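/- **Theorem 4.6.** Let $a_{\max},s:\mathbb N\to\mathbb N$ and $\varepsilon,\delta:\mathbb N\to\mathbb R$ be such that $a_{\max}(n)\ge 1$ for all $n$, $a_{\max}(n)=O(\log n)$, $s$ is a polynomial with natural coefficients and $s(n)\ge n$, $\varepsilon(n)\ge 0$, $\delta(n)\ge \varepsilon(n)+1/(p(n)+1)$ for all $n$ and some polynomial $p$ with natural coefficients, and $\delta(n)=O(n^{-\gamma})$ for some $\gamma>0$. (For example $\varepsilon(n)=1/(n+1)$ and $\delta=2\varepsilon$.) Then estimating the normalized trace $\frac1{2^n}\operatorname{tr}[A]$ of a block-encoded Hermitian matrix $A\in\mathbb C^{2^n\times 2^n}$ up to additive error $\delta(n)$ is $\mathsf{DQC1}$-complete, in the following sense. *Problem.* An instance consists of $n$ and $a\le a_{\max}(n)$ (in unary), the list of at most $s(n)$ gates of a quantum circuit on $a+n$ qubits over the gate set $\{H,T,T^\dagger,\mathrm{CNOT},\mathrm{Toffoli}\}$, and two signed finite binary expansions $\pm b_0.b_1b_2\ldots$ representing numbers $\mathrm{lo},\mathrm{hi}$ with $\mathrm{hi}-\mathrm{lo}\ge 2\delta(n)$.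 The promise is that the unitary $U$ of the circuit is a $(1,a,\varepsilon(n))$ block-encoding of some Hermitian $A\in\mathbb C^{2^n\times 2^n}$, i.e. $\|A-(\langle 0|^{\otimes a}\otimes I)\,U\,(|0\rangle^{\otimes a}\otimes I)\|\le\varepsilon(n)$ in operator norm, with $\frac1{2^n}\operatorname{tr}[A]\ge \mathrm{hi}$ (yes-instances) or $\frac1{2^n}\operatorname{tr}[A]\le \mathrm{lo}$ (no-instances). The task is to decide which of the two holds. *Class.* A promise problem $L=(L_{\rm yes},L_{\rm no})$ over bit strings is in $\mathsf{DQC1}$ if there are functions $\alpha,\beta:\mathbb N\to[0,1]$ whose values are finite binary expansions computable in polynomial time from the argument in unary, with $\beta(k)-\alpha(k)\ge 1/(q(k)+1)$ for all $k$ and some polynomial $q$ with natural coefficients, and a polynomial-time (Turing machine) algorithm that on input $x\in L_{\rm yes}\cup L_{\rm no}$ writes down a circuit $Q_x$ over the same gate set on $m+1$ qubits ($m$ depending on $x$ and written in unary) such that, with $\rho=|0\rangle\langle 0|\otimes 2^{-m}I$, the acceptance probability $\operatorname{tr}[(|1\rangle\langle 1|\otimes I)\,Q_x\rho Q_x^\dagger]$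 is at least $\beta(|x|)$ if $x\in L_{\rm yes}$ and at most $\alpha(|x|)$ if $x\in L_{\rm no}$. *Claim.* The problem above is in $\mathsf{DQC1}$, and every promise problem in $\mathsf{DQC1}$ reduces to it by a polynomial-time many-one reduction. -/

import Mathlib

open Filter Asymptotics

noncomputable section

namespace DQC

/-! ## Quantum circuits

Basis states of `n` qubits are bit vectors `Fin n → Bool`, so operators on `n` qubits are
`2 ^ n × 2 ^ n` matrices indexed by bit vectors. -/

/-- Operators on `n` qubits. -/
abbrev QOp (n : ℕ) : Type := Matrix (Fin n → Bool) (Fin n → Bool) ℂ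

/-- The gate set: Hadamard, `T`, its inverse, controlled-NOT and Toffoli (the Clifford+`T` set; the
inverse of `T` and the Toffoli gate are exact words in the other gates). Control and target qubits
are pairwise distinct. -/
inductive Gate (n : ℕ) : Type
  | hadamard (q : Fin n) : Gate n
  | tGate (q : Fin n) : Gate n
  | tInv (q : Fin n) : Gate n
  | cnot (c t : Fin n) (h : c ≠ t) : Gate n
  | toffoli (c d t : Fin n) (hcd : c ≠ d) (hct : c ≠ t) (hdt : d ≠ t) : Gate n

/-- The unitary of a gate, acting as the identity on the qubits that it does not touch;
the entry at `(y, x)` is the amplitude `⟨y| G |x⟩`. -/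
def Gate.toMatrix {n : ℕ} : Gate n → QOp n
  | .hadamard q => Matrix.of fun y x =>
      if ∀ j, j ≠ q → y j = x j then
        (if x q = true ∧ y q = true then -1 else 1) / (Real.sqrt 2 : ℂ) else 0
  | .tGate q => Matrix.diagonal fun x =>
      if x q = true then Complex.exp (Real.pi / 4 * Complex.I) else 1
  | .tInv q => Matrix.diagonal fun x =>
      if x q = true then Complex.exp (-(Real.pi / 4 * Complex.I)) else 1
  | .cnot c t _ => Matrix.of fun y x =>
      if y = Function.update x t (xor (x t) (x c)) then 1 else 0
  | .toffoli c d t _ _ _ => Matrix.of fun y x =>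
      if y = Function.update x t (xor (x t) (x c && x d)) then 1 else 0

/-- A circuit on `n` qubits: the list of its gates, in the order in which they are applied. -/
abbrev Circuit (n : ℕ) : Type := List (Gate n)

/-- The unitary `U_T ⋯ U_2 U_1` implemented by the circuit `[U_1, U_2, …, U_T]`. -/
def Circuit.toMatrix {n : ℕ} : Circuit n → QOp n
  | [] => 1
  | g :: C => Circuit.toMatrix C * g.toMatrix

/-! ## Classical descriptions as bit strings -/

/-- A list of natural numbers as a bit string: each `k` is written as `k` ones followed by a zero.
This is a prefix code, so the list can be read off from the string. -/
def bits (l : List ℕ) : List Bool :=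
  l.flatMap fun k => List.replicate k true ++ [false]

/-- Gate type followed by the indices of the qubits on which the gate acts. -/
def Gate.code {n : ℕ} : Gate n → List ℕ
  | .hadamard q => [0, q]
  | .tGate q => [1, q]
  | .tInv q => [2, q]
  | .cnot c t _ => [3, c, t]
  | .toffoli c d t _ _ _ => [4, c, d, t]

/-- The sequence of the codes of the gates of a circuit. -/
def Circuit.code {n : ℕ} (C : Circuit n) : List ℕ := C.flatMap Gate.code

/-- A signed finite binary expansion `± b₀.b₁b₂…bₘ`. -/
structure BinaryFraction : Type where
  neg : Bool
  digits : List Bool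

/-- `b₀ + b₁ / 2 + b₂ / 4 + ⋯`. -/
def digitsValue : List Bool → ℝ
  | [] => 0
  | b :: bs => (if b = true then 1 else 0) + digitsValue bs / 2

/-- The real number represented by a signed binary expansion. -/
def BinaryFraction.value (r : BinaryFraction) : ℝ :=
  (if r.neg = true then -1 else 1) * digitsValue r.digits

/-- Sign, digits (each `0` or `1`) and the end marker `2`. -/
def BinaryFraction.code (r : BinaryFraction) : List ℕ :=
  r.neg.toNat :: (r.digits.map Bool.toNat ++ [2])

/-! ## Polynomial time, promise problems and the class DQC1 -/

/-- `f` is computed by a Turing machine in time polynomial in the length of the encoded input. -/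
def PolyTime {X Y : Type} (ex : X → List Bool) (ey : Y → List Bool) (f : X → Y) : Prop :=
  Nonempty (Turing.TM2ComputableInPolyTime ex ey f)

/-- A promise problem over bit strings. -/
structure PromiseProblem : Type where
  yes : Set (List Bool)
  no : Set (List Bool)

/-- The initial state `|0⟩⟨0| ⊗ I / 2 ^ m` of one clean and `m` maximally mixed qubits. -/
def initialState (m : ℕ) : QOp (m + 1) :=
  Matrix.diagonal fun x => if x 0 = false then 1 / 2 ^ m else 0

/-- The projector `|1⟩⟨1| ⊗ I` onto the first qubit being `1`. -/
def acceptProjector (m : ℕ) : QOp (m + 1) :=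
  Matrix.diagonal fun x => if x 0 = true then 1 else 0

/-- The probability `tr[(|1⟩⟨1| ⊗ I) Q ρ Q†]` that measuring the first qubit gives `1` after the
circuit `Q` is run on one clean and `m` maximally mixed qubits. -/
def acceptProb {m : ℕ} (Q : Circuit (m + 1)) : ℝ :=
  (Matrix.trace (acceptProjector m * Q.toMatrix * initialState m * Q.toMatrix.conjTranspose)).re

/-- The description of a one-clean-qubit circuit: the number of mixed qubits, then the gates.
A string of this kind that is written down in polynomial time has polynomially many gates and
qubits, since all numbers are written in unary. -/
def describe {m : ℕ} (Q : Circuit (m + 1)) : List Bool := bits (m :: Circuit.code Q)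

/-- The class DQC1: a polynomial-time algorithm writes down, for every `x` in the promise, a
one-clean-qubit circuit `Q` whose acceptance probability is at least `b` on yes-instances and at
most `a` on no-instances. The thresholds `a < b`, functions of the input length, are separated by an
inverse polynomial and are computable in polynomial time (from the length in unary). -/
def DQC1 : Set PromiseProblem :=
  {L | ∃ (gen : List Bool → List Bool) (a b : ℕ → BinaryFraction) (p : Polynomial ℕ),
    PolyTime id id gen ∧
    PolyTime Computability.unaryEncodeNat (fun r : BinaryFraction => bits r.code) a ∧
    PolyTime Computability.unaryEncodeNat (fun r : BinaryFraction => bits r.code) b ∧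
    (∀ k : ℕ, 0 ≤ (a k).value ∧ (b k).value ≤ 1 ∧
      1 / (((p.eval k : ℕ) : ℝ) + 1) ≤ (b k).value - (a k).value) ∧
    (∀ x ∈ L.yes, ∃ (m : ℕ) (Q : Circuit (m + 1)),
      gen x = describe Q ∧ (b x.length).value ≤ acceptProb Q) ∧
    (∀ x ∈ L.no, ∃ (m : ℕ) (Q : Circuit (m + 1)),
      gen x = describe Q ∧ acceptProb Q ≤ (a x.length).value)}

/-- Polynomial-time many-one reducibility of promise problems. -/
def Reduces (L P : PromiseProblem) : Prop :=
  ∃ f : List Bool → List Bool, PolyTime id id f ∧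
    (∀ x ∈ L.yes, f x ∈ P.yes) ∧ (∀ x ∈ L.no, f x ∈ P.no)

/-- Membership in DQC1 together with DQC1-hardness. -/
def DQC1Complete (P : PromiseProblem) : Prop :=
  P ∈ DQC1 ∧ ∀ L ∈ DQC1, Reduces L P

/-! ## Block-encodings and the trace estimation problem -/

/-- `(⟨0|^{⊗a} ⊗ I) U (|0⟩^{⊗a} ⊗ I)`; the ancillas are the first `a` qubits. -/
def topLeftBlock {n : ℕ} (a : ℕ) (U : QOp (a + n)) : QOp n :=
  Matrix.of fun y x => U (Fin.append (fun _ => false) y) (Fin.append (fun _ => false) x)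

/-- `U` is a `(c, a, ε)` block-encoding of `A`: `U` is unitary and `‖A - c · block‖ ≤ ε` in
operator norm. -/
def IsBlockEncoding {n : ℕ} (c : ℝ) (a : ℕ) (ε : ℝ) (U : QOp (a + n)) (A : QOp n) : Prop :=
  U ∈ Matrix.unitaryGroup (Fin (a + n) → Bool) ℂ ∧
    ‖Matrix.toEuclideanCLM (𝕜 := ℂ) (A - (c : ℂ) • topLeftBlock a U)‖ ≤ ε

/-- An instance: a circuit on `a + n` qubits and two thresholds. -/
structure TraceInstance : Type where
  n : ℕ
  a : ℕ
  circuit : Circuit (a + n)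
  lo : BinaryFraction
  hi : BinaryFraction

/-- The bit string describing an instance. -/
def TraceInstance.describe (I : TraceInstance) : List Bool :=
  bits (I.n :: I.a :: (I.lo.code ++ I.hi.code ++ I.circuit.code))

/-- The instance is well formed for the bounds `anc n` on the number of ancillas, `size n` on the
number of gates, and the accuracy `δ n`: estimating a number to within (less than) `δ n` tells
whether it is at least `hi` or at most `lo`. -/
def TraceInstance.Admissible (I : TraceInstance) (anc : ℕ → ℕ) (size : Polynomial ℕ)
    (δ : ℕ → ℝ) : Prop :=
  I.a ≤ anc I.n ∧ I.circuit.length ≤ size.eval I.n ∧ 2 * δ I.n ≤ I.hi.value - I.lo.value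

/-- The circuit implements a `(1, a, ε n)` block-encoding of the Hermitian matrix `A`. -/
def TraceInstance.Encodes (I : TraceInstance) (ε : ℕ → ℝ) (A : QOp I.n) : Prop :=
  A.IsHermitian ∧ IsBlockEncoding 1 I.a (ε I.n) I.circuit.toMatrix A

/-- Estimating the normalized trace `tr[A] / 2 ^ n` of a block-encoded Hermitian matrix `A` up to
additive error `δ n`, as a promise problem. -/
def traceEstimation (anc : ℕ → ℕ) (size : Polynomial ℕ) (ε δ : ℕ → ℝ) : PromiseProblem where
  yes := {w | ∃ I : TraceInstance, w = I.describe ∧ I.Admissible anc size δ ∧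
    ∃ A, I.Encodes ε A ∧ I.hi.value ≤ A.trace.re / 2 ^ I.n}
  no := {w | ∃ I : TraceInstance, w = I.describe ∧ I.Admissible anc size δ ∧
    ∃ A, I.Encodes ε A ∧ A.trace.re / 2 ^ I.n ≤ I.lo.value}

end DQC

end

/-! Membership rests on the Hadamard test. A circuit that never changes the clean qubit is a pair of
unitaries `C₀`, `C₁` on the `m` mixed qubits, and Hadamard gates around it (with a sign) give the
acceptance probability `1/2 + Re tr(C₁† C₀) / 2^(m+1)` (`acceptProb_hadamardTest`). Averages of
overlaps are therefore accessible, and the mixed qubits act as a random basis state over which the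
average is taken.

In `core` two of these random bits, qubits `7` and `11`, select one of four alternatives with weight
`1/4` each: a diagonal entry of the instance circuit `U`, a sign for the threshold `lo`, a sign for
`hi`, or zero. Only diagonal entries with all block-encoding ancillas zero may count. There are no
clean qubits to test this, but orthogonality suffices: in the branch `C₁` a further qubit is flipped
whenever a test fails, and then the overlap vanishes (`run_core_overlap`). A threshold is realized
as the average of a random sign: the first set bit in a sequence of random bits decides, so that the
`k`-th place has weight `2^(-k)`, as in a binary expansion (`sum_rsgn_decideFirst`,
`kindsValue_kinds`). Altogether the acceptance probability is `1/2 + (tr/2^n - (lo + hi)/2) / (8 *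
2^a)`, with `tr` the trace of the encoded block (`exists_traceCircuit`). Replacing the block by `A`
changes the normalized trace by at most `ε` (`abs_trace_le`). As `δ - ε` is at least inverse
polynomial and `2^a` is polynomial, yes-instances exceed `1/2` by an inverse polynomial, and
no-instances do not exceed `1/2`.

All scratch qubits are dirty. The gadgets use them by toggling twice, so that the unknown initial
value cancels (`run_ladder`, `run_shift`, `run_kill`). The controlled `T` gate is the exception: a
scratch bit that is set turns the controlled circuit into its complex conjugate (`slice_ctrl`). This
is harmless, because only real parts of diagonal entries enter (`run_core_overlap_re`).

For hardness, let `Q` be a one-clean-qubit circuit and let `S` be the diagonal sign that is `1` if a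
fresh selector qubit is `0`, and `2Π - 1` with the accepting projector `Π` if it is `1`. Then `Q† S
Q` is a Hermitian unitary. With the clean qubit as the only ancilla, its block has normalized trace
`(1 + (2p - 1))/2 = p`, the acceptance probability (`exists_blockEncoding`). Idle qubits do not
change normalized traces, so `n` can be made so large that `2 δ(n)` falls below the gap of the DQC1
thresholds (`exists_accuracy`), which then serve as `lo` and `hi`.

Polynomial time refers to actual multi-stack machines. Machines are assembled from small pieces by
sequencing, branching and looping, with a correctness and time statement `Runs` for every construct.
This yields closure under composition and concatenation (`PolyTime.comp`, `PolyTime.append`) and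
token-by-token translation (`polyTime_transduce`), from which the generators of both circuits are
built (`exists_polyTime_traceCircuit`, `exists_polyTime_sandwich`). -/

noncomputable section

namespace DQC

open Turing

/-! ## Open stack machines -/

/-- `Steps f n c c'`: `n` applications of the partial map `f` lead from `c` to `c'`. -/
inductive Steps {C : Type*} (f : C → Option C) : ℕ → C → C → Prop
  | refl (c : C) : Steps f 0 c c
  | head {n : ℕ} {c c₁ c₂ : C} : f c = some c₁ → Steps f n c₁ c₂ → Steps f (n + 1) c c₂

theorem Steps.trans {C : Type*} {f : C → Option C} {n n' : ℕ} {c c₁ c₂ : C}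
    (h : Steps f n c c₁) (h' : Steps f n' c₁ c₂) : Steps f (n + n') c c₂ := by
  induction h with
  | refl => simpa using h'
  | @head n c c₁ _ h _ ih =>
    rw [Nat.add_right_comm]
    exact .head h (ih h')

theorem Steps.congr {C : Type*} {f : C → Option C} {n : ℕ} {c c' d d' : C}
    (h : Steps f n c c') (hc : c = d) (hc' : c' = d') : Steps f n d d' := hc ▸ hc' ▸ h

theorem Steps.map {C D : Type*} {f : C → Option C} {g : D → Option D} (φ : C → D)
    (hφ : ∀ c c', f c = some c' → g (φ c) = some (φ c')) {n : ℕ} {c c' : C}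
    (h : Steps f n c c') : Steps g n (φ c) (φ c') := by
  induction h with
  | refl => exact .refl _
  | head h _ ih => exact .head (hφ _ _ h) ih

theorem Steps.iterate {C : Type*} {f : C → Option C} {n : ℕ} {c c' : C}
    (h : Steps f n c c') : (flip Bind.bind f)^[n] (some c) = some c' := by
  induction h with
  | refl => rfl
  | head h _ ih =>
    rw [Function.iterate_succ_apply, ← ih]
    congr 1

/-- A stack machine without designated stacks; leaving it means halting. -/
structure Frag (K : Type) (Γ : K → Type) (σ : Type) where
  Λ : Type
  fin : Fintype Λ
  entry : Option Λ
  m : Λ → TM2.Stmt Γ Λ σ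

section Stmt

variable {K : Type} {Γ : K → Type} {σ Λ Λ' : Type}

/-- Continue at a label, or halt. -/
def jump : Option Λ → TM2.Stmt Γ Λ σ
  | none => .halt
  | some l => .goto fun _ => l

/-- Rename the labels of a statement and replace halting by a jump. -/
def relabel (φ : Λ → Λ') (ex : Option Λ') : TM2.Stmt Γ Λ σ → TM2.Stmt Γ Λ' σ
  | .push k f q => .push k f (relabel φ ex q)
  | .peek k f q => .peek k f (relabel φ ex q)
  | .pop k f q => .pop k f (relabel φ ex q)
  | .load f q => .load f (relabel φ ex q)
  | .branch f q₁ q₂ => .branch f (relabel φ ex q₁) (relabel φ ex q₂)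
  | .goto l => .goto fun v => φ (l v)
  | .halt => jump ex

/-- The target of a label under `relabel`. -/
def relabelTarget (φ : Λ → Λ') (ex : Option Λ') : Option Λ → Option Λ'
  | none => ex
  | some l => some (φ l)

/-- The effect of `relabel` on configurations. -/
def relabelCfg (φ : Λ → Λ') (ex : Option Λ') (c : TM2.Cfg Γ Λ σ) : TM2.Cfg Γ Λ' σ :=
  ⟨relabelTarget φ ex c.l, c.var, c.stk⟩

variable [DecidableEq K]

theorem stepAux_jump (o : Option Λ) (v : σ) (S : ∀ k, List (Γ k)) :
    TM2.stepAux (jump o) v S = ⟨o, v, S⟩ := by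
  cases o <;> rfl

/-- Executing a statement never inspects a label, so renaming affects only the label of the
resulting configuration. This is what allows verified machines to be glued together without loss of
time. -/
theorem stepAux_relabel (φ : Λ → Λ') (ex : Option Λ') (q : TM2.Stmt Γ Λ σ) (v : σ)
    (S : ∀ k, List (Γ k)) :
    TM2.stepAux (relabel φ ex q) v S = relabelCfg φ ex (TM2.stepAux q v S) := by
  induction q generalizing v S with
  | branch f q₁ q₂ ih₁ ih₂ =>
    simp only [relabel, TM2.stepAux]
    cases f v <;> simp [ih₁, ih₂]
  | goto l => rfl
  | halt => simp [relabel, stepAux_jump, relabelCfg, relabelTarget]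
  | _ => simp only [relabel, TM2.stepAux, *]

theorem Steps.relabel {M : Λ → TM2.Stmt Γ Λ σ} {M' : Λ' → TM2.Stmt Γ Λ' σ} (φ : Λ → Λ')
    (ex : Option Λ') (h : ∀ l, M' (φ l) = DQC.relabel φ ex (M l)) {n : ℕ} {c c' : TM2.Cfg Γ Λ σ}
    (hs : Steps (TM2.step M) n c c') :
    Steps (TM2.step M') n (relabelCfg φ ex c) (relabelCfg φ ex c') := by
  refine hs.map _ ?_
  rintro ⟨_ | l, v, S⟩ c' h'
  · simp at h'
  · simp only [TM2.step, Option.some.injEq] at h'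
    subst h'
    simp [relabelCfg, relabelTarget, TM2.step, h, stepAux_relabel]

end Stmt

namespace Frag

variable {K : Type} {Γ : K → Type} {τ : Type} [DecidableEq K]

/-- `F.Runs t₀ S S' T`: started with the stacks `S`, the machine `F` stops after at most `T` steps
with the stacks `S'`; its internal state is idle before and afterwards. -/
def Runs (t₀ : τ) (F : Frag K Γ (Option Bool × τ)) (S S' : ∀ k, List (Γ k)) (T : ℕ) : Prop :=
  ∃ n ≤ T, Steps (TM2.step F.m) n ⟨F.entry, (none, t₀), S⟩ ⟨none, (none, t₀), S'⟩

variable {t₀ : τ}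

theorem Runs.mono {F : Frag K Γ (Option Bool × τ)} {S S' : ∀ k, List (Γ k)} {T T' : ℕ}
    (h : F.Runs t₀ S S' T) (hT : T ≤ T') : F.Runs t₀ S S' T' :=
  let ⟨n, hn, hs⟩ := h
  ⟨n, hn.trans hT, hs⟩

theorem Runs.congr {F : Frag K Γ (Option Bool × τ)} {S S' S'' : ∀ k, List (Γ k)} {T : ℕ}
    (h : F.Runs t₀ S S' T) (hS : S' = S'') : F.Runs t₀ S S'' T := hS ▸ h

theorem Runs.congr_left {F : Frag K Γ (Option Bool × τ)} {S S' S'' : ∀ k, List (Γ k)} {T : ℕ}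
    (h : F.Runs t₀ S S' T) (hS : S = S'') : F.Runs t₀ S'' S' T := hS ▸ h

/-- Do nothing. -/
def skip : Frag K Γ (Option Bool × τ) := ⟨Empty, inferInstance, none, Empty.elim⟩

theorem Runs.skip (S : ∀ k, List (Γ k)) : (skip : Frag K Γ (Option Bool × τ)).Runs t₀ S S 0 :=
  ⟨0, le_rfl, .refl _⟩

/-- Push a symbol. -/
def push (k : K) (g : Γ k) : Frag K Γ (Option Bool × τ) :=
  ⟨Unit, inferInstance, some (), fun _ => .push k (fun _ => g) .halt⟩

theorem Runs.push (k : K) (g : Γ k) (S : ∀ k, List (Γ k)) :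
    (push k g : Frag K Γ (Option Bool × τ)).Runs t₀ S (Function.update S k (g :: S k)) 1 :=
  ⟨1, le_rfl, .head rfl (.refl _)⟩

/-- Run one machine after another. -/
def seq (F G : Frag K Γ (Option Bool × τ)) : Frag K Γ (Option Bool × τ) where
  Λ := F.Λ ⊕ G.Λ
  fin := @instFintypeSum _ _ F.fin G.fin
  entry := relabelTarget Sum.inl (G.entry.map Sum.inr) F.entry
  m := Sum.elim (fun l => relabel Sum.inl (G.entry.map Sum.inr) (F.m l))
    (fun l => relabel Sum.inr none (G.m l))

theorem Runs.seq {F G : Frag K Γ (Option Bool × τ)} {S S' S'' : ∀ k, List (Γ k)} {T T' : ℕ}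
    (h : F.Runs t₀ S S' T) (h' : G.Runs t₀ S' S'' T') : (F.seq G).Runs t₀ S S'' (T + T') := by
  obtain ⟨n, hn, hs⟩ := h
  obtain ⟨n', hn', hs'⟩ := h'
  refine ⟨n + n', add_le_add hn hn', ?_⟩
  have h1 := hs.relabel (M' := (F.seq G).m) Sum.inl (G.entry.map Sum.inr) (fun _ => rfl)
  have h2 := hs'.relabel (M' := (F.seq G).m) Sum.inr none (fun _ => rfl)
  -- The relabelled end of `F` is the relabelled start of `G`. The case distinction is needed
  -- because `G` may have no entry at all, like `skip`.
  refine Steps.trans h1 (h2.congr ?_ rfl)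
  simp only [relabelCfg, relabelTarget]
  cases G.entry <;> rfl

/-- Pop a symbol into the register and branch on it. -/
def popBranch {Λ σ' : Type} (k : K) (e : Γ k → Bool) (on : Option Bool → Option Λ) :
    TM2.Stmt Γ Λ (Option Bool × σ') :=
  .pop k (fun v o => (o.map e, v.2))
    (.branch (fun v => v.1.isNone) (.load (fun v => (none, v.2)) (jump (on none)))
      (.branch (fun v => v.1 == some true) (.load (fun v => (none, v.2)) (jump (on (some true))))
        (.load (fun v => (none, v.2)) (jump (on (some false))))))

/-- The popped symbol stays in the register only until the branch is taken. The reset to `none`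
restores the idle state that `Runs` asks for. -/
theorem stepAux_popBranch {Λ σ' : Type} (k : K) (e : Γ k → Bool) (on : Option Bool → Option Λ)
    (v : Option Bool × σ') (S : ∀ k, List (Γ k)) :
    TM2.stepAux (popBranch k e on) v S =
      ⟨on ((S k).head?.map e), (none, v.2), Function.update S k (S k).tail⟩ := by
  rcases h : S k with _ | ⟨g, l⟩
  · simp [popBranch, h, stepAux_jump]
  · cases h' : e g <;> simp [popBranch, h, stepAux_jump, h']

/-- Where `popCase` continues after popping. -/
def popTarget (f : Option Bool → Frag K Γ (Option Bool × τ)) (o : Option Bool) :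
    Option (Option (Σ o, (f o).Λ)) :=
  (f o).entry.map fun l => some ⟨o, l⟩

/-- Pop a symbol and continue according to it. -/
def popCase (k : K) (e : Γ k → Bool) (f : Option Bool → Frag K Γ (Option Bool × τ)) :
    Frag K Γ (Option Bool × τ) where
  Λ := Option (Σ o, (f o).Λ)
  fin :=
    have := fun o => (f o).fin
    inferInstance
  entry := some none
  m := fun l => match l with
    | none => popBranch k e (popTarget f)
    | some ⟨o, l⟩ => relabel (fun l => some ⟨o, l⟩) none ((f o).m l)

theorem step_popCase (k : K) (e : Γ k → Bool) (f : Option Bool → Frag K Γ (Option Bool × τ))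
    (v : Option Bool × τ) (S : ∀ k, List (Γ k)) :
    TM2.step (popCase k e f).m ⟨(popCase k e f).entry, v, S⟩ =
      some ⟨(f ((S k).head?.map e)).entry.map fun l => some ⟨_, l⟩, (none, v.2),
        Function.update S k (S k).tail⟩ :=
  congrArg some (stepAux_popBranch k e (popTarget f) v S)

theorem Runs.popCase {k : K} {e : Γ k → Bool} {f : Option Bool → Frag K Γ (Option Bool × τ)}
    {S S' : ∀ k, List (Γ k)} {T : ℕ}
    (h : (f ((S k).head?.map e)).Runs t₀ (Function.update S k (S k).tail) S' T) :
    (popCase k e f).Runs t₀ S S' (T + 1) := by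
  obtain ⟨n, hn, hs⟩ := h
  refine ⟨n + 1, by omega, ?_⟩
  refine .head (step_popCase ..) ?_
  generalize (S k).head?.map e = o at *
  have h1 := hs.relabel (M' := (Frag.popCase k e f).m) (fun l => some ⟨o, l⟩) none (fun _ => rfl)
  refine h1.congr ?_ rfl
  simp only [relabelCfg]
  cases (f o).entry <;> rfl

/-- Where `loop` continues after popping. -/
def loopTarget (isEnd : Bool → Bool) (f : Bool → Frag K Γ (Option Bool × τ)) :
    Option Bool → Option (Option (Σ b, (f b).Λ))
  | none => none
  | some b => if isEnd b then none else some ((f b).entry.map fun l => ⟨b, l⟩)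

/-- Pop symbols and run the associated machine, until the stack is empty or a symbol satisfying
`isEnd` has been popped. -/
def loop (k : K) (e : Γ k → Bool) (isEnd : Bool → Bool)
    (f : Bool → Frag K Γ (Option Bool × τ)) : Frag K Γ (Option Bool × τ) where
  Λ := Option (Σ b, (f b).Λ)
  fin :=
    have := fun o => (f o).fin
    inferInstance
  entry := some none
  m := fun l => match l with
    | none => popBranch k e (loopTarget isEnd f)
    | some ⟨b, l⟩ => relabel (fun l => some ⟨b, l⟩) (some none) ((f b).m l)

theorem step_loop (k : K) (e : Γ k → Bool) (isEnd : Bool → Bool)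
    (f : Bool → Frag K Γ (Option Bool × τ)) (v : Option Bool × τ) (S : ∀ k, List (Γ k)) :
    TM2.step (loop k e isEnd f).m ⟨(loop k e isEnd f).entry, v, S⟩ =
      some ⟨loopTarget isEnd f ((S k).head?.map e), (none, v.2),
        Function.update S k (S k).tail⟩ :=
  congrArg some (stepAux_popBranch k e (loopTarget isEnd f) v S)

theorem Runs.loop_nil {k : K} {e : Γ k → Bool} {isEnd : Bool → Bool}
    {f : Bool → Frag K Γ (Option Bool × τ)} {S : ∀ k, List (Γ k)} (h : S k = []) :
    (loop k e isEnd f).Runs t₀ S S 1 := by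
  refine ⟨1, le_rfl, .head (step_loop ..) ?_⟩
  have : Function.update S k (S k).tail = S := by
    rw [h, List.tail_nil, ← h, Function.update_eq_self]
  rw [this, h]
  exact .refl _

theorem Runs.loop_stop {k : K} {e : Γ k → Bool} {isEnd : Bool → Bool}
    {f : Bool → Frag K Γ (Option Bool × τ)} {S : ∀ k, List (Γ k)} {g : Γ k} {l : List (Γ k)}
    (h : S k = g :: l) (hg : isEnd (e g) = true) :
    (loop k e isEnd f).Runs t₀ S (Function.update S k l) 1 := by
  refine ⟨1, le_rfl, .head (step_loop ..) ?_⟩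
  simp only [h, List.head?_cons, Option.map_some, loopTarget, hg, if_true, List.tail_cons]
  exact .refl _

theorem Runs.loop_step {k : K} {e : Γ k → Bool} {isEnd : Bool → Bool}
    {f : Bool → Frag K Γ (Option Bool × τ)} {S S' S'' : ∀ k, List (Γ k)} {g : Γ k}
    {l : List (Γ k)} {T T' : ℕ} (h : S k = g :: l) (hg : isEnd (e g) = false)
    (hb : (f (e g)).Runs t₀ (Function.update S k l) S' T)
    (hl : (loop k e isEnd f).Runs t₀ S' S'' T') :
    (loop k e isEnd f).Runs t₀ S S'' (T + T' + 1) := by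
  obtain ⟨n, hn, hs⟩ := hb
  obtain ⟨n', hn', hs'⟩ := hl
  refine ⟨n + n' + 1, by omega, .head (step_loop ..) ?_⟩
  have h1 := hs.relabel (M' := (loop k e isEnd f).m) (fun l => some ⟨e g, l⟩) (some none)
    (fun _ => rfl)
  refine Steps.trans (h1.congr ?_ rfl) hs'
  simp only [relabelCfg, h, List.head?_cons, Option.map_some, loopTarget, hg, List.tail_cons]
  cases (f (e g)).entry <;> rfl

/-- Move the contents of stack `a` onto stack `b`, reversing their order. -/
def move (a b : K) (ea : Γ a → Bool) (eb : Bool → Γ b) : Frag K Γ (Option Bool × τ) :=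
  loop a ea (fun _ => false) fun c => push b (eb c)

theorem Runs.move {a b : K} (hab : a ≠ b) (ea : Γ a → Bool) (eb : Bool → Γ b)
    (S : ∀ k, List (Γ k)) :
    (move a b ea eb : Frag K Γ (Option Bool × τ)).Runs t₀ S
      (Function.update (Function.update S a []) b
        (((S a).map fun g => eb (ea g)).reverse ++ S b)) (2 * (S a).length + 1) := by
  generalize h : S a = l
  induction l generalizing S with
  | nil =>
    have : Function.update (Function.update S a []) b
        ((([] : List (Γ a)).map fun g => eb (ea g)).reverse ++ S b) = S := by
      rw [List.map_nil, List.reverse_nil, List.nil_append]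
      simp [← h]
    rw [this]
    exact Runs.loop_nil h
  | cons g l ih =>
    have h1 := Runs.push (t₀ := t₀) b (eb (ea g)) (Function.update S a l)
    have h2 := ih (Function.update (Function.update S a l) b
      (eb (ea g) :: Function.update S a l b)) (by simp [hab])
    refine (Runs.loop_step h rfl h1 ?_).mono (T := 1 + (2 * l.length + 1) + 1)
      (by simp only [List.length_cons]; omega)
    refine h2.congr ?_
    funext k
    by_cases hk : k = b
    · subst hk; simp [Ne.symm hab]
    · by_cases hk' : k = a
      · subst hk'; simp [hk]
      · simp [hk, hk']

end Frag

/-- The stack contents with a single nonempty stack. -/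
def single {K : Type} [DecidableEq K] {Γ : K → Type} (k : K) (l : List (Γ k)) :
    ∀ k, List (Γ k) :=
  Function.update (fun _ => []) k l

theorem initList_eq (tm : FinTM2) (l : List (tm.Γ tm.k₀)) :
    initList tm l = ⟨some tm.main, tm.initialState, single tm.k₀ l⟩ := by
  refine congrArg (TM2.Cfg.mk _ _) (funext fun k => ?_)
  by_cases hk : k = tm.k₀
  · subst hk; simp [single]
  · simp [single, hk]

theorem haltList_eq (tm : FinTM2) (l : List (tm.Γ tm.k₁)) :
    haltList tm l = ⟨none, tm.initialState, single tm.k₁ l⟩ := by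
  refine congrArg (TM2.Cfg.mk _ _) (funext fun k => ?_)
  by_cases hk : k = tm.k₁
  · subst hk; simp [single]
  · simp [single, hk]

theorem PolyTime.of_frag {K τ : Type} {Γ : K → Type} [DecidableEq K] [Fintype K] [Fintype τ]
    (t₀ : τ) (F : Frag K Γ (Option Bool × τ)) (i o : K) (ei : Γ i ≃ Bool) (eo : Γ o ≃ Bool)
    {X Y : Type} {ex : X → List Bool} {ey : Y → List Bool} {f : X → Y} (p : Polynomial ℕ)
    (h : ∀ x, F.Runs t₀ (single i ((ex x).map ei.symm)) (single o ((ey (f x)).map eo.symm))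
      (p.eval (ex x).length)) : PolyTime ex ey f := by
  classical
  have := F.fin
  have : Fintype (Γ i) := Fintype.ofEquiv _ ei.symm
  -- A `FinTM2` must start at a label, but `F` may have no entry. The extra label `none` only halts;
  -- it also receives the exit of `F` and costs the one additional step in `p + 1`.
  let tm : FinTM2 :=
    { K := K, k₀ := i, k₁ := o, Γ := Γ, Λ := Option F.Λ, main := F.entry,
      σ := Option Bool × τ, initialState := (none, t₀),
      m := fun l => match l with
        | none => .halt
        | some l => relabel some (some none) (F.m l) }
  choose n hn hs using h
  refine ⟨⟨⟨tm, ei, eo⟩, p + 1, fun x => ⟨⟨n x + 1, ?_⟩, ?_⟩⟩⟩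
  · have h1 := (hs x).relabel (M' := tm.m) some (some none) (fun _ => rfl)
    have h2 : Steps (TM2.step tm.m) 1 ⟨some none, (none, t₀), single o ((ey (f x)).map eo.symm)⟩
        ⟨none, (none, t₀), single o ((ey (f x)).map eo.symm)⟩ := .head rfl (.refl _)
    refine Eq.trans ?_ ((h1.trans h2).iterate.trans ?_)
    · refine congrArg _ (congrArg some ((initList_eq tm _).trans ?_))
      simp only [relabelCfg]
      cases h : F.entry <;> simp only [tm, h] <;> rfl
    · exact congrArg some (haltList_eq tm _).symm
  · simpa using hn x

/-! ## Closure of polynomial time under composition and concatenation -/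

theorem natPolynomial_eval_mono (p : Polynomial ℕ) : Monotone fun n : ℕ => p.eval n := by
  intro a b h
  simp only [Polynomial.eval_eq_sum, Polynomial.sum]
  exact Finset.sum_le_sum fun i _ => Nat.mul_le_mul_left _ (Nat.pow_le_pow_left h i)

theorem Steps.of_iterate {C : Type*} {f : C → Option C} {n : ℕ} {c c' : C}
    (h : (flip Bind.bind f)^[n] (some c) = some c') : Steps f n c c' := by
  induction n generalizing c with
  | zero =>
    cases h
    exact .refl _
  | succ n ih =>
    rw [Function.iterate_succ_apply] at h
    rcases h' : f c with _ | c₁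
    · have hnone : ∀ n, (flip Bind.bind f)^[n] (none : Option C) = none := fun n => by
        induction n with
        | zero => rfl
        | succ n ih => rw [Function.iterate_succ_apply]; exact ih
      have : flip Bind.bind f (some c) = none := h'
      rw [this, hnone] at h
      cases h
    · have : flip Bind.bind f (some c) = some c₁ := h'
      rw [this] at h
      exact .head h' (ih h)

/-- The number of pushes in a statement. -/
def pushes {K : Type} {Γ : K → Type} {Λ σ : Type} : TM2.Stmt Γ Λ σ → ℕ
  | .push _ _ q => pushes q + 1
  | .peek _ _ q => pushes q
  | .pop _ _ q => pushes q
  | .load _ q => pushes q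
  | .branch _ q₁ q₂ => pushes q₁ + pushes q₂
  | .goto _ => 0
  | .halt => 0

section

variable {K : Type} {Γ : K → Type} {Λ σ : Type} [DecidableEq K]

theorem length_stepAux_le (q : TM2.Stmt Γ Λ σ) (v : σ) (S : ∀ k, List (Γ k)) (k : K) :
    ((TM2.stepAux q v S).stk k).length ≤ (S k).length + pushes q := by
  induction q generalizing v S with
  | push k' f q ih =>
    refine (ih _ _).trans ?_
    by_cases h : k = k'
    · subst h; simp [pushes, Nat.add_assoc, Nat.add_comm 1]
    · simp [pushes, h]
  | pop k' f q ih =>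
    refine (ih _ _).trans ?_
    by_cases h : k = k'
    · subst h; simp [pushes]
    · simp [pushes, h]
  | peek k' f q ih => exact ih _ _
  | load f q ih => exact ih _ _
  | branch f q₁ q₂ ih₁ ih₂ =>
    simp only [TM2.stepAux, pushes]
    cases f v
    · exact (ih₂ _ _).trans (by omega)
    · exact (ih₁ _ _).trans (by omega)
  | goto => exact Nat.le_add_right _ _
  | halt => exact Nat.le_add_right _ _

theorem Steps.length_le {M : Λ → TM2.Stmt Γ Λ σ} {B : ℕ} (hB : ∀ l, pushes (M l) ≤ B) {n : ℕ}
    {c c' : TM2.Cfg Γ Λ σ} (h : Steps (TM2.step M) n c c') (k : K) :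
    (c'.stk k).length ≤ (c.stk k).length + B * n := by
  induction h with
  | refl => simp
  | @head n c c₁ c₂ h _ ih =>
    rcases c with ⟨_ | l, v, S⟩
    · simp at h
    · simp only [TM2.step, Option.some.injEq] at h
      have h1 := length_stepAux_le (M l) v S k
      rw [h] at h1
      have h2 := hB l
      rw [Nat.mul_succ]
      simp only at ih ⊢
      omega

end

/-- The output of a polynomial-time function has polynomial length. -/
theorem length_le_of_computable {X Y : Type} {ex : X → List Bool} {ey : Y → List Bool} {f : X → Y}
    (h : TM2ComputableInPolyTime ex ey f) :
    ∃ p : Polynomial ℕ, ∀ x, (ey (f x)).length ≤ p.eval (ex x).length := by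
  classical
  -- There are finitely many labels, so one constant bounds the growth of a stack per step; the
  -- output is no longer than the input plus `B` times the running time.
  obtain ⟨B, hB⟩ : ∃ B, ∀ l, pushes (h.tm.m l) ≤ B := by
    have := h.tm.ΛFin
    exact ⟨∑ l, pushes (h.tm.m l), fun l =>
      Finset.single_le_sum (f := fun l => pushes (h.tm.m l)) (fun _ _ => Nat.zero_le _)
        (Finset.mem_univ l)⟩
  refine ⟨.X + .C B * h.time, fun x => ?_⟩
  obtain ⟨⟨n, hn⟩, hle⟩ := h.outputsFun x
  have h1 := (Steps.of_iterate hn).length_le hB h.tm.k₁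
  rw [haltList_eq, initList_eq] at h1
  have h2 : ((single h.tm.k₀ (List.map h.inputAlphabet.invFun (ex x)) :
      ∀ k, List (h.tm.Γ k)) h.tm.k₁).length ≤ (ex x).length := by
    generalize h.tm.k₁ = k
    by_cases hk : k = h.tm.k₀
    · subst hk; simp [single]
    · simp [single, hk]
  have h3 : B * n ≤ B * h.time.eval (ex x).length := Nat.mul_le_mul_left _ hle
  simp only [single, Function.update_self, List.length_map] at h1 h2
  simp only [Polynomial.eval_add, Polynomial.eval_X, Polynomial.eval_mul, Polynomial.eval_C]
  omega

/-! ### Two machines side by side, with bit stacks for passing data -/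

section Box

variable (tm : Bool → FinTM2)

/-- Three bit stacks and the stacks of two machines. -/
abbrev BoxK : Type := Fin 3 ⊕ Σ i, (tm i).K

/-- The stack alphabets. -/
@[reducible] def BoxΓ : BoxK tm → Type
  | .inl _ => Bool
  | .inr p => (tm p.1).Γ p.2

/-- The internal states. -/
abbrev Boxτ : Type := ∀ i, (tm i).σ

/-- The idle state. -/
def boxIdle : Boxτ tm := fun i => (tm i).initialState

/-- Assemble stack contents. -/
def comb (B : Fin 3 → List Bool) (P : ∀ i k, List ((tm i).Γ k)) : ∀ k, List (BoxΓ tm k)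
  | .inl j => B j
  | .inr p => P p.1 p.2

variable {tm}

theorem comb_update_inl (B : Fin 3 → List Bool) (P : ∀ i k, List ((tm i).Γ k)) (j : Fin 3)
    (l : List Bool) :
    Function.update (comb tm B P) (.inl j) l = comb tm (Function.update B j l) P := by
  funext k
  rcases k with k | p
  · by_cases h : k = j
    · subst h; simp [comb]
    · simp [comb, h]
  · simp [comb]

theorem comb_update_inr (B : Fin 3 → List Bool) (P : ∀ i k, List ((tm i).Γ k)) (i : Bool)
    (k : (tm i).K) (l : List ((tm i).Γ k)) :
    Function.update (comb tm B P) (.inr ⟨i, k⟩) l =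
      comb tm B (Function.update P i (Function.update (P i) k l)) := by
  funext k'
  rcases k' with k' | ⟨i', k'⟩
  · simp [comb]
  · by_cases h : i' = i
    · subst h
      by_cases h' : k' = k
      · subst h'; simp [comb]
      · simp [comb, h']
    · simp [comb, h]

/-- A statement of one of the machines, acting on its stacks and its internal state. -/
def liftStmt (i : Bool) : TM2.Stmt (tm i).Γ (tm i).Λ (tm i).σ →
    TM2.Stmt (BoxΓ tm) (tm i).Λ (Option Bool × Boxτ tm)
  | .push k f q => .push (.inr ⟨i, k⟩) (fun v => f (v.2 i)) (liftStmt i q)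
  | .peek k f q => .peek (.inr ⟨i, k⟩) (fun v o => (v.1, Function.update v.2 i (f (v.2 i) o)))
      (liftStmt i q)
  | .pop k f q => .pop (.inr ⟨i, k⟩) (fun v o => (v.1, Function.update v.2 i (f (v.2 i) o)))
      (liftStmt i q)
  | .load f q => .load (fun v => (v.1, Function.update v.2 i (f (v.2 i)))) (liftStmt i q)
  | .branch f q₁ q₂ => .branch (fun v => f (v.2 i)) (liftStmt i q₁) (liftStmt i q₂)
  | .goto l => .goto fun v => l (v.2 i)
  | .halt => .halt

/-- A configuration of one of the machines in the context of the others. -/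
def boxCfg (i : Bool) (B : Fin 3 → List Bool) (P : ∀ i k, List ((tm i).Γ k)) (c : (tm i).Cfg) :
    TM2.Cfg (BoxΓ tm) (tm i).Λ (Option Bool × Boxτ tm) :=
  ⟨c.l, (none, Function.update (boxIdle tm) i c.var), comb tm B (Function.update P i c.stk)⟩

/-- A lifted statement reads and writes only the stacks and the state component of its own machine,
so the context is carried along unchanged. -/
theorem stepAux_liftStmt (i : Bool) (B : Fin 3 → List Bool) (P : ∀ i k, List ((tm i).Γ k))
    (q : TM2.Stmt (tm i).Γ (tm i).Λ (tm i).σ) (v : (tm i).σ) (S : ∀ k, List ((tm i).Γ k)) :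
    TM2.stepAux (liftStmt i q) (none, Function.update (boxIdle tm) i v)
        (comb tm B (Function.update P i S)) = boxCfg i B P (TM2.stepAux q v S) := by
  induction q generalizing v S with
  | push k f q ih =>
    simp only [liftStmt, TM2.stepAux, ← ih]
    rw [comb_update_inr]
    simp [comb]
  | peek k f q ih => simp [liftStmt, TM2.stepAux, ← ih, comb]
  | pop k f q ih =>
    simp only [liftStmt, TM2.stepAux, ← ih]
    rw [comb_update_inr]
    simp [comb]
  | load f q ih => simp [liftStmt, TM2.stepAux, ← ih]
  | branch f q₁ q₂ ih₁ ih₂ =>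
    simp only [liftStmt, TM2.stepAux, Function.update_self]
    cases f v <;> simp [ih₁, ih₂]
  | goto l => simp [liftStmt, TM2.stepAux, boxCfg]
  | halt => simp [liftStmt, TM2.stepAux, boxCfg]

/-- One of the machines as an open machine. -/
def box (i : Bool) : Frag (BoxK tm) (BoxΓ tm) (Option Bool × Boxτ tm) where
  Λ := (tm i).Λ
  fin := (tm i).ΛFin
  entry := some (tm i).main
  m := fun l => liftStmt i ((tm i).m l)

/-- Regular termination means being back in the initial state with nothing but the output on the
stacks. A boxed machine is therefore idle again and other pieces can follow it. -/
theorem Runs.box (i : Bool) (B : Fin 3 → List Bool) (P : ∀ i k, List ((tm i).Γ k))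
    {l : List ((tm i).Γ (tm i).k₀)} {l' : List ((tm i).Γ (tm i).k₁)} {T : ℕ}
    (h : TM2OutputsInTime (tm i) l (some l') T) :
    (box i).Runs (boxIdle tm) (comb tm B (Function.update P i (single _ l)))
      (comb tm B (Function.update P i (single _ l'))) T := by
  obtain ⟨⟨n, hn⟩, hle⟩ := h
  refine ⟨n, hle, ?_⟩
  have h1 := Steps.of_iterate hn
  rw [haltList_eq, initList_eq] at h1
  have h2 := h1.map (g := TM2.step (DQC.box (tm := tm) i).m) (boxCfg i B P) (by
    rintro ⟨_ | l, v, S⟩ c' h'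
    · cases h'
    · cases h'
      exact congrArg some (stepAux_liftStmt i B P _ v S))
  have h3 : Function.update (boxIdle tm) i (tm i).initialState = boxIdle tm :=
    Function.update_eq_self i (boxIdle tm)
  simp only [boxCfg, h3] at h2
  exact h2

/-- Move a bit stack to a stack of one of the machines. -/
theorem Runs.moveIn (i : Bool) (k : (tm i).K) (eb : Bool → (tm i).Γ k) (j : Fin 3)
    (B : Fin 3 → List Bool) (P : ∀ i k, List ((tm i).Γ k)) :
    (Frag.move (Γ := BoxΓ tm) (.inl j) (.inr ⟨i, k⟩) id eb).Runs (boxIdle tm) (comb tm B P)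
      (comb tm (Function.update B j [])
        (Function.update P i (Function.update (P i) k (((B j).map eb).reverse ++ P i k))))
      (2 * (B j).length + 1) := by
  have h := Frag.Runs.move (t₀ := boxIdle tm) (Γ := BoxΓ tm) (a := .inl j) (b := .inr ⟨i, k⟩)
    (by simp) id eb (comb tm B P)
  rw [comb_update_inl, comb_update_inr] at h
  exact h

/-- Move a stack of one of the machines to a bit stack. -/
theorem Runs.moveOut (i : Bool) (k : (tm i).K) (ea : (tm i).Γ k → Bool) (j : Fin 3)
    (B : Fin 3 → List Bool) (P : ∀ i k, List ((tm i).Γ k)) :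
    (Frag.move (Γ := BoxΓ tm) (.inr ⟨i, k⟩) (.inl j) ea id).Runs (boxIdle tm) (comb tm B P)
      (comb tm (Function.update B j (((P i k).map ea).reverse ++ B j))
        (Function.update P i (Function.update (P i) k [])))
      (2 * (P i k).length + 1) := by
  have h := Frag.Runs.move (t₀ := boxIdle tm) (Γ := BoxΓ tm) (a := .inr ⟨i, k⟩) (b := .inl j)
    (by simp) ea id (comb tm B P)
  rw [comb_update_inr, comb_update_inl] at h
  exact h

/-- Move a bit stack to another bit stack. -/
theorem Runs.moveBits {j j' : Fin 3} (hj : j ≠ j') (B : Fin 3 → List Bool)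
    (P : ∀ i k, List ((tm i).Γ k)) :
    (Frag.move (Γ := BoxΓ tm) (.inl j) (.inl j') id id).Runs (boxIdle tm) (comb tm B P)
      (comb tm (Function.update (Function.update B j []) j' ((B j).reverse ++ B j')) P)
      (2 * (B j).length + 1) := by
  have h := Frag.Runs.move (t₀ := boxIdle tm) (Γ := BoxΓ tm) (a := .inl j) (b := .inl j')
    (by simpa using hj) id id (comb tm B P)
  rw [comb_update_inl, comb_update_inl] at h
  refine h.congr ?_
  have : List.map (fun g : Bool => id (id g)) (comb tm B P (Sum.inl j)) = B j := List.map_id _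
  rw [this]
  rfl

/-- All stacks empty but one bit stack. -/
def bitState (j : Fin 3) (l : List Bool) : ∀ k, List (BoxΓ tm k) :=
  comb tm (Function.update (fun _ => []) j l) (fun _ _ => [])

/-- All stacks empty but one stack of one of the machines. -/
def machineState (i : Bool) (k : (tm i).K) (l : List ((tm i).Γ k)) : ∀ k, List (BoxΓ tm k) :=
  comb tm (fun _ => []) (Function.update (fun _ _ => []) i (single k l))

theorem Runs.bitState_move {j j' : Fin 3} (hj : j ≠ j') (l : List Bool) :
    (Frag.move (Γ := BoxΓ tm) (.inl j) (.inl j') id id).Runs (boxIdle tm) (bitState j l)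
      (bitState j' l.reverse) (2 * l.length + 1) := by
  have h := Runs.moveBits (tm := tm) hj (Function.update (fun _ => []) j l) (fun _ _ => [])
  simp only [Function.update_self, Function.update_idem, Function.update_of_ne hj.symm,
    List.append_nil] at h
  rwa [Function.update_eq_self_iff.2 rfl] at h

theorem Runs.machineState_of_bitState (i : Bool) (k : (tm i).K) (e : (tm i).Γ k ≃ Bool)
    (j : Fin 3) (l : List Bool) :
    (Frag.move (Γ := BoxΓ tm) (.inl j) (.inr ⟨i, k⟩) id e.symm).Runs (boxIdle tm) (bitState j l)
      (machineState i k (l.reverse.map e.symm)) (2 * l.length + 1) := by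
  have h := Runs.moveIn (tm := tm) i k e.symm j (Function.update (fun _ => []) j l)
    (fun _ _ => [])
  simp only [Function.update_self, Function.update_idem, List.append_nil] at h
  rwa [Function.update_eq_self_iff.2 rfl, ← List.map_reverse] at h

theorem Runs.bitState_of_machineState (i : Bool) (k : (tm i).K) (e : (tm i).Γ k ≃ Bool)
    (j : Fin 3) (l : List Bool) :
    (Frag.move (Γ := BoxΓ tm) (.inr ⟨i, k⟩) (.inl j) e id).Runs (boxIdle tm)
      (machineState i k (l.map e.symm)) (bitState j l.reverse) (2 * l.length + 1) := by
  have h := Runs.moveOut (tm := tm) i k e j (fun _ => [])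
    (Function.update (fun _ _ => []) i (single k (l.map e.symm)))
  simp only [single, Function.update_self, Function.update_idem, List.append_nil, List.map_map,
    Equiv.self_comp_symm, List.map_id, List.length_map] at h
  rwa [Function.update_eq_self_iff.2 rfl, Function.update_eq_self_iff.2 rfl] at h

theorem Runs.machineState (i : Bool) {l : List ((tm i).Γ (tm i).k₀)}
    {l' : List ((tm i).Γ (tm i).k₁)} {T : ℕ} (h : TM2OutputsInTime (tm i) l (some l') T) :
    (DQC.box i).Runs (boxIdle tm) (machineState i _ l) (machineState i _ l') T :=
  Runs.box i (fun _ => []) (fun _ _ => []) h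

theorem single_inl (j : Fin 3) (l : List Bool) :
    (single (.inl j) l : ∀ k, List (BoxΓ tm k)) =
      bitState j l := by
  rw [bitState, ← comb_update_inl]
  unfold single
  congr 1
  funext k
  rcases k with k | p <;> rfl


end Box

variable {X Y Z : Type} {ex : X → List Bool} {ey : Y → List Bool} {ez : Z → List Bool}

/-- The family of two machines. -/
def boxPair (m₁ m₂ : FinTM2) : Bool → FinTM2 := fun i => cond i m₁ m₂

theorem update_single {K : Type} [DecidableEq K] {Γ : K → Type} (k : K) (l l' : List (Γ k)) :
    Function.update (single k l) k l' = single k l' := by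
  simp [single]

theorem single_nil {K : Type} [DecidableEq K] {Γ : K → Type} (k : K) :
    (single k [] : ∀ k, List (Γ k)) = fun _ => [] := by
  simp [single]

/-- Strings travel between the machines through bit stack `2`: every move reverses, so two moves
restore the order. The second running time is polynomial in the first input because the intermediate
string has polynomial length. -/
theorem PolyTime.comp {f : X → Y} {g : Y → Z} (hg : PolyTime ey ez g) (hf : PolyTime ex ey f) :
    PolyTime ex ez (fun x => g (f x)) := by
  classical
  obtain ⟨cf⟩ := hf
  obtain ⟨cg⟩ := hg
  obtain ⟨pf, hpf⟩ := length_le_of_computable cf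
  obtain ⟨pg, hpg⟩ := length_le_of_computable cg
  let tm := boxPair cf.tm cg.tm
  have := cf.tm.kFin
  have := cg.tm.kFin
  have := cf.tm.σFin
  have := cg.tm.σFin
  have : ∀ i, Fintype (tm i).K := fun i => (tm i).kFin
  have : ∀ i, Fintype (tm i).σ := fun i => (tm i).σFin
  let F : Frag (BoxK tm) (BoxΓ tm) (Option Bool × Boxτ tm) :=
    (Frag.move (.inl 0) (.inl 2) id id).seq <|
    (Frag.move (.inl 2) (.inr ⟨true, cf.tm.k₀⟩) id cf.inputAlphabet.symm).seq <|
    (box true).seq <|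
    (Frag.move (.inr ⟨true, cf.tm.k₁⟩) (.inl 2) cf.outputAlphabet id).seq <|
    (Frag.move (.inl 2) (.inr ⟨false, cg.tm.k₀⟩) id cg.inputAlphabet.symm).seq <|
    (box false).seq <|
    (Frag.move (.inr ⟨false, cg.tm.k₁⟩) (.inl 2) cg.outputAlphabet id).seq <|
    Frag.move (.inl 2) (.inl 1) id id
  refine PolyTime.of_frag (boxIdle tm) F (.inl 0) (.inl 1) (Equiv.refl _) (Equiv.refl _)
    (4 * .X + cf.time + 4 * pf + cg.time.comp pf + 4 * pg.comp pf + 6) fun x => ?_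
  have h := (Runs.bitState_move (tm := tm) (j := 0) (j' := 2) (by decide) (ex x)).seq <|
    (Runs.machineState_of_bitState (tm := tm) true cf.tm.k₀ cf.inputAlphabet 2 _).seq <|
    (Runs.machineState (tm := tm) true (by rw [List.reverse_reverse]; exact cf.outputsFun x)).seq <|
    (Runs.bitState_of_machineState (tm := tm) true cf.tm.k₁ cf.outputAlphabet 2 (ey (f x))).seq <|
    (Runs.machineState_of_bitState (tm := tm) false cg.tm.k₀ cg.inputAlphabet 2 _).seq <|
    (Runs.machineState (tm := tm) false (by rw [List.reverse_reverse]; exact cg.outputsFun (f x))).seq <|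
    (Runs.bitState_of_machineState (tm := tm) false cg.tm.k₁ cg.outputAlphabet 2 _).seq <|
    (Runs.bitState_move (tm := tm) (j := 2) (j' := 1) (by decide) (ez (g (f x))).reverse)
  simp only [Equiv.refl_symm, Equiv.coe_refl, List.map_id]
  rw [single_inl, single_inl]
  rw [List.reverse_reverse] at h
  refine h.mono ?_
  have h1 := hpf x
  have h2 := hpg (f x)
  have h3 := natPolynomial_eval_mono pg h1
  have h4 := natPolynomial_eval_mono cg.time h1
  simp only at h3 h4
  simp only [Polynomial.eval_add, Polynomial.eval_mul, Polynomial.eval_comp, Polynomial.eval_X,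
    Polynomial.eval_ofNat, List.length_reverse]
  omega

/-- Stack contents of both machines. -/
def two {tm : Bool → FinTM2} (S₁ : ∀ k, List ((tm true).Γ k)) (S₂ : ∀ k, List ((tm false).Γ k)) :
    ∀ i k, List ((tm i).Γ k)
  | true => S₁
  | false => S₂

section

variable {tm : Bool → FinTM2} (S₁ S : ∀ k, List ((tm true).Γ k))
  (S₂ S' : ∀ k, List ((tm false).Γ k))

theorem update_two_true : Function.update (two S₁ S₂) true S = two S S₂ := by
  funext i; cases i <;> simp [two]

theorem update_two_false : Function.update (two S₁ S₂) false S' = two S₁ S' := by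
  funext i; cases i <;> simp [two]

theorem two_nil : two (tm := tm) (fun _ => []) (fun _ => []) = fun _ _ => [] := by
  funext i; cases i <;> simp [two]

end

/-- Copy a bit stack to stacks of both machines. -/
theorem Runs.copyIn {tm : Bool → FinTM2} (k : (tm true).K) (k' : (tm false).K)
    (e : Bool → (tm true).Γ k) (e' : Bool → (tm false).Γ k') (l : List Bool)
    (l₁ : List ((tm true).Γ k)) (l₂ : List ((tm false).Γ k')) :
    (Frag.loop (Γ := BoxΓ tm) (.inl 2) id (fun _ => false) fun b =>
        (Frag.push (.inr ⟨true, k⟩) (e b)).seq (Frag.push (.inr ⟨false, k'⟩) (e' b))).Runs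
      (boxIdle tm)
      (comb tm (Function.update (fun _ => []) 2 l) (two (single k l₁) (single k' l₂)))
      (comb tm (fun _ => [])
        (two (single k ((l.map e).reverse ++ l₁)) (single k' ((l.map e').reverse ++ l₂))))
      (3 * l.length + 1) := by
  induction l generalizing l₁ l₂ with
  | nil =>
    rw [Function.update_eq_self_iff.2 rfl]
    exact Frag.Runs.loop_nil rfl
  | cons b l ih =>
    have h1 := ih (e b :: l₁) (e' b :: l₂)
    have h2 := (Frag.Runs.push (t₀ := boxIdle tm) (Γ := BoxΓ tm) (.inr ⟨true, k⟩) (e b)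
      (comb tm (Function.update (fun _ => []) 2 l) (two (single k l₁) (single k' l₂)))).seq
      (Frag.Runs.push (t₀ := boxIdle tm) (Γ := BoxΓ tm) (.inr ⟨false, k'⟩) (e' b) _)
    rw [comb_update_inr, comb_update_inr, update_two_true, update_two_false] at h2
    refine (Frag.Runs.loop_step (g := b) (l := l) (T := 2) (T' := 3 * l.length + 1)
      (by simp [comb]) rfl ((h2.congr_left ?_)) ((h1.congr (by simp)).congr_left ?_)).mono
      (by simp only [List.length_cons]; omega)
    · rw [comb_update_inl, Function.update_idem]
    · simp [two, single, comb]

section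

variable {tm : Bool → FinTM2} (i₁ : (tm true).Γ (tm true).k₀ ≃ Bool)
  (o₁ : (tm true).Γ (tm true).k₁ ≃ Bool) (i₂ : (tm false).Γ (tm false).k₀ ≃ Bool)
  (o₂ : (tm false).Γ (tm false).k₁ ≃ Bool)

/-- Run both machines on the input and concatenate the outputs. -/
def appendFrag : Frag (BoxK tm) (BoxΓ tm) (Option Bool × Boxτ tm) :=
  (Frag.move (.inl 0) (.inl 2) id id).seq <|
  (Frag.loop (Γ := BoxΓ tm) (.inl 2) id (fun _ => false) fun b =>
    (Frag.push (.inr ⟨true, (tm true).k₀⟩) (i₁.symm b)).seq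
      (Frag.push (.inr ⟨false, (tm false).k₀⟩) (i₂.symm b))).seq <|
  (box true).seq <|
  (box false).seq <|
  -- The second output is transferred first: the top of a stack is the beginning of the string, so
  -- the first output has to end up on top.
  (Frag.move (.inr ⟨false, (tm false).k₁⟩) (.inl 2) o₂ id).seq <|
  (Frag.move (.inl 2) (.inl 1) id id).seq <|
  (Frag.move (.inr ⟨true, (tm true).k₁⟩) (.inl 2) o₁ id).seq <|
  Frag.move (.inl 2) (.inl 1) id id

theorem Runs.appendFrag {x y z : List Bool} {T₁ T₂ : ℕ}
    (hf : TM2OutputsInTime (tm true) (x.map i₁.symm) (some (y.map o₁.symm)) T₁)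
    (hg : TM2OutputsInTime (tm false) (x.map i₂.symm) (some (z.map o₂.symm)) T₂) :
    (appendFrag i₁ o₁ i₂ o₂).Runs (boxIdle tm) (bitState 0 x) (bitState 1 (y ++ z))
      (5 * x.length + T₁ + 4 * y.length + T₂ + 4 * z.length + 6) := by
  set u : ∀ k, List ((tm true).Γ k) := single (tm true).k₁ (y.map o₁.symm) with hu
  set u' : ∀ k, List ((tm false).Γ k) := single (tm false).k₀ (x.map i₂.symm) with hu'
  set u'' : ∀ k, List ((tm false).Γ k) := single (tm false).k₁ (z.map o₂.symm) with hu''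
  have h1 := Runs.bitState_move (tm := tm) (j := 0) (j' := 2) (by decide) x
  have h2 := Runs.copyIn (tm true).k₀ (tm false).k₀ i₁.symm i₂.symm x.reverse [] []
  have h3 := Runs.box (tm := tm) true (fun _ => []) (two u u') hf
  have h4 := Runs.box (tm := tm) false (fun _ => []) (two u u') hg
  have h5 := Runs.moveOut (tm := tm) false (tm false).k₁ o₂ 2 (fun _ => []) (two u u'')
  have h6 := Runs.moveBits (tm := tm) (j := 2) (j' := 1) (by decide)
    (Function.update (fun _ => []) 2 z.reverse) (two u (fun _ => []))
  have h7 := Runs.moveOut (tm := tm) true (tm true).k₁ o₁ 2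
    (Function.update (fun _ => []) 1 z) (two u (fun _ => []))
  have h8 := Runs.moveBits (tm := tm) (j := 2) (j' := 1) (by decide)
    (Function.update (Function.update (fun _ => []) 1 z) 2 y.reverse)
    (two (fun _ => []) (fun _ => []))
  rw [update_two_true, update_two_true] at h3
  rw [update_two_false, update_two_false] at h4
  rw [update_two_false] at h5
  rw [update_two_true] at h7
  have e7 : two u (fun _ => []) true (tm true).k₁ = y.map o₁.symm := by simp [two, hu, single]
  have e5 : two u u'' false (tm false).k₁ = z.map o₂.symm := by simp [two, hu'', single]
  have e7' : Function.update (two u (fun _ => []) true) (tm true).k₁ [] = fun _ => [] :=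
    (update_single ..).trans (single_nil _)
  have e5' : Function.update (two u u'' false) (tm false).k₁ [] = fun _ => [] :=
    (update_single ..).trans (single_nil _)
  rw [e5, e5'] at h5
  rw [e7, e7'] at h7
  have h := h1.seq <| (h2.congr_left ?_).seq <| (h3.congr_left ?_).seq <| (h4.congr_left rfl).seq <|
    (h5.congr_left rfl).seq <| (h6.congr_left ?_).seq <| (h7.congr_left ?_).seq (h8.congr_left ?_)
  · refine (h.congr ?_).mono ?_
    · rw [two_nil]
      refine congrArg (comb tm · _) (funext fun j => ?_)
      fin_cases j <;> simp
    · simp only [List.length_reverse, List.length_map, Function.update_self]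
      omega
  · rw [single_nil, single_nil, two_nil]; rfl
  · simp [hu']
  · refine congrArg (comb tm · _) (funext fun j => ?_)
    fin_cases j <;> simp
  · refine congrArg (comb tm · _) (funext fun j => ?_)
    fin_cases j <;> simp
  · refine congrArg (comb tm · _) (funext fun j => ?_)
    fin_cases j <;> simp

end

theorem PolyTime.append {Y₁ Y₂ : Type} {e₁ : Y₁ → List Bool} {e₂ : Y₂ → List Bool}
    {f : X → Y₁} {g : X → Y₂} {h : X → Y} (hf : PolyTime ex e₁ f) (hg : PolyTime ex e₂ g)
    (hh : ∀ x, ey (h x) = e₁ (f x) ++ e₂ (g x)) : PolyTime ex ey h := by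
  classical
  obtain ⟨cf⟩ := hf
  obtain ⟨cg⟩ := hg
  obtain ⟨pf, hpf⟩ := length_le_of_computable cf
  obtain ⟨pg, hpg⟩ := length_le_of_computable cg
  let tm := boxPair cf.tm cg.tm
  have : ∀ i, Fintype (tm i).K := fun i => (tm i).kFin
  have : ∀ i, Fintype (tm i).σ := fun i => (tm i).σFin
  refine PolyTime.of_frag (boxIdle tm) (appendFrag cf.inputAlphabet cf.outputAlphabet
    cg.inputAlphabet cg.outputAlphabet) (.inl 0) (.inl 1) (Equiv.refl _) (Equiv.refl _)
    (5 * .X + cf.time + 4 * pf + cg.time + 4 * pg + 6) fun x => ?_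
  simp only [Equiv.refl_symm, Equiv.coe_refl, List.map_id]
  rw [single_inl, single_inl, hh]
  refine (Runs.appendFrag (tm := tm) cf.inputAlphabet cf.outputAlphabet
    cg.inputAlphabet cg.outputAlphabet (cf.outputsFun x) (cg.outputsFun x)).mono ?_
  have h1 := hpf x
  have h2 := hpg x
  simp only [Polynomial.eval_add, Polynomial.eval_mul, Polynomial.eval_X, Polynomial.eval_ofNat]
  omega

/-! ## Programs on stacks of natural numbers -/

theorem bits_cons (k : ℕ) (l : List ℕ) : bits (k :: l) = List.replicate k true ++ false :: bits l := by
  simp [bits]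

theorem bits_nil : bits [] = [] := rfl

theorem bits_zero_cons (l : List ℕ) : bits (0 :: l) = false :: bits l := by simp [bits_cons]

theorem bits_succ_cons (k : ℕ) (l : List ℕ) : bits ((k + 1) :: l) = true :: bits (k :: l) := by
  simp [bits_cons, List.replicate_succ]

theorem bits_append (l l' : List ℕ) : bits (l ++ l') = bits l ++ bits l' := by
  simp [bits]

theorem length_bits_cons (k : ℕ) (l : List ℕ) : (bits (k :: l)).length = k + 1 + (bits l).length := by
  simp [bits_cons]; omega

theorem length_le_length_bits (l : List ℕ) : l.length ≤ (bits l).length := by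
  induction l with
  | nil => simp
  | cons k l ih => rw [length_bits_cons, List.length_cons]; omega

theorem le_length_bits {l : List ℕ} {k : ℕ} (h : k ∈ l) : k < (bits l).length := by
  induction l with
  | nil => simp at h
  | cons j l ih =>
    rw [length_bits_cons]
    rcases List.mem_cons.1 h with rfl | h
    · omega
    · have := ih h; omega

/-- Open machines with `N` bit stacks. -/
abbrev Prog (N : ℕ) : Type 1 := Frag (Fin N) (fun _ => Bool) (Option Bool × Unit)

namespace Prog

variable {N : ℕ}

/-- `F.Runs B B' T`: the machine `F` transforms the stacks of numbers `B` into `B'` within `T`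
steps. The numbers are stored in unary, as in `bits`. -/
def Runs (F : Prog N) (B B' : Fin N → List ℕ) (T : ℕ) : Prop :=
  Frag.Runs () F (fun k => bits (B k)) (fun k => bits (B' k)) T

theorem Runs.mono {F : Prog N} {B B' : Fin N → List ℕ} {T T' : ℕ} (h : Runs F B B' T)
    (hT : T ≤ T') : Runs F B B' T' := Frag.Runs.mono h hT

theorem Runs.congr {F : Prog N} {B B' B'' : Fin N → List ℕ} {T : ℕ} (h : Runs F B B' T)
    (hB : B' = B'') : Runs F B B'' T := hB ▸ h

theorem Runs.congr_left {F : Prog N} {B B' B'' : Fin N → List ℕ} {T : ℕ} (h : Runs F B B' T)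
    (hB : B = B'') : Runs F B'' B' T := hB ▸ h

theorem bits_update (B : Fin N → List ℕ) (k : Fin N) (l : List ℕ) :
    (fun j => bits (Function.update B k l j)) =
      Function.update (fun j => bits (B j)) k (bits l) := by
  funext j
  by_cases h : j = k
  · subst h; simp
  · simp [h]

theorem Runs.skip (B : Fin N → List ℕ) : Runs Frag.skip B B 0 := Frag.Runs.skip _

theorem Runs.seq {F G : Prog N} {B B' B'' : Fin N → List ℕ} {T T' : ℕ} (h : Runs F B B' T)
    (h' : Runs G B' B'' T') : Runs (F.seq G) B B'' (T + T') := Frag.Runs.seq h h'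

/-- Push the number zero. -/
def zero (k : Fin N) : Prog N := Frag.push k false

theorem Runs.zero (k : Fin N) (B : Fin N → List ℕ) :
    Runs (zero k) B (Function.update B k (0 :: B k)) 1 := by
  unfold Runs
  rw [bits_update, bits_zero_cons]
  exact Frag.Runs.push ..

/-- Increase the top number. -/
def inc (k : Fin N) : Prog N := Frag.push k true

theorem Runs.inc {k : Fin N} {B : Fin N → List ℕ} {j : ℕ} {l : List ℕ} (h : B k = j :: l) :
    Runs (inc k) B (Function.update B k ((j + 1) :: l)) 1 := by
  unfold Runs
  rw [bits_update, bits_succ_cons, ← h]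
  exact Frag.Runs.push ..

/-- Branch on the top number: if it is zero, pop it; if it is positive, decrease it. -/
def case (k : Fin N) (F G H : Prog N) : Prog N := Frag.popCase k id fun o => match o with
  | none => F
  | some false => G
  | some true => H

theorem Runs.case_zero {k : Fin N} {F G H : Prog N} {B B' : Fin N → List ℕ} {l : List ℕ} {T : ℕ}
    (h : B k = 0 :: l) (hG : Runs G (Function.update B k l) B' T) :
    Runs (case k F G H) B B' (T + 1) := by
  refine Frag.Runs.popCase ?_
  unfold Runs at hG
  simp only [h, bits_zero_cons, List.head?_cons, Option.map_some, id, List.tail_cons]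
  rwa [bits_update] at hG

theorem Runs.case_succ {k : Fin N} {F G H : Prog N} {B B' : Fin N → List ℕ} {j : ℕ} {l : List ℕ}
    {T : ℕ} (h : B k = (j + 1) :: l) (hH : Runs H (Function.update B k (j :: l)) B' T) :
    Runs (case k F G H) B B' (T + 1) := by
  refine Frag.Runs.popCase ?_
  unfold Runs at hH
  simp only [h, bits_succ_cons, List.head?_cons, Option.map_some, id, List.tail_cons]
  rwa [bits_update] at hH

/-- Count the top number down to zero and pop it, running `F` after every decrement. -/
def times (k : Fin N) (F : Prog N) : Prog N := Frag.loop k id (fun b => !b) fun _ => F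

theorem Runs.times_nil {k : Fin N} {F : Prog N} {B : Fin N → List ℕ} (h : B k = []) :
    Runs (times k F) B B 1 := Frag.Runs.loop_nil (by simp [h, bits_nil])

theorem Runs.times_zero {k : Fin N} {F : Prog N} {B : Fin N → List ℕ} {l : List ℕ}
    (h : B k = 0 :: l) : Runs (times k F) B (Function.update B k l) 1 := by
  unfold Runs
  rw [bits_update]
  exact Frag.Runs.loop_stop (g := false) (by simp [h, bits_zero_cons]) rfl

theorem Runs.times_succ {k : Fin N} {F : Prog N} {B B' B'' : Fin N → List ℕ} {j : ℕ} {l : List ℕ}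
    {T T' : ℕ} (h : B k = (j + 1) :: l) (hF : Runs F (Function.update B k (j :: l)) B' T)
    (hl : Runs (times k F) B' B'' T') : Runs (times k F) B B'' (T + T' + 1) := by
  unfold Runs at hF
  rw [bits_update] at hF
  exact Frag.Runs.loop_step (g := true) (l := bits (j :: l)) (by simp [h, bits_succ_cons]) rfl hF hl

/-- The invariant rule for `times`; `S j` are the stacks when `j` iterations are left. -/
theorem Runs.times {k : Fin N} {F : Prog N} (S : ℕ → Fin N → List ℕ) {l : List ℕ} {n T : ℕ}
    (hS : ∀ j ≤ n, S j k = j :: l)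
    (hF : ∀ j < n, Runs F (Function.update (S (j + 1)) k (j :: l)) (S j) T) :
    Runs (times k F) (S n) (Function.update (S 0) k l) (n * (T + 1) + 1) := by
  induction n with
  | zero => exact (times_zero (hS 0 le_rfl)).mono (by omega)
  | succ n ih =>
    refine (times_succ (hS (n + 1) le_rfl) (hF n (by omega))
      (ih (fun j hj => hS j (by omega)) fun j hj => hF j (by omega))).mono ?_
    rw [Nat.succ_mul]; omega

/-- Pop a number. -/
def drop (k : Fin N) : Prog N := times k Frag.skip

theorem Runs.drop {k : Fin N} {B : Fin N → List ℕ} {j : ℕ} {l : List ℕ} (h : B k = j :: l) :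
    Runs (drop k) B (Function.update B k l) (j + 1) := by
  have := Runs.times (k := k) (F := Frag.skip) (fun i => Function.update B k (i :: l)) (l := l)
    (n := j) (T := 0) (fun _ _ => by simp) (fun i _ => by
      rw [Function.update_idem]; exact Runs.skip _)
  simp only [← h, Function.update_eq_self, Function.update_idem, zero_add, mul_one] at this
  exact this

/-- Pop a number if there is one. -/
theorem Runs.drop' (k : Fin N) (B : Fin N → List ℕ) :
    Runs (Prog.drop k) B (Function.update B k (B k).tail) ((bits (B k)).length + 1) := by
  rcases h : B k with _ | ⟨j, l⟩
  · refine (Runs.times_nil h).congr ?_ |>.mono (by simp)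
    rw [List.tail_nil, ← h, Function.update_eq_self]
  · exact (Runs.drop h).mono (by rw [length_bits_cons]; omega)

/-- Repeat a program. -/
def rep : ℕ → Prog N → Prog N
  | 0, _ => Frag.skip
  | n + 1, F => F.seq (rep n F)

theorem Runs.rep_inc {k : Fin N} (n : ℕ) {B : Fin N → List ℕ} {j : ℕ} {l : List ℕ}
    (h : B k = j :: l) : Runs (rep n (Prog.inc k)) B (Function.update B k ((j + n) :: l)) n := by
  induction n generalizing B j with
  | zero =>
    refine (Runs.skip B).congr ?_
    rw [add_zero, ← h, Function.update_eq_self]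
  | succ n ih =>
    refine ((Runs.inc h).seq (ih (j := j + 1) (by simp))).congr ?_ |>.mono (by omega)
    rw [Function.update_idem, add_assoc, add_comm 1]

/-- Move the top number of `a` to `b`, where a missing number counts as zero. -/
def fetch (a b : Fin N) : Prog N := (zero b).seq (times a (inc b))

theorem Runs.times_inc {a b : Fin N} (hab : a ≠ b) {B : Fin N → List ℕ} {h i : ℕ} {l l' : List ℕ}
    (ha : B a = h :: l) (hb : B b = i :: l') :
    Runs (Prog.times a (Prog.inc b)) B
      (Function.update (Function.update B a l) b ((i + h) :: l')) (2 * h + 1) := by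
  have := Runs.times (k := a) (F := Prog.inc b)
    (fun j => Function.update (Function.update B a (j :: l)) b ((i + (h - j)) :: l')) (l := l)
    (n := h) (T := 1) (fun _ _ => by simp [hab]) (fun j hj => by
      rw [Function.update_comm hab, Function.update_idem, Function.update_comm hab.symm]
      refine (Runs.inc (j := i + (h - (j + 1))) (l := l') (by simp)).congr ?_
      rw [Function.update_idem, show i + (h - (j + 1)) + 1 = i + (h - j) by omega])
  refine (this.congr_left ?_).congr ?_ |>.mono (by omega)
  · simp only [← ha, Function.update_eq_self, Nat.sub_self, add_zero, ← hb]
  · rw [Function.update_comm hab, Function.update_idem, Function.update_comm hab.symm, Nat.sub_zero]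

theorem Runs.fetch {a b : Fin N} (hab : a ≠ b) (B : Fin N → List ℕ) :
    Runs (fetch a b) B (Function.update (Function.update B a (B a).tail) b
      ((B a).headD 0 :: B b)) (2 * (B a).headD 0 + 2) := by
  rcases h : B a with _ | ⟨j, l⟩
  · refine ((Runs.zero b B).seq (Runs.times_nil (by simp [hab, h]))).congr ?_
    rw [List.tail_nil, ← h, Function.update_eq_self, h]
    rfl
  · refine ((Runs.zero b B).seq (Runs.times_inc hab (h := j) (l := l) (i := 0) (l' := B b)
      (by simp [hab, h]) (by simp))).congr ?_ |>.mono (by simp; omega)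
    rw [Function.update_comm hab, Function.update_idem, Function.update_comm hab.symm]
    simp

/-- Add `μ * h` to the top number of `o`, where `h` is the top number of `a`; the stack `t` is
scratch space. -/
def addTo (a : Fin N) (μ : ℕ) (o t : Fin N) : Prog N :=
  (zero t).seq <| (times a ((rep μ (inc o)).seq (inc t))).seq <| (zero a).seq (times t (inc a))

/-- Counting `a` down destroys its top number; the copy accumulated on `t` restores it afterwards.
-/
theorem Runs.addTo {a o t : Fin N} (hao : a ≠ o) (hat : a ≠ t) (hot : o ≠ t) (μ : ℕ)
    {B : Fin N → List ℕ} {h i : ℕ} {l l' : List ℕ} (ha : B a = h :: l) (ho : B o = i :: l')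
    (ht : B t = []) :
    Runs (addTo a μ o t) B (Function.update B o ((i + μ * h) :: l')) ((μ + 5) * (h + 1)) := by
  have h1 := Runs.zero t B
  have h3 := Runs.times (k := a) (F := (rep μ (Prog.inc o)).seq (Prog.inc t))
    (fun j => Function.update (Function.update (Function.update B t [h - j]) o
      ((i + μ * (h - j)) :: l')) a (j :: l)) (l := l)
    (n := h) (T := μ + 1) (fun _ _ => by simp) (fun j hj => by
      rw [Function.update_idem]
      refine ((Runs.rep_inc (k := o) μ (j := i + μ * (h - (j + 1))) (l := l')
        (by simp [hao.symm])).seq (Runs.inc (k := t) (j := h - (j + 1)) (l := [])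
          (by simp [hot.symm, hat.symm]))).congr ?_
      rw [show h - j = h - (j + 1) + 1 by omega, Nat.mul_succ, add_assoc]
      funext k
      simp only [Function.update_apply]
      split_ifs <;> simp_all)
  have h4 := Runs.zero a (Function.update (Function.update B t [h]) o ((i + μ * h) :: l') |>
    (Function.update · a l))
  have h5 := Runs.times_inc (B := Function.update (Function.update (Function.update B t [h]) o
    ((i + μ * h) :: l')) a (0 :: l)) (a := t) (b := a) hat.symm (h := h) (l := []) (i := 0)
    (l' := l) (by simp [hot.symm, hat.symm]) (by simp)
  refine (h1.seq <| (h3.congr_left ?_).seq <| (h4.congr_left ?_).seq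
    (h5.congr_left ?_)).congr ?_ |>.mono ?_
  iterate 4
    funext k
    simp only [Function.update_apply]
    split_ifs <;> simp_all
  nlinarith

/-- Push `μ * h + c` on `o`, where `h` is the top number of `a`; the stack `t` is scratch space. -/
def put (a : Fin N) (μ c : ℕ) (o t : Fin N) : Prog N :=
  (zero o).seq <| (addTo a μ o t).seq (rep c (inc o))

theorem Runs.put {a o t : Fin N} (hao : a ≠ o) (hat : a ≠ t) (hot : o ≠ t) (μ c : ℕ)
    {B : Fin N → List ℕ} {h : ℕ} {l : List ℕ} (ha : B a = h :: l) (ht : B t = []) :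
    Runs (put a μ c o t) B (Function.update B o ((μ * h + c) :: B o))
      ((μ + c + 8) * (h + 1)) := by
  refine ((Runs.zero o B).seq ((Runs.addTo hao hat hot μ (h := h) (l := l) (i := 0) (l' := B o)
    (by simp [hao, ha]) (by simp) (by simp [hot.symm, ht])).seq
    (Runs.rep_inc (k := o) c (j := 0 + μ * h) (l := B o) (by simp)))).congr ?_ |>.mono ?_
  · simp
  · nlinarith

/-- For every number of stack `k`, push it on `x` and run `F`. -/
def each (k x : Fin N) (F : Prog N) : Prog N := Frag.loop k id (fun _ => false) fun b => match b with
  | false => (zero x).seq F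
  | true => (zero x).seq ((inc x).seq ((times k (inc x)).seq F))

theorem Runs.each_nil {k x : Fin N} {F : Prog N} {B : Fin N → List ℕ} (h : B k = []) :
    Runs (each k x F) B B 1 := Frag.Runs.loop_nil (by simp [h, bits_nil])

/-- The bit popped by the loop already distinguishes zero from a positive number; in the second case
the copy starts at one and `times` transfers the rest. -/
theorem Runs.each_cons {k x : Fin N} (hkx : k ≠ x) {F : Prog N} {B B' B'' : Fin N → List ℕ}
    {j : ℕ} {l : List ℕ} {T T' : ℕ} (h : B k = j :: l)
    (hF : Runs F (Function.update (Function.update B k l) x (j :: B x)) B' T)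
    (hl : Runs (each k x F) B' B'' T') : Runs (each k x F) B B'' (2 * j + 3 + T + T') := by
  rcases j with _ | j
  · refine Runs.mono (Frag.Runs.loop_step (g := false) (l := bits l)
      (by simp [h, bits_zero_cons]) rfl (T := 1 + T) ?_ hl) (by omega)
    rw [← bits_update]
    refine Runs.seq (Runs.zero _ _) (hF.congr_left ?_)
    simp [hkx.symm]
  · refine Runs.mono (Frag.Runs.loop_step (g := true) (l := bits (j :: l))
      (by simp [h, bits_succ_cons]) rfl (T := 1 + (1 + ((2 * j + 1) + T))) ?_ hl) (by omega)
    rw [← bits_update]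
    refine Runs.seq (Runs.zero _ _) (Runs.seq (Runs.inc (j := 0) (l := B x) (by simp [hkx.symm]))
      (Runs.seq (Runs.times_inc hkx (h := j) (l := l) (i := 1) (l' := B x) (by simp [hkx])
        (by simp)) (hF.congr_left ?_)))
    funext i
    simp only [Function.update_apply]
    split_ifs <;> simp_all [add_comm]

/-- Pop the top number of `k` and select a program by it. -/
def switch (k : Fin N) : List (Prog N) → Prog N → Prog N
  | [], G => (drop k).seq G
  | F :: Fs, G => case k Frag.skip F (switch k Fs G)

theorem Runs.switch {k : Fin N} {Fs : List (Prog N)} {G : Prog N} {B B' : Fin N → List ℕ} {j : ℕ}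
    {l : List ℕ} {T : ℕ} (h : B k = j :: l)
    (hF : Runs (Fs.getD j G) (Function.update B k l) B' T) :
    Runs (switch k Fs G) B B' (T + j + 1) := by
  induction Fs generalizing j B with
  | nil => exact ((Runs.drop h).seq hF).mono (by omega)
  | cons F Fs ih =>
    rcases j with _ | j
    · exact Runs.case_zero h hF
    · exact (Runs.case_succ h (ih (j := j) (B := Function.update B k (j :: l)) (by simp)
        (by simpa using hF))).mono (by omega)

/-- Empty a stack. -/
def clear (k : Fin N) : Prog N := Frag.loop k id (fun _ => false) fun _ => Frag.skip

theorem Runs.clear (k : Fin N) (B : Fin N → List ℕ) :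
    Runs (Prog.clear k) B (Function.update B k []) ((bits (B k)).length + 1) := by
  have key : ∀ (l : List Bool) (S : Fin N → List Bool), S k = l →
      Frag.Runs () (Prog.clear k) S (Function.update S k []) (l.length + 1) := by
    intro l
    induction l with
    | nil =>
      intro S h
      rw [← h, Function.update_eq_self]
      exact (Frag.Runs.loop_nil h).mono (by omega)
    | cons b l ih =>
      intro S h
      have := ih (Function.update S k l) (by simp)
      rw [Function.update_idem] at this
      refine Frag.Runs.mono (Frag.Runs.loop_step h rfl (Frag.Runs.skip _) this) ?_
      simp only [List.length_cons]
      omega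
  unfold Runs
  rw [bits_update, bits_nil]
  exact key _ _ rfl

/-- Move the numbers of `k` to `x`, reversing their order. -/
theorem Runs.each_skip {k x : Fin N} (hkx : k ≠ x) (B : Fin N → List ℕ) :
    Runs (each k x Frag.skip) B
      (Function.update (Function.update B k []) x ((B k).reverse ++ B x))
      (3 * (bits (B k)).length + 1) := by
  generalize h : B k = l
  induction l generalizing B with
  | nil =>
    refine (Runs.each_nil h).congr ?_
    funext i
    simp only [Function.update_apply]
    split_ifs <;> simp_all
  | cons j l ih =>
    refine (Runs.each_cons hkx h (Runs.skip _) (ih _ (by simp [hkx]))).congr ?_ |>.mono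
      (by rw [length_bits_cons]; omega)
    funext i
    simp only [Function.update_apply]
    split_ifs <;> simp_all

/-- An affine function of the top number of a stack. -/
abbrev Item (N : ℕ) : Type := Fin N × ℕ × ℕ

/-- The value of an item. -/
def Item.val (B : Fin N → List ℕ) (i : Item N) : ℕ := i.2.1 * (B i.1).headD 0 + i.2.2

/-- Push the values of the items on `o`, one after another. -/
def emit (o t : Fin N) : List (Item N) → Prog N
  | [] => Frag.skip
  | i :: is => (put i.1 i.2.1 i.2.2 o t).seq (emit o t is)

/-- A bound for the cost of `emit`. -/
def weight (is : List (Item N)) : ℕ := (is.map fun i => i.2.1 + i.2.2 + 8).sum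

theorem Runs.emit {o t : Fin N} (hot : o ≠ t) {is : List (Item N)} {B : Fin N → List ℕ} {H : ℕ}
    (his : ∀ i ∈ is, i.1 ≠ o ∧ i.1 ≠ t ∧ B i.1 ≠ [] ∧ (B i.1).headD 0 ≤ H) (ht : B t = []) :
    Runs (emit o t is) B (Function.update B o ((is.map (Item.val B)).reverse ++ B o))
      (weight is * (H + 1)) := by
  induction is generalizing B with
  | nil =>
    refine (Runs.skip B).congr ?_ |>.mono (Nat.zero_le _)
    simp
  | cons i is ih =>
    obtain ⟨h1, h2, h3, h4⟩ := his i (by simp)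
    obtain ⟨h, l, hl⟩ := List.exists_cons_of_ne_nil h3
    have e := Runs.put h1 h2 hot i.2.1 i.2.2 hl ht
    have e' := ih (B := Function.update B o ((i.2.1 * h + i.2.2) :: B o)) (fun j hj => by
      obtain ⟨g1, g2, g3, g4⟩ := his j (by simp [hj])
      simp only [Function.update_of_ne g1]
      exact ⟨g1, g2, g3, g4⟩) (by simp [hot.symm, ht])
    refine (e.seq e').congr ?_ |>.mono ?_
    · rw [Function.update_idem]
      have : is.map (Item.val (Function.update B o ((i.2.1 * h + i.2.2) :: B o))) =
          is.map (Item.val B) := by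
        refine List.map_congr_left fun j hj => ?_
        simp [Item.val, Function.update_of_ne (his j (by simp [hj])).1]
      rw [this]
      simp [Item.val, hl]
    · have : h ≤ H := by simpa [hl] using h4
      simp only [weight, List.map_cons, List.sum_cons]
      have h' : (i.2.1 + i.2.2 + 8) * (h + 1) ≤ (i.2.1 + i.2.2 + 8) * (H + 1) :=
        Nat.mul_le_mul_left _ (by omega)
      rw [Nat.add_mul (i.2.1 + i.2.2 + 8)]
      exact Nat.add_le_add_right h' _

end Prog

theorem PolyTime.of_prog {N : ℕ} (F : Prog N) (i o : Fin N) {X Y : Type} {ex : X → List ℕ}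
    {ey : Y → List ℕ} {f : X → Y} (p : Polynomial ℕ)
    (h : ∀ x, F.Runs (single i (ex x)) (single o (ey (f x))) (p.eval (bits (ex x)).length)) :
    PolyTime (fun x => bits (ex x)) (fun y => bits (ey y)) f := by
  refine PolyTime.of_frag () F i o (Equiv.refl _) (Equiv.refl _) p fun x => ?_
  have h1 : ∀ (k : Fin N) l, (fun j => bits (single (Γ := fun _ => ℕ) k l j)) =
      single (Γ := fun _ => Bool) k (bits l) := fun k l => by
    rw [single, Prog.bits_update]
    rfl
  have := h x
  unfold Prog.Runs at this
  rw [h1, h1] at this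
  simpa using this

/-! ## Polynomial-time functions on lists of numbers -/

namespace Prog

theorem headD_le_length_bits (l : List ℕ) : l.headD 0 ≤ (bits l).length := by
  cases l with
  | nil => simp
  | cons k l => rw [length_bits_cons, List.headD_cons]; omega

theorem length_bits_tail (l : List ℕ) : (bits l.tail).length ≤ (bits l).length := by
  cases l with
  | nil => simp
  | cons k l => rw [length_bits_cons, List.tail_cons]; omega

end Prog

open Prog

theorem polyTime_reverse : PolyTime bits bits List.reverse :=
  PolyTime.of_prog (N := 2) (ex := id) (ey := id) (each 0 1 Frag.skip) 0 1 (3 * .X + 1) fun l =>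
    ((Runs.each_skip (by decide) _).congr
      (by funext k; fin_cases k <;> simp [single])).mono (by simp [single])

/-- Moving a stack reverses it, so the reversed tail is what a single pass produces. -/
theorem polyTime_tail : PolyTime bits bits List.tail := by
  have : PolyTime bits bits (fun l : List ℕ => l.tail.reverse) :=
    PolyTime.of_prog (N := 2) (ex := id) (ey := id) ((drop 0).seq (each 0 1 Frag.skip)) 0 1
      (4 * .X + 2) fun l =>
      ((Runs.drop' _ _).seq (Runs.each_skip (by decide) _)).congr
        (by funext k; fin_cases k <;> simp [single]) |>.mono (by
          have := length_bits_tail l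
          simp [single]
          omega)
  exact (polyTime_reverse.comp this : PolyTime bits bits (fun l => l.tail.reverse.reverse)) |>
    fun h => by simpa using h

theorem polyTime_affine (μ c : ℕ) :
    PolyTime bits bits (fun l : List ℕ => [μ * l.headD 0 + c]) :=
  PolyTime.of_prog (N := 4) (ex := id) (ey := id)
    ((fetch 0 1).seq ((Prog.clear 0).seq ((put 1 μ c 2 3).seq (drop 1)))) 0 2
    ((μ + c + 20 : ℕ) * (.X + 1)) fun l => by
      have h1 := Runs.fetch (N := 4) (a := 0) (b := 1) (by decide) (single 0 l)
      have h2 := Runs.clear (N := 4) 0 ![l.tail, [l.headD 0], [], []]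
      have h3 := Runs.put (N := 4) (a := 1) (o := 2) (t := 3) (by decide) (by decide) (by decide) μ c
        (B := ![[], [l.headD 0], [], []]) (h := l.headD 0) (l := []) rfl rfl
      have h4 := Runs.drop (N := 4) (k := 1) (B := ![[], [l.headD 0], [μ * l.headD 0 + c], []])
        (j := l.headD 0) (l := []) rfl
      refine (h1.seq ((h2.congr_left ?_).seq ((h3.congr_left ?_).seq
        (h4.congr_left ?_)))).congr ?_ |>.mono ?_
      iterate 4 funext k; fin_cases k <;> simp [single]
      have := headD_le_length_bits l
      have := length_bits_tail l
      simp [single] at *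
      nlinarith

theorem polyTime_const_singleton (c : ℕ) : PolyTime bits bits (fun _ => [c]) := by
  simpa using polyTime_affine 0 c

theorem polyTime_const_nil : PolyTime bits bits (fun _ : List ℕ => []) := by
  simpa using polyTime_tail.comp (polyTime_const_singleton 0)

theorem PolyTime.bits_append {X : Type} {ex : X → List Bool} {f g : X → List ℕ}
    (hf : PolyTime ex bits f) (hg : PolyTime ex bits g) :
    PolyTime ex bits (fun x => f x ++ g x) :=
  hf.append hg fun _ => DQC.bits_append _ _

theorem polyTime_const (c : List ℕ) : PolyTime bits bits (fun _ => c) := by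
  induction c with
  | nil => exact polyTime_const_nil
  | cons k c ih => exact (polyTime_const_singleton k).bits_append ih

theorem polyTime_replicate :
    PolyTime bits bits (fun l : List ℕ => List.replicate (l.headD 0) 0) :=
  PolyTime.of_prog (N := 3) (ex := id) (ey := id)
    ((fetch 0 1).seq ((Prog.clear 0).seq (times 1 (zero 2)))) 0 2 (10 * (.X + 1)) fun l => by
      have h1 := Runs.fetch (N := 3) (a := 0) (b := 1) (by decide) (single 0 l)
      have h2 := Runs.clear (N := 3) 0 ![l.tail, [l.headD 0], []]
      have h3 := Runs.times (N := 3) (k := 1) (F := Prog.zero 2) (l := []) (T := 1) (n := l.headD 0)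
        (fun j => ![[], [j], List.replicate (l.headD 0 - j) 0]) (fun _ _ => rfl) (fun j hj => by
          refine (Runs.zero _ _).congr ?_
          rw [show l.headD 0 - j = l.headD 0 - (j + 1) + 1 by omega]
          funext k; fin_cases k <;> simp [List.replicate_succ])
      refine (h1.seq ((h2.congr_left ?_).seq (h3.congr_left ?_))).congr ?_ |>.mono ?_
      iterate 3 funext k; fin_cases k <;> simp [single]
      have := headD_le_length_bits l
      have := length_bits_tail l
      simp [single] at *
      nlinarith

theorem polyTime_square : PolyTime bits bits (fun l : List ℕ => [l.headD 0 * l.headD 0]) :=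
  PolyTime.of_prog (N := 5) (ex := id) (ey := id)
    ((fetch 0 1).seq ((Prog.clear 0).seq ((put 1 1 0 2 3).seq ((zero 4).seq
      ((times 2 (addTo 1 1 4 3)).seq (drop 1)))))) 0 4 (40 * (.X + 1) * (.X + 1)) fun l => by
      have h1 := Runs.fetch (N := 5) (a := 0) (b := 1) (by decide) (single 0 l)
      have h2 := Runs.clear (N := 5) 0 ![l.tail, [l.headD 0], [], [], []]
      have h3 := Runs.put (N := 5) (a := 1) (o := 2) (t := 3) (by decide) (by decide) (by decide) 1 0
        (B := ![[], [l.headD 0], [], [], []]) (h := l.headD 0) (l := []) rfl rfl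
      have h4 := Runs.zero (N := 5) 4 ![[], [l.headD 0], [l.headD 0], [], []]
      have h5 := Runs.times (N := 5) (k := 2) (F := Prog.addTo 1 1 4 3) (l := [])
        (T := 6 * (l.headD 0 + 1)) (n := l.headD 0)
        (fun j => ![[], [l.headD 0], [j], [], [(l.headD 0 - j) * l.headD 0]]) (fun _ _ => rfl)
        (fun j hj => by
          refine (Runs.addTo (h := l.headD 0) (i := (l.headD 0 - (j + 1)) * l.headD 0) (l := [])
            (l' := []) (by decide) (by decide) (by decide) 1 rfl rfl rfl).congr ?_
          rw [show l.headD 0 - j = l.headD 0 - (j + 1) + 1 by omega, add_mul,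
            one_mul]
          funext k; fin_cases k <;> simp)
      have h6 := Runs.drop (N := 5) (k := 1)
        (B := ![[], [l.headD 0], [], [], [l.headD 0 * l.headD 0]]) (j := l.headD 0) (l := []) rfl
      refine (h1.seq ((h2.congr_left ?_).seq ((h3.congr_left ?_).seq ((h4.congr_left ?_).seq
        ((h5.congr_left ?_).seq (h6.congr_left ?_)))))).congr ?_ |>.mono ?_
      iterate 6 funext k; fin_cases k <;> simp [single]
      have := headD_le_length_bits l
      have := length_bits_tail l
      simp [single] at *
      nlinarith

/-- The first entry outside `{0, 1}` triggers `clear`, and the loop ends because its input is gone.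
-/
theorem polyTime_takeWhile :
    PolyTime bits bits (fun l : List ℕ => l.takeWhile (· < 2)) := by
  have : PolyTime bits bits (fun l : List ℕ => (l.takeWhile (· < 2)).reverse) := by
    refine PolyTime.of_prog (N := 3) (ex := id) (ey := id)
      (each 0 1 (switch 1 [zero 2, (zero 2).seq (inc 2)] (Prog.clear 0))) 0 2
      (10 * (.X + 1)) fun l => ?_
    have key : ∀ (l o : List ℕ), Runs (N := 3)
        (each 0 1 (switch 1 [zero 2, (zero 2).seq (inc 2)] (Prog.clear 0)))
        ![l, [], o] ![[], [], (l.takeWhile (· < 2)).reverse ++ o] (10 * ((bits l).length + 1)) := by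
      intro l
      induction l with
      | nil => exact fun o => (Runs.each_nil rfl).mono (by omega)
      | cons j l ih =>
        intro o
        by_cases hj : j < 2
        · refine (Runs.each_cons (T := 2 + j + 1) (by decide) rfl (Runs.switch rfl
            (B' := ![l, [], j :: o]) ?_) (ih (j :: o))).congr ?_ |>.mono ?_
          · interval_cases j
            · refine (Runs.zero _ _).congr ?_ |>.mono (by omega)
              funext k; fin_cases k <;> simp
            · refine ((Runs.zero _ _).seq (Runs.inc (j := 0) (l := o) (by simp))).congr ?_
              funext k; fin_cases k <;> simp
          · simp only [List.takeWhile_cons, hj, decide_true, if_true,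
              List.reverse_cons, List.append_assoc, List.cons_append, List.nil_append]
          · rw [length_bits_cons]; omega
        · refine (Runs.each_cons (B' := ![[], [], o]) (by decide) rfl (Runs.switch rfl
            (T := (bits l).length + 1) ?_) (Runs.each_nil rfl)).congr ?_ |>.mono ?_
          · rw [List.getD_eq_default _ _ (Nat.le_of_not_lt hj)]
            refine (Runs.clear _ _).congr ?_ |>.mono ?_
            · funext k; fin_cases k <;> simp
            · simp
          · simp only [List.takeWhile_cons, hj, decide_false, Bool.false_eq_true,
              if_false, List.nil_append, List.reverse_nil]
          · rw [length_bits_cons]; omega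
    refine ((key l []).congr_left ?_).congr ?_ |>.mono ?_
    iterate 2 funext k; fin_cases k <;> simp [single]
    simp
  simpa using polyTime_reverse.comp this

/-- The first entry outside `{0, 1}` has been popped when the default program sends the rest of the
input to the output; hence the tail. This again ends the loop. -/
theorem polyTime_dropWhile_tail :
    PolyTime bits bits (fun l : List ℕ => (l.dropWhile (· < 2)).tail) := by
  have : PolyTime bits bits (fun l : List ℕ => (l.dropWhile (· < 2)).tail.reverse) := by
    refine PolyTime.of_prog (N := 3) (ex := id) (ey := id)
      (each 0 1 (switch 1 [Frag.skip, Frag.skip] (each 0 2 Frag.skip))) 0 2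
      (10 * (.X + 1)) fun l => ?_
    have key : ∀ (l : List ℕ), Runs (N := 3)
        (each 0 1 (switch 1 [Frag.skip, Frag.skip] (each 0 2 Frag.skip)))
        ![l, [], []] ![[], [], (l.dropWhile (· < 2)).tail.reverse]
        (10 * ((bits l).length + 1)) := by
      intro l
      induction l with
      | nil => exact (Runs.each_nil rfl).mono (by omega)
      | cons j l ih =>
        by_cases hj : j < 2
        · refine (Runs.each_cons (T := 0 + j + 1) (by decide) rfl (Runs.switch rfl
            (B' := ![l, [], []]) ?_) ih).congr ?_ |>.mono ?_
          · have : ([Frag.skip, Frag.skip] : List (Prog 3)).getD j (each 0 2 Frag.skip) =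
                Frag.skip := by interval_cases j <;> rfl
            rw [this]
            refine (Runs.skip _).congr ?_
            funext k; fin_cases k <;> simp
          · simp only [List.dropWhile_cons, hj, decide_true, if_true]
          · rw [length_bits_cons]; omega
        · refine (Runs.each_cons (B' := ![[], [], l.reverse]) (by decide) rfl (Runs.switch rfl
            (T := 3 * (bits l).length + 1) ?_) (Runs.each_nil rfl)).congr ?_ |>.mono ?_
          · rw [List.getD_eq_default _ _ (Nat.le_of_not_lt hj)]
            refine (Runs.each_skip (by decide) _).congr ?_ |>.mono ?_
            · funext k; fin_cases k <;> simp
            · simp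
          · simp only [List.dropWhile_cons, hj, decide_false, Bool.false_eq_true,
              if_false, List.tail_cons]
          · rw [length_bits_cons]; omega
    refine ((key l).congr_left ?_).congr ?_ |>.mono ?_
    iterate 2 funext k; fin_cases k <;> simp [single]
    simp
  simpa using polyTime_reverse.comp this

/-! ### A logarithm computable in unary -/

/-- The number of times that `k ↦ (k - 1) / 2` can be applied. -/
def halvings : ℕ → ℕ
  | 0 => 0
  | k + 1 => halvings (k / 2) + 1

/-- Passing from `k` to `(k - 1) / 2` halves `k + 1` up to rounding down. With the next bound,
`halvings k` is the integer part of `log₂ (k + 1)`. -/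
theorem pow_halvings_le (k : ℕ) : 2 ^ halvings k ≤ k + 1 := by
  induction k using Nat.strong_induction_on with
  | _ k ih =>
    cases k with
    | zero => simp [halvings]
    | succ k =>
      rw [halvings, pow_succ]
      have := ih (k / 2) (by omega)
      omega

theorem lt_pow_halvings (k : ℕ) : k + 1 < 2 ^ (halvings k + 1) := by
  induction k using Nat.strong_induction_on with
  | _ k ih =>
    cases k with
    | zero => simp [halvings]
    | succ k =>
      rw [halvings, pow_succ]
      have := ih (k / 2) (by omega)
      omega

/-- Each round removes one unit by `times` and another by `case`. For odd `k` the last `case` meets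
the terminating zero and pops it, and `zero 1` puts it back so that the loop stops properly. -/
theorem runs_halve (o : List ℕ) (k h : ℕ) :
    Runs (N := 3) (times 1 (Prog.case 1 Frag.skip (zero 1) (inc 0)))
      ![[h], [k], o] ![[h + k / 2], [], o] (3 * k + 1) := by
  induction k using Nat.strong_induction_on generalizing h with
  | _ k ih =>
    match k with
    | 0 =>
      refine (Runs.times_zero (l := []) rfl).congr ?_
      funext k; fin_cases k <;> simp
    | 1 =>
      refine (Runs.times_succ (T := 2) (B' := ![[h], [0], o]) (j := 0) (l := []) rfl
        (Runs.case_zero (l := []) (by simp)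
          ((Runs.zero _ _).congr (by funext k; fin_cases k <;> simp))) (ih 0 (by omega) h)).congr ?_
      simp
    | k + 2 =>
      refine (Runs.times_succ (T := 2) (B' := ![[h + 1], [k], o]) (j := k + 1) (l := []) rfl
        (Runs.case_succ (j := k) (l := []) (by simp) ((Runs.inc (j := h) (l := [])
          (by simp)).congr (by funext k; fin_cases k <;> simp)))
        (ih k (by omega) (h + 1))).congr ?_ |>.mono (by omega)
      rw [show (k + 2) / 2 = k / 2 + 1 by omega, show h + 1 + k / 2 = h + (k / 2 + 1) by omega]

theorem polyTime_halvings :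
    PolyTime bits bits (fun l : List ℕ => List.replicate (halvings (l.headD 0)) 0) := by
  let body : Prog 3 := (zero 2).seq ((zero 0).seq ((times 1
    (Prog.case 1 Frag.skip (zero 1) (inc 0))).seq ((zero 1).seq (times 0 (inc 1)))))
  refine PolyTime.of_prog (N := 3) (ex := id) (ey := id)
    ((fetch 0 1).seq ((Prog.clear 0).seq (times 1 body))) 0 2
    (20 * (.X + 1) * (.X + 1)) fun l => ?_
  have key : ∀ (k : ℕ) (o : List ℕ), Runs (N := 3) (times 1 body) ![[], [k], o]
      ![[], [], List.replicate (halvings k) 0 ++ o] (k * (5 * k + 10) + 1) := by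
    intro k
    induction k using Nat.strong_induction_on with
    | _ k ih =>
      intro o
      cases k with
      | zero =>
        refine (Runs.times_zero (l := []) rfl).congr ?_ |>.mono (by omega)
        funext k; fin_cases k <;> simp [halvings]
      | succ k =>
        have h1 := Runs.zero (N := 3) 2 ![[], [k], o]
        have h2 := Runs.zero (N := 3) 0 ![[], [k], 0 :: o]
        have h3 := runs_halve (0 :: o) k 0
        have h4 := Runs.zero (N := 3) 1 ![[0 + k / 2], [], 0 :: o]
        have h5 := Runs.times_inc (N := 3) (a := 0) (b := 1) (by decide)
          (B := ![[0 + k / 2], [0], 0 :: o]) (h := k / 2) (i := 0) (l := []) (l' := [])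
          (by simp) rfl
        refine (Runs.times_succ (T := 5 * k + 10) (j := k) (l := []) rfl
          ((h1.congr_left ?_).seq ((h2.congr_left ?_).seq
          ((h3.congr_left ?_).seq ((h4.congr_left rfl).seq (h5.congr_left ?_)))) |>.mono ?_)
          ((ih (k / 2) (by omega) (0 :: o)).congr_left ?_)).congr ?_ |>.mono ?_
        iterate 4 funext k; fin_cases k <;> simp
        · omega
        · funext k; fin_cases k <;> simp
        · rw [halvings, List.replicate_succ', List.append_assoc]
          rfl
        · have h : k / 2 ≤ k := Nat.div_le_self _ _
          have := Nat.mul_le_mul h (show 5 * (k / 2) + 10 ≤ 5 * k + 10 by omega)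
          nlinarith
  have h1 := Runs.fetch (N := 3) (a := 0) (b := 1) (by decide) (single 0 l)
  have h2 := Runs.clear (N := 3) 0 ![l.tail, [l.headD 0], []]
  refine (h1.seq ((h2.congr_left ?_).seq ((key (l.headD 0) []).congr_left ?_))).congr ?_ |>.mono ?_
  iterate 3 funext k; fin_cases k <;> simp [single]
  have := headD_le_length_bits l
  have := length_bits_tail l
  simp [single] at *
  nlinarith

open Prog

/-! ## Token transducers -/

/-- A rule of a transducer: the number of arguments that follow the token, and the output, given by
affine functions of the position (variable `0`) and of the arguments (variables `1`, `2`, `3`). -/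
structure Rule where
  arity : ℕ
  out : List (Fin 4 × ℕ × ℕ)

/-- The output of a rule. -/
def Rule.eval (R : Rule) (j : ℕ) (l : List ℕ) : List ℕ :=
  R.out.map fun i => i.2.1 * (![j, if 0 < R.arity then l.headD 0 else 0,
    if 1 < R.arity then l.tail.headD 0 else 0,
    if 2 < R.arity then l.tail.tail.headD 0 else 0] i.1) + i.2.2

/-- Read a list of tokens with arguments; the token `d` is treated by the rule number `d` in the
list, or by the default rule. -/
def transduce (rs : List Rule) (r : Rule) : ℕ → List ℕ → List ℕ
  | _, [] => []
  | j, d :: l => (rs.getD d r).eval j l ++ transduce rs r (j + 1) (l.drop (rs.getD d r).arity)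
termination_by _ l => l.length
decreasing_by simp

namespace Prog

/-- Move the next argument to stack `b` if there is one according to the arity. -/
def arg (p : Prop) [Decidable p] (b : Fin 8) : Prog 8 := if p then fetch 0 b else zero b

theorem Runs.arg (p : Prop) [Decidable p] {b : Fin 8} (hb : 0 ≠ b) {B : Fin 8 → List ℕ} {H : ℕ}
    (hH : ∀ x ∈ B 0, x ≤ H) : Runs (Prog.arg p b) B
      (Function.update (Function.update B 0 (if p then (B 0).tail else B 0)) b
        ((if p then (B 0).headD 0 else 0) :: B b)) (2 * (H + 1)) := by
  unfold Prog.arg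
  split_ifs
  · refine (Runs.fetch hb B).mono ?_
    have : (B 0).headD 0 ≤ H := by
      cases h : B 0 with
      | nil => simp
      | cons x l => exact hH x (by simp [h])
    omega
  · refine (Runs.zero b B).congr ?_ |>.mono (by omega)
    rw [Function.update_eq_self]

/-- Apply a rule: the input is on stack `0`, the position on stack `2`; the output is pushed on
stack `6`. -/
def rule (R : Rule) : Prog 8 :=
  (arg (0 < R.arity) 3).seq <| (arg (1 < R.arity) 4).seq <| (arg (2 < R.arity) 5).seq <|
  (emit 6 7 (R.out.map fun i => (![2, 3, 4, 5] i.1, i.2.1, i.2.2))).seq <|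
  (drop 3).seq <| (drop 4).seq <| (drop 5).seq (inc 2)

/-- A bound for the cost of a rule. -/
def ruleWeight (R : Rule) : ℕ := weight (R.out.map fun i => ((![2, 3, 4, 5] : Fin 4 → Fin 8) i.1, i.2.1, i.2.2))

theorem headD_le {l : List ℕ} {H : ℕ} (h : ∀ x ∈ l, x ≤ H) : l.headD 0 ≤ H := by
  cases l with
  | nil => simp
  | cons x l => exact h x (by simp)

theorem Runs.rule {R : Rule} (hR : R.arity ≤ 3) {l o : List ℕ} {j H : ℕ} (hl : ∀ x ∈ l, x ≤ H)
    (hj : j ≤ H) : Runs (Prog.rule R) ![l, [], [j], [], [], [], o, []]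
      ![l.drop R.arity, [], [j + 1], [], [], [], (R.eval j l).reverse ++ o, []]
      ((ruleWeight R + 10) * (H + 1)) := by
  have ht : ∀ (l : List ℕ), (∀ x ∈ l, x ≤ H) → ∀ x ∈ l.tail, x ≤ H := fun l h x hx =>
    h x (List.mem_of_mem_tail hx)
  have ht' : ∀ (p : Prop) [Decidable p] (l : List ℕ), (∀ x ∈ l, x ≤ H) →
      ∀ x ∈ (if p then l.tail else l), x ≤ H := fun p _ l h => by
    split_ifs
    · exact ht l h
    · exact h
  set l1 := if 0 < R.arity then l.tail else l with e1
  set l2 := if 1 < R.arity then l1.tail else l1 with e2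
  set l3 := if 2 < R.arity then l2.tail else l2 with e3
  have hl1 : ∀ x ∈ l1, x ≤ H := ht' _ _ hl
  have hl2 : ∀ x ∈ l2, x ≤ H := ht' _ _ hl1
  set x1 := if 0 < R.arity then l.headD 0 else 0 with f1
  set x2 := if 1 < R.arity then l1.headD 0 else 0 with f2
  set x3 := if 2 < R.arity then l2.headD 0 else 0 with f3
  have hx1 : x1 ≤ H := by
    rw [f1]; split_ifs
    exacts [headD_le hl, Nat.zero_le _]
  have hx2 : x2 ≤ H := by
    rw [f2]; split_ifs
    exacts [headD_le hl1, Nat.zero_le _]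
  have hx3 : x3 ≤ H := by
    rw [f3]; split_ifs
    exacts [headD_le hl2, Nat.zero_le _]
  have hl3 : l3 = l.drop R.arity := by
    rw [e3, e2, e1]
    generalize R.arity = r at hR ⊢
    interval_cases r <;> rcases l with _ | ⟨_, _ | ⟨_, l⟩⟩ <;> simp
  have heval : R.eval j l = R.out.map fun i => i.2.1 * (![j, x1, x2, x3] i.1) + i.2.2 := by
    unfold Rule.eval
    have g2 : x2 = if 1 < R.arity then l.tail.headD 0 else 0 := by
      rw [f2, e1]
      split_ifs
      · rfl
      · omega
      · rfl
    have g3 : x3 = if 2 < R.arity then l.tail.tail.headD 0 else 0 := by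
      rw [f3, e2, e1]
      split_ifs <;> first | rfl | omega
    rw [g2, g3]
  have h1 := Runs.arg (0 < R.arity) (b := 3) (by decide) (B := ![l, [], [j], [], [], [], o, []])
    (H := H) hl
  have h2 := Runs.arg (1 < R.arity) (b := 4) (by decide) (B := ![l1, [], [j], [x1], [], [], o, []])
    (H := H) hl1
  have h3 := Runs.arg (2 < R.arity) (b := 5) (by decide)
    (B := ![l2, [], [j], [x1], [x2], [], o, []]) (H := H) hl2
  have h4 := Runs.emit (N := 8) (o := 6) (t := 7) (by decide)
    (is := R.out.map fun i => (![2, 3, 4, 5] i.1, i.2.1, i.2.2))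
    (B := ![l3, [], [j], [x1], [x2], [x3], o, []]) (H := H) (fun i hi => by
      obtain ⟨⟨k, μ, c⟩, -, rfl⟩ := List.mem_map.1 hi
      fin_cases k <;> simp [hj, hx1, hx2, hx3]) rfl
  have hv : (R.out.map fun i => ((![2, 3, 4, 5] : Fin 4 → Fin 8) i.1, i.2.1, i.2.2)).map
      (Item.val ![l3, [], [j], [x1], [x2], [x3], o, []]) = R.eval j l := by
    rw [heval, List.map_map]
    refine List.map_congr_left fun ⟨k, μ, c⟩ _ => ?_
    fin_cases k <;> simp [Item.val]
  rw [hv] at h4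
  set o' := (R.eval j l).reverse ++ o
  have h5 := Runs.drop (N := 8) (k := 3) (B := ![l3, [], [j], [x1], [x2], [x3], o', []])
    (j := x1) (l := []) rfl
  have h6 := Runs.drop (N := 8) (k := 4) (B := ![l3, [], [j], [], [x2], [x3], o', []])
    (j := x2) (l := []) rfl
  have h7 := Runs.drop (N := 8) (k := 5) (B := ![l3, [], [j], [], [], [x3], o', []])
    (j := x3) (l := []) rfl
  have h8 := Runs.inc (N := 8) (k := 2) (B := ![l3, [], [j], [], [], [], o', []])
    (j := j) (l := []) rfl
  refine (h1.seq <| (h2.congr_left ?_).seq <| (h3.congr_left ?_).seq <| (h4.congr_left ?_).seq <|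
    (h5.congr_left ?_).seq <| (h6.congr_left ?_).seq <| (h7.congr_left ?_).seq
    (h8.congr_left ?_)).congr ?_ |>.mono ?_
  · funext k; fin_cases k <;> simp [e1, f1]
  · funext k; fin_cases k <;> simp [e2, f2]
  · funext k; fin_cases k <;> simp [e3, f3]
  · funext k; fin_cases k <;> simp [o']
  · funext k; fin_cases k <;> simp
  · funext k; fin_cases k <;> simp
  · funext k; fin_cases k <;> simp
  · funext k; fin_cases k <;> simp [hl3]
  · change _ + (_ + (_ + (ruleWeight R * (H + 1) + _))) ≤ _
    nlinarith

end Prog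

/-- Output is pushed on a stack, so the reversed output comes first. Entries, positions and the
number of tokens are all bounded by the length of the unary input, which gives quadratic time. -/
theorem polyTime_transduce_reverse (rs : List Rule) (r : Rule) (hr : ∀ R ∈ r :: rs, R.arity ≤ 3) :
    PolyTime bits bits (fun l : List ℕ => (transduce rs r 0 l).reverse) := by
  set W := ((r :: rs).map ruleWeight).sum with hW
  have hget : ∀ d, rs.getD d r ∈ r :: rs := fun d => by
    rcases lt_or_ge d rs.length with h | h
    · rw [List.getD_eq_getElem _ _ h]
      exact List.mem_cons_of_mem _ (List.getElem_mem _)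
    · rw [List.getD_eq_default _ _ h]
      exact List.mem_cons_self
  have hWR : ∀ d, ruleWeight (rs.getD d r) ≤ W := fun d =>
    List.single_le_sum (fun _ _ => Nat.zero_le _) _ (List.mem_map_of_mem (hget d))
  let F : Prog 8 := each 0 1 (switch 1 (rs.map Prog.rule) (Prog.rule r))
  -- The induction is on a bound `n` for the length, since one rule may consume several entries. The
  -- final position is known only up to `j' ≤ H`, which is enough for dropping it.
  have key : ∀ (H n : ℕ) (l o : List ℕ) (j : ℕ), l.length ≤ n → (∀ x ∈ l, x ≤ H) →
      j + l.length ≤ H → ∃ j' ≤ H, F.Runs ![l, [], [j], [], [], [], o, []]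
        ![[], [], [j'], [], [], [], (transduce rs r j l).reverse ++ o, []]
        (n * ((W + 15) * (H + 1)) + 1) := by
    intro H n
    induction n with
    | zero =>
      intro l o j hn hl hj
      obtain rfl : l = [] := List.length_eq_zero_iff.1 (by omega)
      refine ⟨j, by omega, (Runs.each_nil rfl).congr ?_ |>.mono (by omega)⟩
      simp [transduce]
    | succ n ih =>
      intro l o j hn hl hj
      cases l with
      | nil =>
        refine ⟨j, by omega, (Runs.each_nil rfl).congr ?_ |>.mono (by omega)⟩
        simp [transduce]
      | cons d l =>
        rw [List.length_cons] at hn hj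
        have hd : d ≤ H := hl d (by simp)
        have hl' : ∀ x ∈ l, x ≤ H := fun x hx => hl x (by simp [hx])
        set R := rs.getD d r with hR
        obtain ⟨j', hj', h'⟩ := ih (l.drop R.arity) ((R.eval j l).reverse ++ o) (j + 1)
          (by rw [List.length_drop]; omega) (fun x hx => hl' x (List.mem_of_mem_drop hx))
          (by rw [List.length_drop]; omega)
        refine ⟨j', hj', (Runs.each_cons (by decide) rfl (Runs.switch rfl
          (T := (ruleWeight R + 10) * (H + 1))
          (B' := ![l.drop R.arity, [], [j + 1], [], [], [], (R.eval j l).reverse ++ o, []]) ?_)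
          h').congr ?_ |>.mono ?_⟩
        · have : (rs.map Prog.rule).getD d (Prog.rule r) = Prog.rule R := by
            rw [hR, List.getD_map]
          rw [this]
          refine (Runs.rule (hr R (hget d)) (o := o) hl' (show j ≤ H by omega)).congr_left ?_
          funext k; fin_cases k <;> simp
        · rw [transduce, List.reverse_append, List.append_assoc]
        · have := hWR d
          rw [← hR] at this
          nlinarith [Nat.mul_le_mul_right (H + 1) this]
  refine PolyTime.of_prog (N := 8) (ex := id) (ey := id)
    ((zero 2).seq (F.seq (drop 2))) 0 6 ((W + 17 : ℕ) * (.X + 1) * (.X + 1)) fun l => ?_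
  obtain ⟨j', hj', h2⟩ := key (bits l).length l.length l [] 0 le_rfl
    (fun x hx => (le_length_bits hx).le) (by simpa using length_le_length_bits l)
  have h1 := Runs.zero (N := 8) 2 ![l, [], [], [], [], [], [], []]
  have h3 := Runs.drop (N := 8) (k := 2)
    (B := ![[], [], [j'], [], [], [], (transduce rs r 0 l).reverse ++ [], []])
    (j := j') (l := []) rfl
  refine ((h1.congr_left ?_).seq ((h2.congr_left ?_).seq (h3.congr_left rfl))).congr ?_ |>.mono ?_
  iterate 3 funext k; fin_cases k <;> simp [single]
  have := length_le_length_bits l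
  simp
  nlinarith [Nat.mul_le_mul_right ((W + 15) * ((bits l).length + 1)) this]

theorem polyTime_transduce (rs : List Rule) (r : Rule) (hr : ∀ R ∈ r :: rs, R.arity ≤ 3) :
    PolyTime bits bits (fun l : List ℕ => transduce rs r 0 l) := by
  simpa using polyTime_reverse.comp (polyTime_transduce_reverse rs r hr)

/-! ## Passing between strings and lists of numbers -/

/-- Parse a bit string as a list of numbers; a final zero is added if it is missing. -/
def ofBits : List Bool → List ℕ
  | [] => []
  | false :: l => 0 :: ofBits l
  | true :: l => ((ofBits l).headD 0 + 1) :: (ofBits l).tail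

theorem ofBits_bits (l : List ℕ) : ofBits (bits l) = l := by
  induction l with
  | nil => rfl
  | cons k l ih =>
    induction k with
    | zero => rw [bits_zero_cons, ofBits, ih]
    | succ k ihk => rw [bits_succ_cons, ofBits, ihk]; simp

/-- Only a block of ones at the very end can lack its terminator. Arbitrary strings are parsed
because `gen` is uncontrolled outside the promise, while a reduction must be total. -/
theorem bits_ofBits (x : List Bool) :
    bits (ofBits x) = if x.getLast? = some true then x ++ [false] else x := by
  induction x with
  | nil => rfl
  | cons b x ih =>
    cases b with
    | false =>
      rw [ofBits, bits_zero_cons, ih]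
      cases x with
      | nil => simp
      | cons c x => simp [List.getLast?_cons_cons]; split_ifs <;> rfl
    | true =>
      rw [ofBits]
      cases x with
      | nil => simp [ofBits, bits]
      | cons c x =>
        have : ofBits (c :: x) ≠ [] := by cases c <;> simp [ofBits]
        obtain ⟨k, l, h⟩ := List.exists_cons_of_ne_nil this
        rw [h] at ih ⊢
        rw [List.headD_cons, List.tail_cons, bits_succ_cons, ih]
        simp only [List.getLast?_cons_cons]
        split_ifs <;> rfl

/-- Reversing the input onto the second stack exposes its last bit, which decides about the extra
zero; moving back restores the order. -/
theorem polyTime_ofBits : PolyTime id bits ofBits := by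
  let G : Option Bool → Prog 2 := fun o => match o with
    | some true => (Frag.push 0 false).seq (Frag.push 0 true)
    | some false => Frag.push 0 false
    | none => Frag.skip
  refine PolyTime.of_frag (K := Fin 2) () ((Frag.move 0 1 id id).seq
    ((Frag.popCase 1 id G).seq (Frag.move 1 0 id id))) 0 0 (Equiv.refl _) (Equiv.refl _)
    (4 * .X + 10) fun x => ?_
  have h1 := Frag.Runs.move (t₀ := ()) (K := Fin 2) (Γ := fun _ => Bool) (a := 0) (b := 1)
    (by decide) id id ![x, []]
  have hx : x = x.reverse.reverse := by simp
  have h2 : Frag.Runs () (Frag.popCase 1 id G) ![[], x.reverse]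
      ![(bits (ofBits x)).drop (x.length - 1), x.reverse.tail] 3 := by
    refine Frag.Runs.popCase (T := 2) ?_
    rw [bits_ofBits]
    rcases hr : x.reverse with _ | ⟨b, y⟩
    · obtain rfl : x = [] := by simpa using hr
      refine (Frag.Runs.skip _).congr ?_ |>.mono (by omega)
      funext k; fin_cases k <;> simp
    · have : x = y.reverse ++ [b] := by rw [hx, hr]; simp
      subst this
      cases b with
      | false =>
        refine (Frag.Runs.push _ _ _).congr ?_ |>.mono (by omega)
        funext k; fin_cases k <;> simp
      | true =>
        refine ((Frag.Runs.push _ _ _).seq (Frag.Runs.push _ _ _)).congr ?_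
        funext k; fin_cases k <;> simp
  have h3 := Frag.Runs.move (t₀ := ()) (K := Fin 2) (Γ := fun _ => Bool) (a := 1) (b := 0)
    (by decide) id id ![(bits (ofBits x)).drop (x.length - 1), x.reverse.tail]
  refine ((h1.congr_left ?_).seq ((h2.congr_left ?_).seq h3)).congr ?_ |>.mono ?_
  · funext k; fin_cases k <;> simp [single]
  · funext k; fin_cases k <;> simp
  · have : bits (ofBits x) = x.take (x.length - 1) ++ (bits (ofBits x)).drop (x.length - 1) := by
      conv_lhs => rw [← List.take_append_drop (x.length - 1) (bits (ofBits x))]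
      congr 1
      rw [bits_ofBits]
      split_ifs
      · rw [List.take_append_of_le_length (by omega)]
      · rfl
    funext k; fin_cases k
    · simp only [Fin.zero_eta, single, Function.update_self]
      rw [Equiv.refl_symm, Equiv.coe_refl, List.map_id, this]
      simp [← List.dropLast_eq_take]
    · simp [single]
  · simp
    omega

theorem runs_count (o : Bool) (x : List Bool) (l : List Bool) :
    Frag.Runs () (Frag.move 0 1 id (fun _ => o) : Prog 2) ![x, l]
      ![[], List.replicate x.length o ++ l] (2 * x.length + 1) := by
  refine (Frag.Runs.move (t₀ := ()) (K := Fin 2) (Γ := fun _ => Bool) (a := 0) (b := 1)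
    (by decide) id (fun _ => o) ![x, l]).congr ?_
  funext k; fin_cases k
  · simp
  · simp [List.map_const']

theorem polyTime_length : PolyTime id Computability.unaryEncodeNat (fun x : List Bool => x.length) := by
  refine PolyTime.of_frag (K := Fin 2) (Γ := fun _ => Bool) ()
    (Frag.move 0 1 id (fun _ => true)) 0 1 (Equiv.refl _)
    (Equiv.refl _) (2 * .X + 1) fun x => ?_
  refine ((runs_count true x []).congr_left ?_).congr ?_ |>.mono (by simp)
  · funext k; fin_cases k <;> simp [single]
  · funext k; fin_cases k
    · simp [single]
    · simp [single]
      induction x.length with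
      | zero => rfl
      | succ n ih => rw [Computability.unaryEncodeNat, List.replicate_succ, ih]

theorem polyTime_unary_singleton :
    PolyTime Computability.unaryEncodeNat bits (fun k => [k]) := by
  refine PolyTime.of_frag (K := Fin 2) (Γ := fun _ => Bool) ()
    ((Frag.push 1 false).seq
    (Frag.move 0 1 id (fun _ => true))) 0 1 (Equiv.refl _)
    (Equiv.refl _) (2 * .X + 2) fun n => ?_
  have hn : (Computability.unaryEncodeNat n).length = n := by
    induction n with
    | zero => rfl
    | succ n ih => rw [Computability.unaryEncodeNat, List.length_cons, ih]
  have h1 := Frag.Runs.push (t₀ := ()) (K := Fin 2) (Γ := fun _ => Bool) 1 false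
    ![Computability.unaryEncodeNat n, []]
  refine ((h1.congr_left ?_).seq ((runs_count true (Computability.unaryEncodeNat n) [false]).congr_left ?_)).congr ?_ |>.mono ?_
  · funext k; fin_cases k <;> simp [single]
  · funext k; fin_cases k <;> simp
  · funext k; fin_cases k
    · simp [single]
    · simp [single, hn, bits]
  · simp; omega

theorem polyTime_length_singleton : PolyTime id bits (fun x : List Bool => [x.length]) :=
  polyTime_unary_singleton.comp polyTime_length

/-! ## Gates on qubits numbered by natural numbers

Amplitudes are functions on all bit sequences `ℕ → Bool`; this makes it possible to treat circuits
on different numbers of qubits together. -/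

/-- The gates, acting on qubits numbered by natural numbers. -/
inductive RGate : Type
  | h (q : ℕ) : RGate
  | t (q : ℕ) : RGate
  | ti (q : ℕ) : RGate
  | cx (c t : ℕ) : RGate
  | ccx (c d t : ℕ) : RGate

namespace RGate

/-- The code of a gate. -/
def code : RGate → List ℕ
  | h q => [0, q]
  | t q => [1, q]
  | ti q => [2, q]
  | cx c r => [3, c, r]
  | ccx c d r => [4, c, d, r]

/-- The qubits of the gate are distinct and their numbers are less than `M`. -/
def Valid (M : ℕ) : RGate → Prop
  | h q => q < M
  | t q => q < M
  | ti q => q < M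
  | cx c r => c < M ∧ r < M ∧ c ≠ r
  | ccx c d r => c < M ∧ d < M ∧ r < M ∧ c ≠ d ∧ c ≠ r ∧ d ≠ r

/-- The complex conjugate gate, which is also the inverse gate. -/
def conj : RGate → RGate
  | t q => ti q
  | ti q => t q
  | g => g

/-- The eighth root of unity. -/
def omega : ℂ := Complex.exp (Real.pi / 4 * Complex.I)

/-- The action of a gate on amplitudes. -/
def act : RGate → ((ℕ → Bool) → ℂ) → (ℕ → Bool) → ℂ
  | h q, ψ => fun y => (ψ (Function.update y q false) +
      (if y q = true then -1 else 1) * ψ (Function.update y q true)) / (Real.sqrt 2 : ℂ)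
  | t q, ψ => fun y => (if y q = true then omega else 1) * ψ y
  | ti q, ψ => fun y => (if y q = true then starRingEnd ℂ omega else 1) * ψ y
  | cx c r, ψ => fun y => ψ (Function.update y r (xor (y r) (y c)))
  | ccx c d r, ψ => fun y => ψ (Function.update y r (xor (y r) (y c && y d)))

theorem omega_conj : starRingEnd ℂ omega = Complex.exp (-(Real.pi / 4 * Complex.I)) := by
  rw [omega, ← Complex.exp_conj]
  congr 1
  rw [map_mul, map_div₀, Complex.conj_ofReal, Complex.conj_I, Complex.conj_ofNat]
  ring

theorem conj_omega_mul : starRingEnd ℂ omega * omega = 1 := by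
  rw [omega_conj, omega, ← Complex.exp_add]
  simp

theorem omega_mul_conj : omega * starRingEnd ℂ omega = 1 := by
  rw [mul_comm, conj_omega_mul]

theorem omega_sq : omega * omega = Complex.I := by
  rw [omega, ← Complex.exp_add, ← add_mul]
  rw [show (Real.pi / 4 + Real.pi / 4 : ℂ) = Real.pi / 2 by ring, Complex.exp_pi_div_two_mul_I]

theorem omega_pow_four : omega * (omega * (omega * omega)) = -1 := by
  rw [omega_sq, ← mul_assoc, omega_sq, Complex.I_mul_I]

theorem sqrt_two_mul : (Real.sqrt 2 : ℂ) * (Real.sqrt 2 : ℂ) = 2 := by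
  rw [← Complex.ofReal_mul, Real.mul_self_sqrt (by norm_num)]
  norm_num

theorem sqrt_two_ne : (Real.sqrt 2 : ℂ) ≠ 0 := by
  intro h
  have := sqrt_two_mul
  rw [h] at this
  norm_num at this

theorem conj_conj (g : RGate) : g.conj.conj = g := by cases g <;> rfl

theorem Valid.conj {M : ℕ} {g : RGate} (h : g.Valid M) : g.conj.Valid M := by
  cases g <;> exact h

theorem act_conj_act {M : ℕ} {g : RGate} (h : g.Valid M) (ψ : (ℕ → Bool) → ℂ) :
    g.conj.act (g.act ψ) = ψ := by
  funext y
  cases g with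
  | h q =>
    simp only [RGate.conj, act, Function.update_idem, Function.update_self, Bool.false_eq_true,
      if_true, if_false]
    have h2 := sqrt_two_mul
    have hne := sqrt_two_ne
    rcases hq : y q
    · rw [← hq, Function.update_eq_self]
      field_simp
      rw [hq]
      simp [sq, h2]
      ring
    · rw [← hq, Function.update_eq_self]
      field_simp
      rw [sq, h2]
      simp
      ring
  | t q =>
    simp only [RGate.conj, act]
    split_ifs
    · rw [← mul_assoc, conj_omega_mul, one_mul]
    · simp
  | ti q =>
    simp only [RGate.conj, act]
    split_ifs
    · rw [← mul_assoc, omega_mul_conj, one_mul]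
    · simp
  | cx c r =>
    obtain ⟨-, -, h⟩ := h
    simp [RGate.conj, act, Function.update_of_ne h]
  | ccx c d r =>
    obtain ⟨-, -, -, -, h, h'⟩ := h
    simp [RGate.conj, act, Function.update_of_ne h, Function.update_of_ne h']

/-- The gates are symmetric matrices, so inverse and entrywise conjugate coincide; `act_conj_act`
expresses the first aspect, this identity the second. -/
theorem act_conj (g : RGate) (ψ : (ℕ → Bool) → ℂ) :
    g.conj.act ψ = fun y => starRingEnd ℂ (g.act (fun x => starRingEnd ℂ (ψ x)) y) := by
  funext y
  cases g <;> simp [RGate.conj, act, apply_ite (starRingEnd ℂ)]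

end RGate

open RGate hiding h t ti cx ccx code conj

/-- The action of a sequence of gates on amplitudes. -/
def run : List RGate → ((ℕ → Bool) → ℂ) → (ℕ → Bool) → ℂ
  | [], ψ => ψ
  | g :: l, ψ => run l (g.act ψ)

@[simp] theorem run_nil (ψ : (ℕ → Bool) → ℂ) : run [] ψ = ψ := rfl

theorem run_cons (g : RGate) (l : List RGate) (ψ : (ℕ → Bool) → ℂ) :
    run (g :: l) ψ = run l (g.act ψ) := rfl

theorem run_append (l l' : List RGate) (ψ : (ℕ → Bool) → ℂ) :
    run (l ++ l') ψ = run l' (run l ψ) := by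
  induction l generalizing ψ with
  | nil => rfl
  | cons g l ih => exact ih _

/-- The inverse circuit. -/
def inv (l : List RGate) : List RGate := (l.map RGate.conj).reverse

theorem inv_append (l l' : List RGate) : inv (l ++ l') = inv l' ++ inv l := by simp [inv]

theorem inv_inv (l : List RGate) : inv (inv l) = l := by
  simp [inv, Function.comp_def, conj_conj]

theorem valid_inv {M : ℕ} {l : List RGate} (h : ∀ g ∈ l, g.Valid M) : ∀ g ∈ inv l, g.Valid M := by
  intro g hg
  simp only [inv, List.mem_reverse, List.mem_map] at hg
  obtain ⟨g, hg, rfl⟩ := hg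
  exact (h g hg).conj

theorem run_inv_run {M : ℕ} {l : List RGate} (h : ∀ g ∈ l, g.Valid M) (ψ : (ℕ → Bool) → ℂ) :
    run (inv l) (run l ψ) = ψ := by
  induction l generalizing ψ with
  | nil => rfl
  | cons g l ih =>
    have : inv (g :: l) = inv l ++ [g.conj] := by simp [inv]
    rw [this, run_cons, run_append, ih (fun g hg => h g (by simp [hg]))]
    exact act_conj_act (h g (by simp)) ψ

theorem run_run_inv {M : ℕ} {l : List RGate} (h : ∀ g ∈ l, g.Valid M) (ψ : (ℕ → Bool) → ℂ) :
    run l (run (inv l) ψ) = ψ := by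
  have := run_inv_run (valid_inv h) ψ
  rwa [inv_inv] at this

theorem run_map_conj (l : List RGate) (ψ : (ℕ → Bool) → ℂ) :
    run (l.map RGate.conj) ψ = fun y => starRingEnd ℂ (run l (fun x => starRingEnd ℂ (ψ x)) y) := by
  induction l generalizing ψ with
  | nil => simp [run]
  | cons g l ih => rw [List.map_cons, run_cons, ih, run_cons, act_conj]; simp

/-! ## Relation to matrices -/

/-- The gate, forgetting the number of qubits. -/
def Gate.raw {n : ℕ} : Gate n → RGate
  | .hadamard q => .h q
  | .tGate q => .t q
  | .tInv q => .ti q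
  | .cnot c t _ => .cx c t
  | .toffoli c d t _ _ _ => .ccx c d t

theorem Gate.raw_code {n : ℕ} (g : Gate n) : g.raw.code = g.code := by cases g <;> rfl

theorem Gate.raw_valid {n : ℕ} (g : Gate n) : g.raw.Valid n := by
  cases g <;> simp_all [Gate.raw, RGate.Valid, Fin.val_inj]

/-- The sequence of gates of a circuit. -/
def Circuit.raw {n : ℕ} (C : Circuit n) : List RGate := C.map Gate.raw

theorem Circuit.raw_valid {n : ℕ} (C : Circuit n) : ∀ g ∈ C.raw, g.Valid n := by
  intro g hg
  obtain ⟨g, -, rfl⟩ := List.mem_map.1 hg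
  exact g.raw_valid

theorem Circuit.code_eq {n : ℕ} (C : Circuit n) : C.code = C.raw.flatMap RGate.code := by
  induction C with
  | nil => rfl
  | cons g C ih =>
    rw [Circuit.code, List.flatMap_cons, ← Circuit.code, ih, ← Gate.raw_code]
    rfl

theorem exists_circuit {n : ℕ} {l : List RGate} (h : ∀ g ∈ l, g.Valid n) :
    ∃ C : Circuit n, C.raw = l := by
  induction l with
  | nil => exact ⟨[], rfl⟩
  | cons g l ih =>
    obtain ⟨C, rfl⟩ := ih fun g hg => h g (by simp [hg])
    have hg := h g (by simp)
    have : ∃ g' : Gate n, g'.raw = g := by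
      cases g with
      | h q => exact ⟨.hadamard ⟨q, hg⟩, rfl⟩
      | t q => exact ⟨.tGate ⟨q, hg⟩, rfl⟩
      | ti q => exact ⟨.tInv ⟨q, hg⟩, rfl⟩
      | cx c r =>
        exact ⟨.cnot ⟨c, hg.1⟩ ⟨r, hg.2.1⟩ (fun e => hg.2.2 (Fin.mk.inj_iff.1 e)), rfl⟩
      | ccx c d r =>
        obtain ⟨h1, h2, h3, h4, h5, h6⟩ := hg
        exact ⟨.toffoli ⟨c, h1⟩ ⟨d, h2⟩ ⟨r, h3⟩ (fun e => h4 (Fin.mk.inj_iff.1 e))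
          (fun e => h5 (Fin.mk.inj_iff.1 e)) (fun e => h6 (Fin.mk.inj_iff.1 e)), rfl⟩
    obtain ⟨g', rfl⟩ := this
    exact ⟨g' :: C, rfl⟩

theorem extend_update {α β : Type*} [DecidableEq α] [DecidableEq β] {p : α → β}
    (hp : Function.Injective p) (y : α → Bool) (z : β → Bool) (i : α) (b : Bool) :
    Function.extend p (Function.update y i b) z =
      Function.update (Function.extend p y z) (p i) b := by
  funext k
  by_cases h : ∃ j, p j = k
  · obtain ⟨j, rfl⟩ := h
    rw [hp.extend_apply]
    by_cases hj : j = i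
    · subst hj; simp
    · rw [Function.update_of_ne hj, Function.update_of_ne (fun e => hj (hp e)), hp.extend_apply]
  · rw [Function.extend_apply' _ _ _ h, Function.update_of_ne (fun e => h ⟨i, e.symm⟩),
      Function.extend_apply' _ _ _ h]

/-- Fix all qubits from `n` on. -/
def restrict (n : ℕ) (z : ℕ → Bool) (ψ : (ℕ → Bool) → ℂ) : (Fin n → Bool) → ℂ :=
  fun y => ψ (Function.extend Fin.val y z)

theorem sum_hadamard {n : ℕ} (q : Fin n) (y : Fin n → Bool) (f : (Fin n → Bool) → ℂ) :
    (∑ x, if ∀ j, j ≠ q → y j = x j then f x else 0) =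
      f (Function.update y q false) + f (Function.update y q true) := by
  rw [← Finset.sum_filter]
  have : (Finset.univ.filter fun x : Fin n → Bool => ∀ j, j ≠ q → y j = x j) =
      {Function.update y q false, Function.update y q true} := by
    ext x
    simp only [Finset.mem_filter, Finset.mem_univ, true_and, Finset.mem_insert,
      Finset.mem_singleton, funext_iff]
    constructor
    · intro h
      cases hx : x q
      · left
        intro j
        by_cases hj : j = q
        · subst hj; simp [hx]
        · rw [Function.update_of_ne hj, h j hj]
      · right
        intro j
        by_cases hj : j = q
        · subst hj; simp [hx]
        · rw [Function.update_of_ne hj, h j hj]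
    · rintro (h | h) j hj <;> rw [h j, Function.update_of_ne hj]
  rw [this, Finset.sum_pair]
  intro h
  simpa using congrFun h q

theorem sum_involution {n : ℕ} (f : (Fin n → Bool) → Fin n → Bool) (hf : ∀ x, f (f x) = x)
    (y : Fin n → Bool) (ψ : (Fin n → Bool) → ℂ) :
    (∑ x, (if y = f x then 1 else 0) * ψ x) = ψ (f y) := by
  have : ∀ x, y = f x ↔ x = f y := fun x => ⟨fun h => by rw [h, hf], fun h => by rw [h, hf]⟩
  simp [this]

/-- Qubits from `n` on are spectators: fixing them commutes with the gate. Amplitudes on infinitely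
many qubits thus carry the same information as the finite matrices. -/
theorem restrict_act {n : ℕ} (g : Gate n) (z : ℕ → Bool) (ψ : (ℕ → Bool) → ℂ) :
    restrict n z (g.raw.act ψ) = g.toMatrix.mulVec (restrict n z ψ) := by
  funext y
  have hv : ∀ q : Fin n, Function.extend Fin.val y z q = y q := fun q =>
    Fin.val_injective.extend_apply _ _ _
  cases g with
  | hadamard q =>
    simp only [restrict, Gate.raw, act, Gate.toMatrix, Matrix.mulVec, dotProduct, Matrix.of_apply,
      ite_mul, zero_mul]
    rw [sum_hadamard, hv, extend_update Fin.val_injective, extend_update Fin.val_injective]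
    simp only [Function.update_self, Bool.false_eq_true, false_and, true_and, if_false]
    split_ifs <;> ring
  | tGate q =>
    simp only [restrict, Gate.raw, act, Gate.toMatrix, Matrix.mulVec_diagonal, hv, omega]
  | tInv q =>
    simp only [restrict, Gate.raw, act, Gate.toMatrix, Matrix.mulVec_diagonal, hv, omega_conj]
  | cnot c t h =>
    simp only [restrict, Gate.raw, act, Gate.toMatrix, Matrix.mulVec, dotProduct, Matrix.of_apply,
      hv, ← extend_update Fin.val_injective]
    rw [sum_involution (fun x => Function.update x t (xor (x t) (x c)))
      (fun x => by simp [Function.update_of_ne h])]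
  | toffoli c d t _ h h' =>
    simp only [restrict, Gate.raw, act, Gate.toMatrix, Matrix.mulVec, dotProduct, Matrix.of_apply,
      hv, ← extend_update Fin.val_injective]
    rw [sum_involution (fun x => Function.update x t (xor (x t) (x c && x d)))
      (fun x => by simp [Function.update_of_ne h, Function.update_of_ne h'])]

theorem restrict_run {n : ℕ} (C : Circuit n) (z : ℕ → Bool) (ψ : (ℕ → Bool) → ℂ) :
    restrict n z (run C.raw ψ) = C.toMatrix.mulVec (restrict n z ψ) := by
  induction C generalizing ψ with
  | nil => simp [Circuit.raw, Circuit.toMatrix]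
  | cons g C ih =>
    rw [Circuit.raw, List.map_cons, run_cons, ← Circuit.raw, ih, restrict_act, Circuit.toMatrix,
      Matrix.mulVec_mulVec]

/-- A basis state. -/
def ket (x : ℕ → Bool) : (ℕ → Bool) → ℂ := fun y => open Classical in if y = x then 1 else 0

/-- Extend a bit vector by zeros. -/
def pad {n : ℕ} (x : Fin n → Bool) : ℕ → Bool := Function.extend Fin.val x fun _ => false

theorem pad_val {n : ℕ} (x : Fin n → Bool) (i : Fin n) : pad x i = x i :=
  Fin.val_injective.extend_apply _ _ _

theorem pad_of_lt {n : ℕ} (x : Fin n → Bool) {i : ℕ} (h : i < n) : pad x i = x ⟨i, h⟩ :=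
  pad_val x ⟨i, h⟩

theorem extend_injective (n : ℕ) (z : ℕ → Bool) :
    Function.Injective fun y : Fin n → Bool => Function.extend Fin.val y z := by
  intro x y h
  funext i
  have := congrFun h i
  simpa [Fin.val_injective.extend_apply] using this

theorem run_extend {n : ℕ} (C : Circuit n) (x y : Fin n → Bool) (z : ℕ → Bool) :
    run C.raw (ket (Function.extend Fin.val x z)) (Function.extend Fin.val y z) =
      C.toMatrix y x := by
  have h1 := congrFun (restrict_run C z (ket (Function.extend Fin.val x z))) y
  have h2 : restrict n z (ket (Function.extend Fin.val x z)) = Pi.single x 1 := by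
    funext y
    simp only [restrict, ket, (extend_injective n z).eq_iff, Pi.single_apply]
  rw [h2, Matrix.mulVec_single_one] at h1
  exact h1

theorem toMatrix_eq_run {n : ℕ} (C : Circuit n) (y x : Fin n → Bool) :
    C.toMatrix y x = run C.raw (ket (pad x)) (pad y) := (run_extend C x y _).symm

theorem toMatrix_append {n : ℕ} (C D : Circuit n) :
    Circuit.toMatrix (C ++ D) = D.toMatrix * C.toMatrix := by
  induction C with
  | nil => simp [Circuit.toMatrix]
  | cons g C ih => rw [List.cons_append, Circuit.toMatrix, ih, Circuit.toMatrix, mul_assoc]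

/-- The inverse of a gate. -/
def Gate.inv {n : ℕ} : Gate n → Gate n
  | .tGate q => .tInv q
  | .tInv q => .tGate q
  | g => g

theorem Gate.raw_inv {n : ℕ} (g : Gate n) : g.inv.raw = g.raw.conj := by cases g <;> rfl

/-- The inverse circuit. -/
def Circuit.inv {n : ℕ} (C : Circuit n) : Circuit n := (C.map Gate.inv).reverse

theorem Circuit.raw_inv {n : ℕ} (C : Circuit n) : C.inv.raw = DQC.inv C.raw := by
  simp [Circuit.raw, Circuit.inv, DQC.inv, Function.comp_def, Gate.raw_inv]

theorem Gate.toMatrix_inv {n : ℕ} (g : Gate n) : g.inv.toMatrix = g.toMatrix.conjTranspose := by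
  ext y x
  cases g with
  | hadamard q =>
    simp only [Gate.inv, Gate.toMatrix, Matrix.conjTranspose_apply, Matrix.of_apply]
    by_cases h : ∀ j, j ≠ q → y j = x j
    · rw [if_pos h, if_pos fun j hj => (h j hj).symm]
      simp only [and_comm]
      split_ifs <;> simp
    · rw [if_neg h, if_neg fun h' => h fun j hj => (h' j hj).symm]
      simp
  | tGate q =>
    simp only [Gate.inv, Gate.toMatrix, Matrix.conjTranspose_apply, Matrix.diagonal_apply]
    by_cases h : y = x
    · subst h
      have := omega_conj
      rw [omega] at this
      simp only [if_true, ← this]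
      split_ifs <;> simp
    · rw [if_neg h, if_neg (Ne.symm h)]; simp
  | tInv q =>
    simp only [Gate.inv, Gate.toMatrix, Matrix.conjTranspose_apply, Matrix.diagonal_apply]
    by_cases h : y = x
    · subst h
      have := omega_conj
      rw [omega] at this
      simp only [if_true, ← this]
      split_ifs <;> simp
    · rw [if_neg h, if_neg (Ne.symm h)]; simp
  | cnot c t h =>
    simp only [Gate.inv, Gate.toMatrix, Matrix.conjTranspose_apply, Matrix.of_apply]
    have : y = Function.update x t (xor (x t) (x c)) ↔ x = Function.update y t (xor (y t) (y c)) :=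
      ⟨fun e => by rw [e]; simp [Function.update_of_ne h],
        fun e => by rw [e]; simp [Function.update_of_ne h]⟩
    simp only [this]
    split_ifs <;> simp
  | toffoli c d t h0 h h' =>
    simp only [Gate.inv, Gate.toMatrix, Matrix.conjTranspose_apply, Matrix.of_apply]
    have : y = Function.update x t (xor (x t) (x c && x d)) ↔
        x = Function.update y t (xor (y t) (y c && y d)) :=
      ⟨fun e => by rw [e]; simp [Function.update_of_ne h, Function.update_of_ne h'],
        fun e => by rw [e]; simp [Function.update_of_ne h, Function.update_of_ne h']⟩
    simp only [this]
    split_ifs <;> simp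

theorem Circuit.toMatrix_inv {n : ℕ} (C : Circuit n) :
    C.inv.toMatrix = C.toMatrix.conjTranspose := by
  induction C with
  | nil => simp [Circuit.inv, Circuit.toMatrix]
  | cons g C ih =>
    have : Circuit.inv (g :: C) = Circuit.inv C ++ [g.inv] := by simp [Circuit.inv]
    rw [this, toMatrix_append, ih, Circuit.toMatrix, Circuit.toMatrix, Circuit.toMatrix,
      Matrix.conjTranspose_mul, one_mul, Gate.toMatrix_inv]

/-- Unitarity is read off from the fact that the inverse circuit undoes the circuit on every basis
state. -/
theorem Circuit.conjTranspose_mul_self {n : ℕ} (C : Circuit n) :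
    C.toMatrix.conjTranspose * C.toMatrix = 1 := by
  refine Matrix.ext_of_mulVec_single fun x => ?_
  have h := restrict_run C (fun _ => false) (ket (pad x))
  have h' := restrict_run C.inv (fun _ => false) (run C.raw (ket (pad x)))
  rw [Circuit.raw_inv, run_inv_run C.raw_valid, h, Matrix.mulVec_mulVec,
    Circuit.toMatrix_inv] at h'
  have h2 : restrict n (fun _ => false) (ket (pad x)) = Pi.single x 1 := by
    funext y
    simp only [restrict, ket, pad, (extend_injective n _).eq_iff, Pi.single_apply]
  rw [h2] at h'
  rw [← h', Matrix.one_mulVec]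

theorem Circuit.mem_unitaryGroup {n : ℕ} (C : Circuit n) :
    C.toMatrix ∈ Matrix.unitaryGroup (Fin n → Bool) ℂ :=
  Matrix.mem_unitaryGroup_iff'.2 C.conjTranspose_mul_self

/-! ## The Hadamard test with one clean qubit -/

theorem sum_cons {m : ℕ} {M : Type*} [AddCommMonoid M] (f : (Fin (m + 1) → Bool) → M) :
    ∑ x, f x = ∑ x : Fin m → Bool, f (Fin.cons false x) + ∑ x : Fin m → Bool, f (Fin.cons true x) := by
  rw [← (Fin.consEquiv fun _ => Bool).sum_comp, Fintype.sum_prod_type, Fintype.sum_bool, add_comm]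
  rfl

theorem acceptProb_eq {m : ℕ} (Q : Circuit (m + 1)) :
    acceptProb Q = (∑ x : Fin m → Bool, ∑ y : Fin m → Bool,
      Complex.normSq (Q.toMatrix (Fin.cons true y) (Fin.cons false x))) / 2 ^ m := by
  have key : Matrix.trace (acceptProjector m * Q.toMatrix * initialState m *
      Q.toMatrix.conjTranspose) = ((∑ x : Fin m → Bool, ∑ y : Fin m → Bool,
      Complex.normSq (Q.toMatrix (Fin.cons true y) (Fin.cons false x)) / 2 ^ m : ℝ) : ℂ) := by
    rw [Finset.sum_comm, Matrix.trace, sum_cons]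
    simp only [Matrix.diag_apply, Matrix.mul_apply (N := Matrix.conjTranspose _), initialState,
      acceptProjector, Matrix.mul_diagonal, Matrix.diagonal_mul, Fin.cons_zero, Bool.false_eq_true,
      if_false, zero_mul, Finset.sum_const_zero, zero_add, if_true, one_mul, sum_cons, mul_zero,
      Bool.true_eq_false, add_zero]
    push_cast
    refine Finset.sum_congr rfl fun y _ => Finset.sum_congr rfl fun x _ => ?_
    rw [Matrix.conjTranspose_apply, Complex.normSq_eq_conj_mul_self, RCLike.star_def]
    ring
  rw [acceptProb, key, Complex.ofReal_re]
  simp only [Finset.sum_div]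

theorem hadamard_mulVec {n : ℕ} (q : Fin n) (ψ : (Fin n → Bool) → ℂ) (y : Fin n → Bool) :
    (Gate.hadamard q).toMatrix.mulVec ψ y = (ψ (Function.update y q false) +
      (if y q = true then -1 else 1) * ψ (Function.update y q true)) / (Real.sqrt 2 : ℂ) := by
  simp only [Gate.toMatrix, Matrix.mulVec, dotProduct, Matrix.of_apply, ite_mul, zero_mul]
  rw [sum_hadamard]
  simp only [Function.update_self, Bool.false_eq_true, false_and, true_and, if_false]
  split_ifs <;> ring

theorem tGate_mulVec {n : ℕ} (q : Fin n) (ψ : (Fin n → Bool) → ℂ) (y : Fin n → Bool) :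
    (Gate.tGate q).toMatrix.mulVec ψ y = (if y q = true then omega else 1) * ψ y := by
  simp only [Gate.toMatrix, Matrix.mulVec_diagonal, omega]

/-- The circuit that applies `C` between Hadamard gates on the clean qubit. -/
def hadamardTest {m : ℕ} (C : Circuit (m + 1)) : Circuit (m + 1) :=
  [.hadamard 0] ++ C ++ [.tGate 0, .tGate 0, .tGate 0, .tGate 0, .hadamard 0]

theorem cons_inj_left {m : ℕ} {a b : Bool} {x y : Fin m → Bool} :
    (Fin.cons a x : Fin (m + 1) → Bool) = Fin.cons b y ↔ a = b ∧ x = y :=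
  ⟨fun h => ⟨by simpa using congrFun h 0, by
    funext i; simpa using congrFun h i.succ⟩, fun ⟨h, h'⟩ => by rw [h, h']⟩

theorem exists_cons {m : ℕ} (x : Fin (m + 1) → Bool) :
    ∃ (b : Bool) (y : Fin m → Bool), x = Fin.cons b y :=
  ⟨x 0, Fin.tail x, (Fin.cons_self_tail x).symm⟩

theorem mulVec_single {n : ℕ} (M : QOp n) (y x : Fin n → Bool) :
    M y x = M.mulVec (Pi.single x 1) y := by simp

/-- By `hC` the matrix is block diagonal in the clean qubit. The four `T` gates form a Pauli `Z`;
its sign turns the difference of the two blocks, which a plain Hadamard test shows at outcome `1`,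
into their sum. -/
theorem hadamardTest_apply {m : ℕ} (C : Circuit (m + 1))
    (hC : ∀ y x, y 0 ≠ x 0 → C.toMatrix y x = 0) (x y : Fin m → Bool) :
    (hadamardTest C).toMatrix (Fin.cons true y) (Fin.cons false x) =
      (C.toMatrix (Fin.cons false y) (Fin.cons false x) +
        C.toMatrix (Fin.cons true y) (Fin.cons true x)) / 2 := by
  have h1 : (Gate.hadamard (0 : Fin (m + 1))).toMatrix.mulVec
      (Pi.single (Fin.cons false x : Fin (m + 1) → Bool) 1) =
      (1 / (Real.sqrt 2 : ℂ)) • ((Pi.single (Fin.cons false x) 1 : (Fin (m + 1) → Bool) → ℂ) +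
        Pi.single (Fin.cons true x) 1) := by
    funext z
    rw [hadamard_mulVec]
    obtain ⟨b, z, rfl⟩ := exists_cons z
    simp only [Fin.update_cons_zero, Fin.cons_zero, Pi.smul_apply,
      Pi.add_apply, Pi.single_apply, cons_inj_left, smul_eq_mul]
    cases b <;> simp [ite_div]
  have h2 : (hadamardTest C).toMatrix = (Gate.hadamard 0).toMatrix * ((Gate.tGate 0).toMatrix *
      ((Gate.tGate 0).toMatrix * ((Gate.tGate 0).toMatrix * ((Gate.tGate 0).toMatrix *
      (C.toMatrix * (Gate.hadamard 0).toMatrix))))) := by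
    rw [hadamardTest, toMatrix_append, toMatrix_append]
    simp only [Circuit.toMatrix, one_mul, Matrix.mul_assoc]
  have hω := omega_pow_four
  have h3 := sqrt_two_mul
  have h4 := sqrt_two_ne
  rw [mulVec_single (hadamardTest C).toMatrix, h2]
  simp only [← Matrix.mulVec_mulVec, h1]
  rw [hadamard_mulVec]
  simp only [tGate_mulVec, Matrix.mulVec_smul, Matrix.mulVec_add, Fin.update_cons_zero,
    Fin.cons_zero, Bool.false_eq_true, if_false, if_true, one_mul, Pi.smul_apply, Pi.add_apply,
    ← mulVec_single, smul_eq_mul]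
  rw [hC (Fin.cons false y) (Fin.cons true x) (by simp),
    hC (Fin.cons true y) (Fin.cons false x) (by simp)]
  generalize C.toMatrix (Fin.cons false y) (Fin.cons false x) = u
  generalize C.toMatrix (Fin.cons true y) (Fin.cons true x) = v
  have : 1 / (Real.sqrt 2 : ℂ) * (u + 0) + -1 * (omega * (1 / (Real.sqrt 2 : ℂ) *
      (omega * (omega * (omega * 0)) + omega * (omega * (omega * v))))) =
      (u + v) / (Real.sqrt 2 : ℂ) := by
    linear_combination -(v / (Real.sqrt 2 : ℂ)) * hω
  rw [this, div_div, h3]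

/-- Expand `|u + v|² / 4`. The columns of both diagonal blocks are unit vectors, so the squares
contribute `1/2`, and the cross terms form the normalized trace of `C₁† C₀`. -/
theorem acceptProb_hadamardTest {m : ℕ} (C : Circuit (m + 1))
    (hC : ∀ y x, y 0 ≠ x 0 → C.toMatrix y x = 0) :
    acceptProb (hadamardTest C) = 1 / 2 + (∑ x : Fin m → Bool, (∑ y : Fin m → Bool,
      starRingEnd ℂ (C.toMatrix (Fin.cons true y) (Fin.cons true x)) *
        C.toMatrix (Fin.cons false y) (Fin.cons false x)).re) / 2 ^ m / 2 := by
  have col : ∀ z, ∑ y, Complex.normSq (C.toMatrix y z) = 1 := fun z => by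
    have := congrFun (congrFun C.conjTranspose_mul_self z) z
    rw [Matrix.mul_apply, Matrix.one_apply_eq] at this
    simp only [Matrix.conjTranspose_apply, RCLike.star_def, ← Complex.normSq_eq_conj_mul_self] at this
    exact_mod_cast this
  have c0 : ∀ x : Fin m → Bool,
      ∑ y : Fin m → Bool, Complex.normSq (C.toMatrix (Fin.cons false y) (Fin.cons false x)) = 1 := by
    intro x
    rw [← col (Fin.cons false x), sum_cons, left_eq_add]
    refine Finset.sum_eq_zero fun y _ => ?_
    rw [hC _ _ (by simp), map_zero]
  have c1 : ∀ x : Fin m → Bool,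
      ∑ y : Fin m → Bool, Complex.normSq (C.toMatrix (Fin.cons true y) (Fin.cons true x)) = 1 := by
    intro x
    rw [← col (Fin.cons true x), sum_cons, right_eq_add]
    refine Finset.sum_eq_zero fun y _ => ?_
    rw [hC _ _ (by simp), map_zero]
  have hx : ∀ x : Fin m → Bool, ∑ y : Fin m → Bool,
      Complex.normSq ((hadamardTest C).toMatrix (Fin.cons true y) (Fin.cons false x)) =
      1 / 2 + (∑ y : Fin m → Bool,
        starRingEnd ℂ (C.toMatrix (Fin.cons true y) (Fin.cons true x)) *
        C.toMatrix (Fin.cons false y) (Fin.cons false x)).re / 2 := by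
    intro x
    have : ∀ y : Fin m → Bool,
        Complex.normSq ((hadamardTest C).toMatrix (Fin.cons true y) (Fin.cons false x)) =
        Complex.normSq (C.toMatrix (Fin.cons false y) (Fin.cons false x)) / 4 +
        Complex.normSq (C.toMatrix (Fin.cons true y) (Fin.cons true x)) / 4 +
        (starRingEnd ℂ (C.toMatrix (Fin.cons true y) (Fin.cons true x)) *
        C.toMatrix (Fin.cons false y) (Fin.cons false x)).re / 2 := by
      intro y
      rw [hadamardTest_apply C hC, map_div₀, Complex.normSq_add]
      simp only [Complex.normSq_apply, Complex.mul_re, Complex.conj_re, Complex.conj_im]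
      norm_num
      ring
    simp only [this, Finset.sum_add_distrib, ← Finset.sum_div, c0, c1, Complex.re_sum]
    norm_num
  rw [acceptProb_eq]
  simp only [hx, Finset.sum_add_distrib, ← Finset.sum_div, Finset.sum_const, Finset.card_univ,
    Fintype.card_fun, Fintype.card_bool, Fintype.card_fin, nsmul_eq_mul]
  have : (2 : ℝ) ^ m ≠ 0 := by positivity
  push_cast
  field_simp

/-! ### Circuits that preserve a qubit -/

namespace RGate

/-- The gate does not change qubit `k` (other than by a phase). -/
def Keeps (k : ℕ) : RGate → Prop
  | h q => q ≠ k
  | t _ => True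
  | ti _ => True
  | cx _ r => r ≠ k
  | ccx _ _ r => r ≠ k

theorem act_eq_zero {k : ℕ} {g : RGate} (hg : g.Keeps k) {b : Bool} {ψ : (ℕ → Bool) → ℂ}
    (hψ : ∀ y, y k ≠ b → ψ y = 0) (y : ℕ → Bool) (hy : y k ≠ b) : g.act ψ y = 0 := by
  cases g with
  | h q =>
    simp only [act]
    rw [hψ _ (by rwa [Function.update_of_ne hg.symm]),
      hψ _ (by rwa [Function.update_of_ne hg.symm])]
    simp
  | t q => simp only [act]; rw [hψ _ hy, mul_zero]
  | ti q => simp only [act]; rw [hψ _ hy, mul_zero]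
  | cx c r => exact hψ _ (by rwa [Function.update_of_ne hg.symm])
  | ccx c d r => exact hψ _ (by rwa [Function.update_of_ne hg.symm])

end RGate

theorem run_eq_zero {k : ℕ} {l : List RGate} (hl : ∀ g ∈ l, g.Keeps k) {b : Bool}
    {ψ : (ℕ → Bool) → ℂ} (hψ : ∀ y, y k ≠ b → ψ y = 0) (y : ℕ → Bool) (hy : y k ≠ b) :
    run l ψ y = 0 := by
  induction l generalizing ψ with
  | nil => exact hψ y hy
  | cons g l ih =>
    exact ih (fun g hg => hl g (by simp [hg])) (act_eq_zero (hl g (by simp)) hψ)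

theorem toMatrix_eq_zero {n : ℕ} {C : Circuit n} {k : Fin n} (hC : ∀ g ∈ C.raw, g.Keeps k)
    (y x : Fin n → Bool) (h : y k ≠ x k) : C.toMatrix y x = 0 := by
  rw [toMatrix_eq_run]
  refine run_eq_zero (b := x k) hC (fun z hz => ?_) _ (by rwa [pad_val])
  rw [ket, if_neg]
  rintro rfl
  exact hz (pad_val x k)

/-- The overlap of the two branches is the single amplitude `⟨1x| C† X C |0x⟩` with `X` the flip of
qubit `0`, which is accessible to gate-by-gate computation. -/
theorem acceptProb_hadamardTest_run {m : ℕ} (C : Circuit (m + 1))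
    (hC : ∀ g ∈ C.raw, g.Keeps 0) :
    acceptProb (hadamardTest C) = 1 / 2 + (∑ x : Fin m → Bool, (run (inv C.raw)
      (fun y => run C.raw (ket (pad (Fin.cons false x : Fin (m + 1) → Bool)))
        (Function.update y 0 (!y 0))) (pad (Fin.cons true x : Fin (m + 1) → Bool))).re)
      / 2 ^ m / 2 := by
  have hC' : ∀ y x : Fin (m + 1) → Bool, y 0 ≠ x 0 → C.toMatrix y x = 0 :=
    fun y x h => toMatrix_eq_zero (k := 0) hC y x h
  rw [acceptProb_hadamardTest C hC']
  refine congrArg (fun s : ℝ => 1 / 2 + s / 2 ^ m / 2)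
    (Finset.sum_congr rfl fun x _ => ?_)
  congr 1
  have h := congrFun (restrict_run C.inv (fun _ => false) (fun y => run C.raw
    (ket (pad (Fin.cons false x : Fin (m + 1) → Bool))) (Function.update y 0 (!y 0))))
    (Fin.cons true x)
  rw [Circuit.raw_inv] at h
  refine Eq.trans ?_ h.symm
  have h0 : ∀ y : Fin (m + 1) → Bool, restrict (m + 1) (fun _ => false) (fun y => run C.raw
      (ket (pad (Fin.cons false x : Fin (m + 1) → Bool))) (Function.update y 0 (!y 0))) y =
      C.toMatrix (Function.update y 0 (!y 0)) (Fin.cons false x) := by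
    intro y
    have : pad y 0 = y 0 := pad_val y 0
    rw [toMatrix_eq_run]
    simp only [restrict, ← pad.eq_1, this]
    congr 1
    exact (extend_update Fin.val_injective y _ 0 _).symm
  rw [Matrix.mulVec, dotProduct, sum_cons]
  simp only [h0, Circuit.toMatrix_inv, Matrix.conjTranspose_apply, RCLike.star_def,
    Fin.update_cons_zero, Fin.cons_zero, Bool.not_true, Bool.not_false]
  rw [right_eq_add]
  refine Finset.sum_eq_zero fun y _ => ?_
  rw [hC' _ _ (by simp), map_zero, zero_mul]

/-! ## Gates for the controlled phases -/

/-- The sign of a bit. -/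
def sgn (b : Bool) : ℂ := if b = true then -1 else 1

theorem sgn_xor (a b : Bool) : sgn (xor a b) = sgn a * sgn b := by
  cases a <;> cases b <;> simp [sgn]

theorem sgn_mul_self (a : Bool) : sgn a * sgn a = 1 := by cases a <;> simp [sgn]

/-- The Pauli `Z` gate. -/
def zGate (q : ℕ) : List RGate := [.t q, .t q, .t q, .t q]

theorem run_zGate (q : ℕ) (ψ : (ℕ → Bool) → ℂ) (y : ℕ → Bool) :
    run (zGate q) ψ y = sgn (y q) * ψ y := by
  have := omega_pow_four
  simp only [zGate, run_cons, run_nil, act, sgn]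
  split_ifs
  · linear_combination (ψ y) * this
  · ring

/-- Propagate one rung of the ladder. -/
def ladderPre (j : ℕ) : List RGate :=
  [.cx (12 + 4 * j) (8 + 4 * j), .ccx (7 + 4 * j) (12 + 4 * j) (8 + 4 * j)]

/-- The second half of a rung, depending on its kind. -/
def ladderPost : ℕ → ℕ → List RGate
  | 0, j => ladderPre j
  | 1, j => ladderPre j ++ [.ccx 0 (7 + 4 * j) (8 + 4 * j)]
  | _, j => ladderPre j ++ [.ccx 0 (7 + 4 * j) (8 + 4 * j), .cx 0 (8 + 4 * j)]

/-- The circuit that adds the decision `ladderBit` to the qubits `8 + 4 * j`. -/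
def ladder : ℕ → List ℕ → List RGate
  | _, [] => []
  | j, κ :: ks => ladderPre j ++ (ladder (j + 1) ks ++ ladderPost κ j)

/-- The first `j` such that the bit `7 + 4 * j` is set decides. -/
def ladderBit : ℕ → List ℕ → (ℕ → Bool) → Bool
  | _, [], _ => false
  | j, κ :: ks, y => xor (y 0 && decide (2 ≤ κ))
      (if y (7 + 4 * j) = true then y 0 && decide (1 ≤ κ) else ladderBit (j + 1) ks y)

/-- The permutation of bit sequences performed by `ladder`. -/
def ladderMap : ℕ → List ℕ → (ℕ → Bool) → ℕ → Bool
  | _, [], y => y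
  | j, κ :: ks, y => Function.update (ladderMap (j + 1) ks y) (8 + 4 * j)
      (xor (y (8 + 4 * j)) (ladderBit j (κ :: ks) y))

theorem ladderBit_congr {y y' : ℕ → Bool} (h0 : y 0 = y' 0)
    (h : ∀ i, y (7 + 4 * i) = y' (7 + 4 * i)) (ks : List ℕ) (j : ℕ) :
    ladderBit j ks y = ladderBit j ks y' := by
  induction ks generalizing j with
  | nil => rfl
  | cons κ ks ih => rw [ladderBit, ladderBit, h0, h, ih]

theorem ladderBit_of_false {y : ℕ → Bool} (h0 : y 0 = false) (ks : List ℕ) (j : ℕ) :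
    ladderBit j ks y = false := by
  induction ks generalizing j with
  | nil => rfl
  | cons κ ks ih => rw [ladderBit, h0, ih]; simp

theorem ladderMap_of_ne {k : ℕ} (hk : ∀ i, k ≠ 8 + 4 * i) (ks : List ℕ) (j : ℕ) (y : ℕ → Bool) :
    ladderMap j ks y k = y k := by
  induction ks generalizing j with
  | nil => rfl
  | cons κ ks ih => rw [ladderMap, Function.update_of_ne (hk j), ih]

theorem ladderMap_self (j : ℕ) (ks : List ℕ) (y : ℕ → Bool) :
    ladderMap j ks y (8 + 4 * j) = xor (y (8 + 4 * j)) (ladderBit j ks y) := by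
  cases ks with
  | nil => simp [ladderMap, ladderBit]
  | cons κ ks => rw [ladderMap, Function.update_self]

theorem ladderBit_update (j i : ℕ) (ks : List ℕ) (y : ℕ → Bool) (b : Bool) :
    ladderBit j ks (Function.update y (8 + 4 * i) b) = ladderBit j ks y :=
  ladderBit_congr (Function.update_of_ne (by omega) _ _)
    (fun _ => Function.update_of_ne (by omega) _ _) _ _

theorem ladderMap_update {i j : ℕ} (h : i < j) (ks : List ℕ) (y : ℕ → Bool) (b : Bool) :
    ladderMap j ks (Function.update y (8 + 4 * i) b) =
      Function.update (ladderMap j ks y) (8 + 4 * i) b := by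
  induction ks generalizing j with
  | nil => rfl
  | cons κ ks ih =>
    rw [ladderMap, ladderMap, ih (by omega), ladderBit_update, Function.update_of_ne (by omega),
      Function.update_comm (by omega)]

theorem ladderBit_ladderMap (i j : ℕ) (ks ks' : List ℕ) (y : ℕ → Bool) :
    ladderBit i ks (ladderMap j ks' y) = ladderBit i ks y :=
  ladderBit_congr (ladderMap_of_ne (by omega) _ _ _) (fun _ => ladderMap_of_ne (by omega) _ _ _) _ _

/-- The decision depends only on qubits `0` and `7 + 4 * i`, which are never changed, so adding it
twice does nothing. -/
theorem ladderMap_ladderMap (j : ℕ) (ks : List ℕ) (y : ℕ → Bool) :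
    ladderMap j ks (ladderMap j ks y) = y := by
  induction ks generalizing j with
  | nil => rfl
  | cons κ ks ih =>
    rw [ladderMap, ladderBit_ladderMap, ladderMap_self, ladderMap, ladderMap_update (by omega), ih,
      Function.update_idem]
    simp

theorem run_ladderPre (j : ℕ) (ψ : (ℕ → Bool) → ℂ) (y : ℕ → Bool) :
    run (ladderPre j) ψ y = ψ (Function.update y (8 + 4 * j)
      (xor (y (8 + 4 * j)) (!y (7 + 4 * j) && y (12 + 4 * j)))) := by
  simp only [ladderPre, run_cons, run_nil, act]
  rw [Function.update_idem, Function.update_self, Function.update_of_ne (by omega)]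
  congr 2
  cases y (8 + 4 * j) <;> cases y (7 + 4 * j) <;> cases y (12 + 4 * j) <;> rfl

theorem run_ladderPost (κ j : ℕ) (ψ : (ℕ → Bool) → ℂ) (y : ℕ → Bool) :
    run (ladderPost κ j) ψ y = ψ (Function.update y (8 + 4 * j)
      (xor (xor (y (8 + 4 * j)) (!y (7 + 4 * j) && y (12 + 4 * j)))
        (xor (y 0 && decide (2 ≤ κ)) (y 0 && y (7 + 4 * j) && decide (1 ≤ κ))))) := by
  have h0 : 0 ≠ 8 + 4 * j := by omega
  have h7 : 7 + 4 * j ≠ 8 + 4 * j := by omega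
  have h12 : 12 + 4 * j ≠ 8 + 4 * j := by omega
  match κ with
  | 0 => simp [ladderPost, run_ladderPre]
  | 1 =>
    simp only [ladderPost, run_append, run_cons, run_nil, act, run_ladderPre, Function.update_idem,
      Function.update_self, Function.update_of_ne h7,
      Function.update_of_ne h12]
    congr 2
    cases y (8 + 4 * j) <;> cases y (7 + 4 * j) <;> cases y (12 + 4 * j) <;> cases y 0 <;> rfl
  | κ + 2 =>
    simp only [ladderPost, run_append, run_cons, run_nil, act, run_ladderPre, Function.update_idem,
      Function.update_self, Function.update_of_ne h0, Function.update_of_ne h7,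
      Function.update_of_ne h12]
    congr 2
    cases y (8 + 4 * j) <;> cases y (7 + 4 * j) <;> cases y (12 + 4 * j) <;> cases y 0 <;> simp

/-- A rung adds `¬y (7 + 4 * j) ∧ y (12 + 4 * j)` to its target both before and after the recursive
part toggles qubit `12 + 4 * j` by the decision of the remaining list. The unknown initial value of
that qubit cancels, so all targets may be maximally mixed. -/
theorem run_ladder (j : ℕ) (ks : List ℕ) (ψ : (ℕ → Bool) → ℂ) (y : ℕ → Bool) :
    run (ladder j ks) ψ y = ψ (ladderMap j ks y) := by
  induction ks generalizing j ψ y with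
  | nil => rfl
  | cons κ ks ih =>
    rw [ladder, run_append, run_append, run_ladderPost, ih, run_ladderPre,
      ladderMap_update (by omega), Function.update_idem, Function.update_self,
      Function.update_of_ne (by omega), Function.update_of_ne (by omega),
      ladderMap_of_ne (by omega), show 12 + 4 * j = 8 + 4 * (j + 1) by ring, ladderMap_self,
      ladderMap, ladderBit]
    congr 2
    cases y (8 + 4 * j) <;> cases y (7 + 4 * j) <;> cases y (8 + 4 * (j + 1)) <;> cases y 0 <;>
      cases ladderBit (j + 1) ks y <;> simp

/-- The phase `-1` to the power `ladderBit`. -/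
def shift (ks : List ℕ) : List RGate := ladder 0 ks ++ (zGate 8 ++ (ladder 0 ks ++ zGate 8))

/-- Qubit `8` contributes its sign once as it is and once toggled by the decision; the product no
longer depends on its value. -/
theorem run_shift (ks : List ℕ) (ψ : (ℕ → Bool) → ℂ) (y : ℕ → Bool) :
    run (shift ks) ψ y = sgn (ladderBit 0 ks y) * ψ y := by
  rw [shift, run_append, run_append, run_append, run_zGate, run_ladder, run_zGate, run_ladder,
    ladderMap_ladderMap]
  have := ladderMap_self 0 ks y
  rw [mul_zero, add_zero] at this
  rw [this, sgn_xor, ← mul_assoc, ← mul_assoc, sgn_mul_self, one_mul]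

/-! ## The classical part of the circuit -/

/-- Compare the first `a` qubits of the instance with zero. -/
def proj (a : ℕ) : List RGate := (List.range a).map fun i => .ccx 0 (5 + 4 * i) (6 + 4 * i)

/-- Flip qubit `4` if the qubits `0`, `7` and `11` are set. -/
def kill : List RGate := [.ccx 0 7 2, .ccx 2 11 4, .ccx 0 7 2, .ccx 2 11 4]

theorem run_proj (a : ℕ) (ψ : (ℕ → Bool) → ℂ) (y : ℕ → Bool) :
    run (proj a) ψ y = ψ fun k => if k % 4 = 2 ∧ 6 ≤ k ∧ k < 6 + 4 * a then
      xor (y k) (y 0 && y (k - 1)) else y k := by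
  induction a generalizing ψ y with
  | zero =>
    simp only [proj, List.range_zero, List.map_nil, run_nil]
    congr 1
    funext k
    rw [if_neg (by omega)]
  | succ a ih =>
    have : proj (a + 1) = proj a ++ [.ccx 0 (5 + 4 * a) (6 + 4 * a)] := by
      simp [proj, List.range_succ]
    rw [this, run_append]
    change run (proj a) ψ (Function.update y (6 + 4 * a) _) = _
    rw [ih]
    congr 1
    funext k
    by_cases hk : k = 6 + 4 * a
    · subst hk
      rw [if_neg (by omega), if_pos (by omega), Function.update_self,
        show 6 + 4 * a - 1 = 5 + 4 * a by omega]
    · rw [Function.update_of_ne hk, Function.update_of_ne (by omega)]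
      by_cases h : k % 4 = 2 ∧ 6 ≤ k ∧ k < 6 + 4 * a
      · rw [if_pos h, if_pos (by omega), Function.update_of_ne (by omega)]
      · rw [if_neg h, if_neg (by omega)]

/-- A triply controlled flip with the dirty scratch qubit `2`: performing both Toffoli gates twice
restores the scratch and cancels its initial value. -/
theorem run_kill (ψ : (ℕ → Bool) → ℂ) (y : ℕ → Bool) :
    run kill ψ y = ψ (Function.update y 4 (xor (y 4) (y 0 && y 7 && y 11))) := by
  simp only [kill, run_cons, run_nil, act]
  congr 1
  funext k
  by_cases h4 : k = 4
  · subst h4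
    simp
    cases y 4 <;> cases y 11 <;> cases y 0 <;> cases y 7 <;> cases y 2 <;> rfl
  · by_cases h2 : k = 2
    · subst h2
      simp
    · simp [h4, h2]

/-- The classical part of the circuit: phases for the two thresholds, and tests. -/
def tests (lo hi : List ℕ) (a : ℕ) : List RGate :=
  shift lo ++ ([.cx 0 11] ++ (shift hi ++ ([.cx 0 11] ++ (kill ++ proj a))))

/-- The permutation performed by `tests`. -/
def testsMap (a : ℕ) (y : ℕ → Bool) : ℕ → Bool := fun k =>
  if k = 4 then xor (y 4) (y 0 && y 7 && y 11)
  else if k % 4 = 2 ∧ 6 ≤ k ∧ k < 6 + 4 * a then xor (y k) (y 0 && y (k - 1)) else y k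

/-- The phase applied by `tests`. -/
def testsPhase (lo hi : List ℕ) (y : ℕ → Bool) : ℂ :=
  sgn (ladderBit 0 hi (Function.update y 11 (xor (y 11) (y 0)))) * sgn (ladderBit 0 lo y)

theorem testsMap_of_mod (a : ℕ) (y : ℕ → Bool) {k : ℕ} (h : k % 4 ≠ 2) (h' : k ≠ 4) :
    testsMap a y k = y k := by
  rw [testsMap, if_neg h', if_neg fun e => h e.1]

theorem testsMap_testsMap (a : ℕ) (y : ℕ → Bool) : testsMap a (testsMap a y) = y := by
  funext k
  rw [testsMap]
  split_ifs with h1 h2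
  · subst h1
    rw [testsMap_of_mod a y (k := 0) (by omega) (by omega),
      testsMap_of_mod a y (k := 7) (by omega) (by omega),
      testsMap_of_mod a y (k := 11) (by omega) (by omega), testsMap, if_pos rfl]
    simp
  · rw [testsMap_of_mod a y (k := 0) (by omega) (by omega),
      testsMap_of_mod a y (k := k - 1) (by omega) (by omega), testsMap, if_neg h1, if_pos h2]
    simp
  · rw [testsMap, if_neg h1, if_neg h2]

theorem testsPhase_testsMap (lo hi : List ℕ) (a : ℕ) (y : ℕ → Bool) :
    testsPhase lo hi (testsMap a y) = testsPhase lo hi y := by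
  have h : ∀ i, testsMap a y (7 + 4 * i) = y (7 + 4 * i) := fun i =>
    testsMap_of_mod a y (by omega) (by omega)
  have h0 : testsMap a y 0 = y 0 := testsMap_of_mod a y (by omega) (by omega)
  have h11 : testsMap a y 11 = y 11 := h 1
  rw [testsPhase, testsPhase, ladderBit_congr h0 h, ladderBit_congr (y' := Function.update y 11
    (xor (y 11) (y 0)))]
  · simp [h0]
  · intro i
    simp only [Function.update_apply, h, h0, h11]

theorem testsPhase_mul_self (lo hi : List ℕ) (y : ℕ → Bool) :
    testsPhase lo hi y * testsPhase lo hi y = 1 := by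
  rw [testsPhase, mul_mul_mul_comm, sgn_mul_self, sgn_mul_self, one_mul]

/-- In the branch where qubit `0` is set, the two `cx 0 11` negate bit `11` for the second threshold
only. For lists starting with two zeros, the two phases can then be active only at complementary
values of that bit. -/
theorem run_tests (lo hi : List ℕ) (a : ℕ) (ψ : (ℕ → Bool) → ℂ) (y : ℕ → Bool) :
    run (tests lo hi a) ψ y = testsPhase lo hi y * ψ (testsMap a y) := by
  have hm : Function.update (fun k => if k % 4 = 2 ∧ 6 ≤ k ∧ k < 6 + 4 * a then
      xor (y k) (y 0 && y (k - 1)) else y k) 4 (xor (y 4) (y 0 && y 7 && y 11)) = testsMap a y := by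
    funext k
    rw [Function.update_apply, testsMap]
  rw [tests, run_append, run_append, run_append, run_append, run_append, run_proj, run_kill]
  simp only [Nat.zero_mod, Nat.reduceMod, Nat.reduceEqDiff, false_and, if_false, hm]
  simp only [run_cons, run_nil, act, run_shift]
  rw [← testsPhase_testsMap _ _ a, testsPhase]
  simp [mul_assoc]

/-! ## Controlled circuits -/

/-- The circuit for a controlled gate. The control is qubit `3`; the complex conjugate gate is
performed if qubit `1` is set. -/
def ctrl : RGate → List RGate
  | .h q => [.t (5 + 4 * q), .t (5 + 4 * q), .h (5 + 4 * q), .t (5 + 4 * q), .cx 3 (5 + 4 * q),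
      .ti (5 + 4 * q), .h (5 + 4 * q), .ti (5 + 4 * q), .ti (5 + 4 * q)]
  | .t q => [.ccx 3 (5 + 4 * q) 1, .t 1, .ccx 3 (5 + 4 * q) 1, .ti 1]
  | .ti q => [.ccx 3 (5 + 4 * q) 1, .ti 1, .ccx 3 (5 + 4 * q) 1, .t 1]
  | .cx c r => [.ccx 3 (5 + 4 * c) (5 + 4 * r)]
  | .ccx c d r => [.ccx 3 (5 + 4 * c) 2, .ccx 2 (5 + 4 * d) (5 + 4 * r), .ccx 3 (5 + 4 * c) 2,
      .ccx 2 (5 + 4 * d) (5 + 4 * r)]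

/-- The positions of the qubits of the instance. -/
def slot (i : ℕ) : ℕ := 5 + 4 * i

theorem slot_injective : Function.Injective slot := fun i j h => by
  unfold slot at h; omega

/-- Fix all qubits outside the positions `slot i`. -/
def slice (z : ℕ → Bool) (ψ : (ℕ → Bool) → ℂ) : (ℕ → Bool) → ℂ :=
  fun v => ψ (Function.extend slot v z)

/-- The circuit that is performed by the controlled circuit. -/
def mode (z : ℕ → Bool) (l : List RGate) : List RGate :=
  if z 3 = true then (if z 1 = true then l.map RGate.conj else l) else []

theorem extend_slot (v z : ℕ → Bool) (i : ℕ) : Function.extend slot v z (5 + 4 * i) = v i :=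
  slot_injective.extend_apply v z i

theorem extend_of_mod (v z : ℕ → Bool) {k : ℕ} (h : k % 4 ≠ 1 ∨ k = 1) :
    Function.extend slot v z k = z k :=
  Function.extend_apply' _ _ _ fun ⟨i, hi⟩ => by unfold slot at hi; omega

theorem update_extend (v z : ℕ → Bool) (i : ℕ) (b : Bool) :
    Function.update (Function.extend slot v z) (5 + 4 * i) b =
      Function.extend slot (Function.update v i b) z :=
  (extend_update slot_injective v z i b).symm

theorem omega_add_conj : omega + starRingEnd ℂ omega = 2 * (Real.sqrt 2 : ℂ)⁻¹ := by
  have h : omega = (Real.sqrt 2 / 2 : ℝ) + (Real.sqrt 2 / 2 : ℝ) * Complex.I := by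
    rw [omega, show (Real.pi / 4 : ℂ) = ((Real.pi / 4 : ℝ) : ℂ) by push_cast; rfl,
      Complex.exp_mul_I, ← Complex.ofReal_cos, ← Complex.ofReal_sin, Real.cos_pi_div_four,
      Real.sin_pi_div_four]
  have h2 := sqrt_two_mul
  have h3 := sqrt_two_ne
  rw [h, map_add, map_mul, Complex.conj_ofReal, Complex.conj_I]
  push_cast
  field_simp
  linear_combination 2 * h2

/-- The Hadamard gate is conjugate to a bit flip by `H` and `T` gates, so only that flip is
controlled. For `T`, the scratch bit `1` is toggled by the product of control and target between a
`T` and a `T†`: this yields the desired phase if the bit was clear and its conjugate if it was set.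
The controlled Toffoli gate uses the dirty scratch bit `2` as in `kill`. -/
theorem slice_ctrl {M : ℕ} {g : RGate} (hg : g.Valid M) (z : ℕ → Bool) (ψ : (ℕ → Bool) → ℂ) :
    slice z (run (ctrl g) ψ) = run (mode z [g]) (slice z ψ) := by
  funext v
  have e1 : Function.extend slot v z 1 = z 1 := extend_of_mod v z (by omega)
  have e2 : Function.extend slot v z 2 = z 2 := extend_of_mod v z (by omega)
  have e3 : Function.extend slot v z 3 = z 3 := extend_of_mod v z (by omega)
  have f3 : ∀ v, Function.extend slot v z 3 = z 3 := fun v => extend_of_mod v z (by omega)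
  have hw := omega_mul_conj
  cases g with
  | h q =>
    have hp := omega_add_conj
    have hk : (Real.sqrt 2 : ℂ)⁻¹ * (Real.sqrt 2 : ℂ)⁻¹ * 2 = 1 := by
      rw [← mul_inv, sqrt_two_mul]; norm_num
    have hact : ∀ φ, (RGate.h q).act φ v = (φ (Function.update v q false) +
        (if v q = true then -1 else 1) * φ (Function.update v q true)) * (Real.sqrt 2 : ℂ)⁻¹ :=
      fun φ => div_eq_mul_inv _ _
    simp only [slice, ctrl, run_cons, run_nil, act, update_extend, extend_slot, f3,
      Function.update_self, Function.update_idem, div_eq_mul_inv]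
    -- With `ω`, its conjugate and `1/√2` abstracted, the claims are polynomial identities modulo
    -- the relations `hw`, `hp` and `hk`.
    generalize starRingEnd ℂ omega = W' at *
    generalize omega = W at *
    generalize (Real.sqrt 2 : ℂ)⁻¹ = k at *
    unfold mode
    rcases hz : z 3 <;> rcases hv : v q
    · simp only [Bool.false_eq_true, if_false, if_true, Bool.bne_false, run_nil, slice]
      have : Function.update v q false = v := by rw [← hv, Function.update_eq_self]
      rw [this]
      generalize ψ (Function.extend slot v z) = a
      generalize ψ (Function.extend slot (Function.update v q true) z) = b
      grind
    · simp only [Bool.false_eq_true, if_false, if_true, Bool.bne_false, run_nil, slice]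
      have : Function.update v q true = v := by rw [← hv, Function.update_eq_self]
      rw [this]
      generalize ψ (Function.extend slot v z) = a
      generalize ψ (Function.extend slot (Function.update v q false) z) = b
      grind
    · have : run (if z 1 = true then List.map RGate.conj [RGate.h q] else [RGate.h q]) =
          (RGate.h q).act := by split_ifs <;> rfl
      simp only [Bool.false_eq_true, if_false, if_true, Bool.xor_true, Bool.not_true,
        Bool.not_false, this, hact, slice, hv]
      generalize ψ (Function.extend slot (Function.update v q false) z) = a
      generalize ψ (Function.extend slot (Function.update v q true) z) = b
      grind
    · have : run (if z 1 = true then List.map RGate.conj [RGate.h q] else [RGate.h q]) =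
          (RGate.h q).act := by split_ifs <;> rfl
      simp only [Bool.false_eq_true, if_false, if_true, Bool.xor_true, Bool.not_true,
        Bool.not_false, this, hact, slice, hv]
      generalize ψ (Function.extend slot (Function.update v q false) z) = a
      generalize ψ (Function.extend slot (Function.update v q true) z) = b
      grind
  | t q =>
    simp only [slice, ctrl, run_cons, run_nil, act, Function.update_self, Function.update_idem]
    simp only [Function.update_of_ne (show 3 ≠ 1 by omega), e1, e3,
      Function.update_of_ne (show 5 + 4 * q ≠ 1 by omega), extend_slot, Bool.xor_assoc,
      Bool.xor_self, Bool.xor_false]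
    rw [← e1, Function.update_eq_self, e1]
    have hw' := conj_omega_mul
    unfold mode
    cases z 3 <;> cases z 1 <;> cases hv : v q <;>
      simp [hv, run_cons, act, slice, RGate.conj, ← mul_assoc, hw']
  | ti q =>
    simp only [slice, ctrl, run_cons, run_nil, act, Function.update_self, Function.update_idem]
    simp only [Function.update_of_ne (show 3 ≠ 1 by omega), e1, e3,
      Function.update_of_ne (show 5 + 4 * q ≠ 1 by omega), extend_slot, Bool.xor_assoc,
      Bool.xor_self, Bool.xor_false]
    rw [← e1, Function.update_eq_self, e1]
    have hw' := conj_omega_mul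
    unfold mode
    cases z 3 <;> cases z 1 <;> cases hv : v q <;>
      simp [hv, run_cons, act, slice, RGate.conj, ← mul_assoc, hw]
  | cx c r =>
    have : run (if z 1 = true then List.map RGate.conj [RGate.cx c r] else [RGate.cx c r]) =
        (RGate.cx c r).act := by split_ifs <;> rfl
    simp only [slice, ctrl, run_cons, run_nil, act, e3, extend_slot, update_extend, mode]
    cases z 3
    · simp [slice]
    · simp only [if_true, this, act, slice, Bool.true_and]
  | ccx c d r =>
    obtain ⟨-, -, -, h1, h2, h3⟩ := hg
    have : run (if z 1 = true then List.map RGate.conj [RGate.ccx c d r] else [RGate.ccx c d r]) =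
        (RGate.ccx c d r).act := by split_ifs <;> rfl
    simp only [slice, ctrl, run_cons, run_nil, act]
    have key : ∀ y : ℕ → Bool, ψ (Function.update (Function.update (Function.update
        (Function.update y (5 + 4 * r) (y (5 + 4 * r) ^^ (y 2 && y (5 + 4 * d)))) 2
        (y 2 ^^ (y 3 && y (5 + 4 * c)))) (5 + 4 * r) (y (5 + 4 * r) ^^ (y 3 && y (5 + 4 * c) &&
          y (5 + 4 * d)))) 2 (y 2)) = ψ (Function.update y (5 + 4 * r) (y (5 + 4 * r) ^^
          (y 3 && y (5 + 4 * c) && y (5 + 4 * d)))) := by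
      intro y
      congr 1
      funext k
      have n : 5 + 4 * r ≠ 2 := by omega
      by_cases k2 : k = 2
      · subst k2; simp [n.symm]
      · by_cases kr : k = 5 + 4 * r
        · subst kr; simp [n]
        · simp [k2, kr]
    have key' := key (Function.extend slot v z)
    rw [extend_slot, extend_slot, extend_slot, e2, e3, update_extend] at key'
    simp only [Function.update_self, Function.update_of_ne (show 5 + 4 * r ≠ 2 by omega),
      Function.update_of_ne (show 5 + 4 * d ≠ 2 by omega),
      Function.update_of_ne (show 5 + 4 * c ≠ 2 by omega),
      Function.update_of_ne (show 3 ≠ 2 by omega), e2, e3,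
      Function.update_of_ne (show 5 + 4 * c ≠ 5 + 4 * r by omega),
      Function.update_of_ne (show 5 + 4 * d ≠ 5 + 4 * r by omega),
      Function.update_of_ne (show 3 ≠ 5 + 4 * r by omega),
      Function.update_of_ne (show 2 ≠ 5 + 4 * r by omega), extend_slot]
    refine Eq.trans ?_ (key'.trans ?_)
    · rw [update_extend]
      congr 2
      · congr 1
        cases v r <;> cases v c <;> cases v d <;> cases z 2 <;> cases z 3 <;> rfl
      · cases v c <;> cases z 2 <;> cases z 3 <;> rfl
    · rw [update_extend, mode]
      cases z 3
      · simp [slice]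
      · simp only [if_true, this, act, slice, Bool.true_and]

theorem mode_cons (z : ℕ → Bool) (g : RGate) (l : List RGate) :
    mode z (g :: l) = mode z [g] ++ mode z l := by
  unfold mode; split_ifs <;> rfl

/-- The controlled circuit. -/
def controlled (l : List RGate) : List RGate := l.flatMap ctrl

theorem slice_controlled {M : ℕ} {l : List RGate} (hl : ∀ g ∈ l, g.Valid M) (z : ℕ → Bool)
    (ψ : (ℕ → Bool) → ℂ) :
    slice z (run (controlled l) ψ) = run (mode z l) (slice z ψ) := by
  induction l generalizing ψ with
  | nil => simp [controlled, mode]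
  | cons g l ih =>
    have : controlled (g :: l) = ctrl g ++ controlled l := rfl
    rw [this, run_append, ih (fun g hg => hl g (by simp [hg])), slice_ctrl (hl g (by simp)),
      mode_cons z g l, run_append]

/-! ## The circuit for trace estimation -/

/-- Toggle the control qubit if the qubits `0` and `7` are set. -/
def flag : List RGate := [.ccx 0 7 3]

/-- The circuit between the Hadamard gates: thresholds, tests and controlled circuit. -/
def core (lo hi : List ℕ) (a : ℕ) (l : List RGate) : List RGate :=
  tests lo hi a ++ (flag ++ (controlled l ++ flag))

/-- The permutation performed by `flag`. -/
def flagMap (y : ℕ → Bool) : ℕ → Bool := Function.update y 3 (xor (y 3) (y 0 && y 7))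

theorem run_flag (ψ : (ℕ → Bool) → ℂ) (y : ℕ → Bool) : run flag ψ y = ψ (flagMap y) := rfl

theorem flagMap_flagMap (y : ℕ → Bool) : flagMap (flagMap y) = y := by
  simp [flagMap]

theorem flagMap_of_false {y : ℕ → Bool} (h : y 0 = false) : flagMap y = y := by
  simp [flagMap, h]

theorem flagMap_extend (v z : ℕ → Bool) :
    flagMap (Function.extend slot v z) = Function.extend slot v (flagMap z) := by
  funext k
  by_cases hk : ∃ i, slot i = k
  · obtain ⟨i, rfl⟩ := hk
    rw [slot_injective.extend_apply, flagMap, Function.update_of_ne (by unfold slot; omega),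
      slot_injective.extend_apply]
  · rw [Function.extend_apply' _ _ _ hk, flagMap, flagMap, extend_of_mod v z (by omega),
      extend_of_mod v z (by omega), extend_of_mod v z (by omega)]
    simp only [Function.update_apply]
    rw [Function.extend_apply' _ _ _ hk]

theorem testsMap_of_false (a : ℕ) {y : ℕ → Bool} (h : y 0 = false) : testsMap a y = y := by
  funext k
  rw [testsMap, h]
  split_ifs with h1
  · simp [h1]
  · simp
  · rfl

theorem testsPhase_of_false (lo hi : List ℕ) {y : ℕ → Bool} (h : y 0 = false) :
    testsPhase lo hi y = 1 := by
  rw [testsPhase, ladderBit_of_false h, ladderBit_of_false (by simp [h])]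
  simp [sgn]

theorem run_zero (l : List RGate) : run l (fun _ => 0) = fun _ => 0 := by
  induction l with
  | nil => rfl
  | cons g l ih =>
    have : g.act (fun _ => 0) = fun _ => 0 := by cases g <;> simp [act]
    rw [run_cons, this, ih]

theorem run_inv_ket {M : ℕ} {l : List RGate} (hl : ∀ g ∈ l, g.Valid M) (v : ℕ → Bool) :
    run (inv l) (ket v) v = starRingEnd ℂ (run l (ket v) v) := by
  obtain ⟨C, rfl⟩ := exists_circuit hl
  have hv : v = Function.extend Fin.val (fun i : Fin M => v i) v := by
    funext k
    by_cases hk : ∃ i : Fin M, (i : ℕ) = k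
    · obtain ⟨i, rfl⟩ := hk
      rw [Fin.val_injective.extend_apply]
    · rw [Function.extend_apply' _ _ _ hk]
  rw [← Circuit.raw_inv]
  conv_lhs => rw [hv]
  conv_rhs => rw [hv]
  rw [run_extend, run_extend, Circuit.toMatrix_inv]
  rfl

theorem run_map_conj_ket (l : List RGate) (v : ℕ → Bool) :
    run (l.map RGate.conj) (ket v) v = starRingEnd ℂ (run l (ket v) v) := by
  rw [run_map_conj]
  have : (fun x => starRingEnd ℂ (ket v x)) = ket v := by
    funext x
    rw [ket]
    split_ifs <;> simp
  rw [this]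

theorem extend_slot_self (z : ℕ → Bool) : Function.extend slot (fun i => z (slot i)) z = z := by
  funext k
  by_cases hk : ∃ i, slot i = k
  · obtain ⟨i, rfl⟩ := hk
    rw [slot_injective.extend_apply]
  · rw [Function.extend_apply' _ _ _ hk]

theorem run_tests_run_tests (lo hi : List ℕ) (a : ℕ) (ψ : (ℕ → Bool) → ℂ) :
    run (tests lo hi a) (run (tests lo hi a) ψ) = ψ := by
  funext y
  rw [run_tests, run_tests, testsPhase_testsMap, testsMap_testsMap, ← mul_assoc,
    testsPhase_mul_self, one_mul]

theorem valid_mode {M : ℕ} {l : List RGate} (hl : ∀ g ∈ l, g.Valid M) (z : ℕ → Bool) :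
    ∀ g ∈ mode z l, g.Valid M := by
  intro g hg
  unfold mode at hg
  split_ifs at hg
  · obtain ⟨g', hg', rfl⟩ := List.mem_map.1 hg
    exact (hl g' hg').conj
  · exact hl g hg
  · simp at hg

-- In the branch with qubit `0` clear, tests and flag do nothing, and the controlled circuit runs in
-- the mode given by `x`. In the other branch the tests contribute a phase and a permutation. The
-- controlled circuit moves only the qubits `slot i`, so if the permutation moved any other qubit,
-- the two branches are orthogonal.
open Classical in
theorem run_core_overlap {M N : ℕ} {lo hi : List ℕ} {a : ℕ} {l : List RGate}
    (hC : ∀ g ∈ core lo hi a l, g.Valid M) (hl : ∀ g ∈ l, g.Valid N) (x : ℕ → Bool)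
    (hx : x 0 = false) :
    run (inv (core lo hi a l)) (fun y => run (core lo hi a l) (ket x)
      (Function.update y 0 (!y 0))) (Function.update x 0 true) =
    if testsMap a (Function.update x 0 true) = Function.update x 0 true then
      testsPhase lo hi (Function.update x 0 true) *
        run (inv (mode (flagMap (Function.update x 0 true)) l)) (run (mode x l)
          (ket fun i => x (slot i))) fun i => x (slot i)
    else 0 := by
  set x1 := Function.update x 0 true with hx1
  set p := testsMap a x1 with hp
  set q := flagMap p with hq
  set r := Function.update p 0 false with hr
  have hp0 : p 0 = true := by rw [hp, testsMap_of_mod a x1 (by omega) (by omega), hx1]; simp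
  have hq0 : q 0 = true := by rw [hq, flagMap, Function.update_of_ne (by omega), hp0]
  have hr0 : r 0 = false := by simp [hr]
  -- The tests are an involution, hence their own inverse as an operator, although not as a list of
  -- gates.
  have hS : ∀ ψ, run (inv (tests lo hi a)) ψ = run (tests lo hi a) ψ := by
    intro ψ
    conv_lhs => rw [← run_tests_run_tests lo hi a ψ]
    exact run_inv_run (M := M) (fun g hg => hC g (by simp [core, hg])) _
  have hW : ∀ ψ, slice q (run (inv (controlled l)) ψ) = run (inv (mode q l)) (slice q ψ) := by
    intro ψ
    have h1 : ∀ g ∈ controlled l, g.Valid M := fun g hg => hC g (by simp [core, hg])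
    conv_rhs => rw [← run_run_inv h1 ψ, slice_controlled hl]
    rw [run_inv_run (valid_mode hl q)]
  -- After qubit `0` is flipped, the branch that starts from `x` is seen on the slots with the
  -- background `r`, where qubit `0` is clear.
  have hinner : slice q (run flag (fun y => run (core lo hi a l) (ket x)
      (Function.update y 0 (!y 0)))) =
      run (mode r l) (fun v => ket x (Function.extend slot v r)) := by
    funext v
    have e0 : Function.extend slot v p 0 = p 0 := extend_of_mod v p (by omega)
    have er : ∀ v, Function.extend slot v r 0 = false := fun v => by
      rw [extend_of_mod v r (by omega), hr0]
    have e1 : Function.update (Function.extend slot v p) 0 false = Function.extend slot v r := by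
      funext k
      by_cases hk : ∃ i, slot i = k
      · obtain ⟨i, rfl⟩ := hk
        rw [slot_injective.extend_apply, Function.update_of_ne (by unfold slot; omega),
          slot_injective.extend_apply]
      · rw [Function.extend_apply' _ _ _ hk, hr]
        simp only [Function.update_apply]
        rw [Function.extend_apply' _ _ _ hk]
    rw [slice, run_flag, flagMap_extend, hq, flagMap_flagMap, e0, hp0, Bool.not_true, e1, core,
      run_append, run_append, run_append, run_flag, flagMap_of_false (er v)]
    have := congrFun (slice_controlled hl r (run flag (run (tests lo hi a) (ket x)))) v
    rw [slice] at this
    rw [this]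
    congr 1
    funext v
    rw [slice, run_flag, flagMap_of_false (er v), run_tests, testsPhase_of_false _ _ (er v),
      testsMap_of_false _ (er v), one_mul]
  have hT : run (inv (core lo hi a l)) (fun y => run (core lo hi a l) (ket x)
      (Function.update y 0 (!y 0))) x1 = testsPhase lo hi x1 *
        run (inv (mode q l)) (run (mode r l) (fun v => ket x (Function.extend slot v r)))
          (fun i => q (slot i)) := by
    have hinv : inv (core lo hi a l) =
        flag ++ (inv (controlled l) ++ (flag ++ inv (tests lo hi a))) := by
      rw [core, inv_append, inv_append, inv_append, List.append_assoc, List.append_assoc]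
      rfl
    rw [hinv, run_append, run_append, run_append, hS, run_tests, run_flag, ← hinner, ← hW, slice,
      extend_slot_self]
  rw [hT]
  split_ifs with h
  · have hrx : r = x := by
      rw [hr, h, hx1, Function.update_idem, ← hx, Function.update_eq_self]
    have hqs : (fun i => q (slot i)) = fun i => x (slot i) := by
      funext i
      rw [hq, h, flagMap, hx1, Function.update_of_ne (by unfold slot; omega),
        Function.update_of_ne (by unfold slot; omega)]
    have hk : (fun v => ket x (Function.extend slot v x)) = ket fun i => x (slot i) := by
      funext v
      have : Function.extend slot v x = x ↔ v = fun i => x (slot i) := by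
        constructor
        · intro h
          funext i
          rw [← h, slot_injective.extend_apply]
        · rintro rfl
          exact extend_slot_self x
      simp only [ket, this]
    rw [hrx, hqs, hk, hq, h]
  -- The tests never change a slot, so `p ≠ x1` means a difference in the background; no content of
  -- the slots can repair it.
  · have : (fun v => ket x (Function.extend slot v r)) = fun _ => 0 := by
      funext v
      rw [ket, if_neg]
      intro h'
      refine h (funext fun k => ?_)
      by_cases hk : ∃ i, slot i = k
      · obtain ⟨i, rfl⟩ := hk
        exact testsMap_of_mod a x1 (by unfold slot; omega) (by unfold slot; omega)
      · have := congrFun h' k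
        rw [Function.extend_apply' _ _ _ hk, hr] at this
        by_cases h0 : k = 0
        · subst h0
          rw [hp0, hx1, Function.update_self]
        · rw [Function.update_of_ne h0] at this
          rw [this, hx1, Function.update_of_ne h0]
    rw [this, run_zero, run_zero, mul_zero]

-- If bit `7` is set, the flag toggles the control qubit `3` in one branch, so exactly one branch
-- performs the circuit. Whether this leaves the circuit, its inverse or its conjugate, the diagonal
-- entry has the same real part, and the leading zeros of the lists make the phase trivial. If bit
-- `7` is clear, both branches perform the same circuit and only the phase survives.
open Classical in
theorem run_core_overlap_re {M N : ℕ} {lo hi : List ℕ} {a : ℕ} {l : List RGate}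
    (hC : ∀ g ∈ core (0 :: lo) (0 :: hi) a l, g.Valid M) (hl : ∀ g ∈ l, g.Valid N) (x : ℕ → Bool)
    (hx : x 0 = false) :
    (run (inv (core (0 :: lo) (0 :: hi) a l)) (fun y => run (core (0 :: lo) (0 :: hi) a l) (ket x)
      (Function.update y 0 (!y 0))) (Function.update x 0 true)).re =
    if testsMap a (Function.update x 0 true) = Function.update x 0 true then
      (if x 7 = true then (run l (ket fun i => x (slot i)) fun i => x (slot i)).re
        else (testsPhase (0 :: lo) (0 :: hi) (Function.update x 0 true)).re)
    else 0 := by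
  rw [run_core_overlap hC hl x hx]
  split_ifs with h h7
  · set v := fun i => x (slot i)
    have hph : testsPhase (0 :: lo) (0 :: hi) (Function.update x 0 true) = 1 := by
      have h7' : ∀ y : ℕ → Bool, y 7 = true → ∀ ks, ladderBit 0 (0 :: ks) y = false := by
        intro y hy ks
        simp [ladderBit, hy]
      rw [testsPhase, h7' _ (by simp [h7]), h7' _ (by simp [h7])]
      simp [sgn]
    have h3 : flagMap (Function.update x 0 true) 3 = !x 3 := by simp [flagMap, h7]
    have h1 : flagMap (Function.update x 0 true) 1 = x 1 := by simp [flagMap]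
    rw [hph, one_mul]
    unfold mode
    rw [h3, h1]
    cases x 3
    · simp only [Bool.not_false, if_true, Bool.false_eq_true, if_false, run_nil]
      split_ifs
      · rw [run_inv_ket (M := N) (l := l.map RGate.conj), run_map_conj_ket, Complex.conj_conj]
        intro g hg
        obtain ⟨g', hg', rfl⟩ := List.mem_map.1 hg
        exact (hl g' hg').conj
      · rw [run_inv_ket hl, Complex.conj_re]
    · simp only [Bool.not_true, if_true, Bool.false_eq_true, if_false, inv, List.map_nil,
        List.reverse_nil, run_nil]
      split_ifs
      · rw [run_map_conj_ket, Complex.conj_re]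
      · rfl
  · have hm : mode (flagMap (Function.update x 0 true)) l = mode x l := by
      unfold mode
      rw [show flagMap (Function.update x 0 true) 3 = x 3 by
        simp [flagMap, Bool.eq_false_iff.2 h7],
        show flagMap (Function.update x 0 true) 1 = x 1 by simp [flagMap]]
    rw [hm, run_inv_run (valid_mode hl x)]
    simp [ket]
  · simp

theorem testsMap_eq_iff (a : ℕ) {y : ℕ → Bool} (h : y 0 = true) :
    testsMap a y = y ↔ (y 7 && y 11) = false ∧ ∀ i < a, y (5 + 4 * i) = false := by
  constructor
  · intro e
    constructor
    · have := congrFun e 4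
      rw [testsMap, if_pos rfl, h] at this
      revert this
      cases y 4 <;> cases y 7 <;> cases y 11 <;> simp
    · intro i hi
      have := congrFun e (6 + 4 * i)
      rw [testsMap, if_neg (by omega), if_pos (by omega), h,
        show 6 + 4 * i - 1 = 5 + 4 * i by omega] at this
      revert this
      cases y (5 + 4 * i) <;> cases y (6 + 4 * i) <;> simp
  · rintro ⟨h1, h2⟩
    funext k
    rw [testsMap, h, Bool.true_and, Bool.true_and, h1]
    split_ifs with e e'
    · simp [e]
    · rw [show k - 1 = 5 + 4 * ((k - 6) / 4) by omega, h2 _ (by omega)]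
      simp
    · rfl

/-! ## Validity -/

theorem keeps_core (lo hi : List ℕ) (a : ℕ) (l : List RGate) :
    ∀ g ∈ core lo hi a l, g.Keeps 0 := by
  have hpre : ∀ j, ∀ g ∈ ladderPre j, g.Keeps 0 := by
    intro j g hg
    simp only [ladderPre, List.mem_cons, List.not_mem_nil, or_false] at hg
    rcases hg with rfl | rfl <;> simp [Keeps]
  have hpost : ∀ κ j, ∀ g ∈ ladderPost κ j, g.Keeps 0 := by
    intro κ j g hg
    unfold ladderPost at hg
    split at hg
    · exact hpre j g hg
    all_goals
      rcases List.mem_append.1 hg with hg | hg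
      · exact hpre j g hg
      · simp only [List.mem_cons, List.not_mem_nil, or_false] at hg
        rcases hg with rfl | rfl <;> simp [Keeps]
  have hlad : ∀ (ks : List ℕ) j, ∀ g ∈ ladder j ks, g.Keeps 0 := by
    intro ks
    induction ks with
    | nil => intro j g hg; simp [ladder] at hg
    | cons κ ks ih =>
      intro j g hg
      rw [ladder, List.mem_append, List.mem_append] at hg
      rcases hg with hg | hg | hg
      exacts [hpre j g hg, ih _ g hg, hpost κ j g hg]
  have hshift : ∀ (ks : List ℕ), ∀ g ∈ shift ks, g.Keeps 0 := by
    intro ks g hg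
    simp only [shift, zGate, List.mem_append, List.mem_cons, List.not_mem_nil, or_false] at hg
    rcases hg with hg | (rfl | rfl | rfl | rfl) | hg | (rfl | rfl | rfl | rfl)
    all_goals first | exact hlad ks 0 g hg | trivial
  intro g hg
  simp only [core, tests, flag, controlled, List.mem_append, List.mem_flatMap] at hg
  rcases hg with (hg | hg | hg | hg | hg | hg) | hg | ⟨g', hg', hg⟩ | hg
  · exact hshift lo g hg
  · obtain rfl := List.mem_singleton.1 hg; simp [Keeps]
  · exact hshift hi g hg
  · obtain rfl := List.mem_singleton.1 hg; simp [Keeps]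
  · simp only [kill, List.mem_cons, List.not_mem_nil, or_false] at hg
    rcases hg with rfl | rfl | rfl | rfl <;> simp [Keeps]
  · obtain ⟨i, -, rfl⟩ := List.mem_map.1 hg
    simp [Keeps]
  · obtain rfl := List.mem_singleton.1 hg; simp [Keeps]
  · cases g' <;> simp only [ctrl, List.mem_cons, List.not_mem_nil, or_false] at hg <;>
      rcases hg with rfl | rfl | rfl | rfl | rfl | rfl | rfl | rfl | rfl <;> simp [Keeps]
  · obtain rfl := List.mem_singleton.1 hg; simp [Keeps]

theorem valid_core {M N : ℕ} {lo hi : List ℕ} {a : ℕ} {l : List RGate}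
    (hlo : 8 + 4 * lo.length < M) (hhi : 8 + 4 * hi.length < M) (ha : 6 + 4 * a ≤ M)
    (hN : 5 + 4 * N ≤ M) (hM : 11 < M) (hl : ∀ g ∈ l, g.Valid N) :
    ∀ g ∈ core lo hi a l, g.Valid M := by
  have hpre : ∀ j, 12 + 4 * j < M → ∀ g ∈ ladderPre j, g.Valid M := by
    intro j hj g hg
    simp only [ladderPre, List.mem_cons, List.not_mem_nil, or_false] at hg
    rcases hg with rfl | rfl <;> simp only [Valid] <;> omega
  have hpost : ∀ κ j, 12 + 4 * j < M → ∀ g ∈ ladderPost κ j, g.Valid M := by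
    intro κ j hj g hg
    unfold ladderPost at hg
    split at hg
    · exact hpre j hj g hg
    all_goals
      rcases List.mem_append.1 hg with hg | hg
      · exact hpre j hj g hg
      · simp only [List.mem_cons, List.not_mem_nil, or_false] at hg
        rcases hg with rfl | rfl <;> simp only [Valid] <;> omega
  have hlad : ∀ (ks : List ℕ) j, 8 + 4 * (j + ks.length) < M → ∀ g ∈ ladder j ks, g.Valid M := by
    intro ks
    induction ks with
    | nil => intro j hj g hg; simp [ladder] at hg
    | cons κ ks ih =>
      intro j hj g hg
      rw [List.length_cons] at hj
      rw [ladder, List.mem_append, List.mem_append] at hg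
      rcases hg with hg | hg | hg
      exacts [hpre j (by omega) g hg, ih _ (by omega) g hg, hpost κ j (by omega) g hg]
  have hshift : ∀ (ks : List ℕ), 8 + 4 * ks.length < M → ∀ g ∈ shift ks, g.Valid M := by
    intro ks hks g hg
    simp only [shift, zGate, List.mem_append, List.mem_cons, List.not_mem_nil, or_false] at hg
    rcases hg with hg | (rfl | rfl | rfl | rfl) | hg | (rfl | rfl | rfl | rfl)
    all_goals first | exact hlad ks 0 (by omega) g hg | (simp only [Valid]; omega)
  intro g hg
  simp only [core, tests, flag, controlled, List.mem_append, List.mem_flatMap] at hg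
  rcases hg with (hg | hg | hg | hg | hg | hg) | hg | ⟨g', hg', hg⟩ | hg
  · exact hshift lo hlo g hg
  · obtain rfl := List.mem_singleton.1 hg; simp only [Valid]; omega
  · exact hshift hi hhi g hg
  · obtain rfl := List.mem_singleton.1 hg; simp only [Valid]; omega
  · simp only [kill, List.mem_cons, List.not_mem_nil, or_false] at hg
    rcases hg with rfl | rfl | rfl | rfl <;> simp only [Valid] <;> omega
  · obtain ⟨i, hi, rfl⟩ := List.mem_map.1 hg
    have := List.mem_range.1 hi
    simp only [Valid]; omega
  · obtain rfl := List.mem_singleton.1 hg; simp only [Valid]; omega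
  · have hv := hl g' hg'
    cases g' <;> simp only [ctrl, List.mem_cons, List.not_mem_nil, or_false] at hg <;>
      rcases hg with rfl | rfl | rfl | rfl | rfl | rfl | rfl | rfl | rfl <;>
      simp only [Valid] at hv ⊢ <;> omega
  · obtain rfl := List.mem_singleton.1 hg; simp only [Valid]; omega

/-! ## Averages over bit vectors -/

/-- The bits outside the range of `f` are free; they multiply the sum and the number of bit vectors
by the same power of two. In this way idle qubits disappear from normalized traces. -/
theorem sum_comp_injective {α β : Type} [Fintype α] [Fintype β] [DecidableEq α] [DecidableEq β]
    {f : α → β} (hf : Function.Injective f) (F : (α → Bool) → ℝ) :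
    (∑ x : β → Bool, F (fun i => x (f i))) / 2 ^ Fintype.card β =
      (∑ y : α → Bool, F y) / 2 ^ Fintype.card α := by
  classical
  let e : α ⊕ ↥(Set.range f)ᶜ ≃ β :=
    ((Equiv.ofInjective f hf).sumCongr (Equiv.refl _)).trans (Equiv.Set.sumCompl (Set.range f))
  have he : ∀ a, e (Sum.inl a) = f a := fun a => rfl
  have h1 : ∑ x : β → Bool, F (fun i => x (f i)) =
      ∑ y : α ⊕ ↥(Set.range f)ᶜ → Bool, F (fun i => y (Sum.inl i)) := by
    rw [← (e.arrowCongr (Equiv.refl Bool)).sum_comp]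
    refine Finset.sum_congr rfl fun y _ => congrArg F (funext fun i => ?_)
    simp [Equiv.arrowCongr, ← he]
  rw [h1, ← (Equiv.sumArrowEquivProdArrow α _ Bool).symm.sum_comp, Fintype.sum_prod_type]
  simp only [Equiv.sumArrowEquivProdArrow_symm_apply_inl, Finset.sum_const, Finset.card_univ,
    Fintype.card_fun, Fintype.card_bool, nsmul_eq_mul, ← Finset.mul_sum]
  rw [← Fintype.card_congr e, Fintype.card_sum, pow_add]
  push_cast
  field_simp

/-! ### Binary expansions as averages of random signs -/

/-- The decision of a list of kinds: the first set bit decides. -/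
def decideFirst : List ℕ → (ℕ → Bool) → Bool
  | [], _ => false
  | κ :: ks, z => xor (decide (2 ≤ κ)) (if z 0 = true then decide (1 ≤ κ)
      else decideFirst ks fun i => z (i + 1))

theorem ladderBit_eq (j : ℕ) (ks : List ℕ) {y : ℕ → Bool} (h : y 0 = true) :
    ladderBit j ks y = decideFirst ks fun i => y (7 + 4 * (j + i)) := by
  induction ks generalizing j with
  | nil => rfl
  | cons κ ks ih =>
    rw [ladderBit, decideFirst, h, ih]
    simp only [Bool.true_and, add_zero, show ∀ i, j + 1 + i = j + (i + 1) from fun i => by omega]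

theorem decideFirst_congr {ks : List ℕ} {z z' : ℕ → Bool} (h : ∀ i < ks.length, z i = z' i) :
    decideFirst ks z = decideFirst ks z' := by
  induction ks generalizing z z' with
  | nil => rfl
  | cons κ ks ih =>
    rw [decideFirst, decideFirst, h 0 (by simp), ih (z' := fun i => z' (i + 1))]
    intro i hi
    exact h (i + 1) (by simpa using hi)

/-- The sign of a bit as a real number. -/
def rsgn (b : Bool) : ℝ := if b = true then -1 else 1

theorem rsgn_true : rsgn true = -1 := if_pos rfl

theorem rsgn_false : rsgn false = 1 := if_neg Bool.false_ne_true

theorem sgn_eq (b : Bool) : sgn b = (rsgn b : ℂ) := by cases b <;> simp [sgn, rsgn]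

/-- The average sign of the decision of a list of kinds. -/
def kindsValue : List ℕ → ℝ
  | [] => 1
  | 0 :: ks => (1 + kindsValue ks) / 2
  | 1 :: ks => (-1 + kindsValue ks) / 2
  | _ :: ks => (1 - kindsValue ks) / 2

theorem pad_cons_zero {m : ℕ} (b : Bool) (x : Fin m → Bool) :
    pad (Fin.cons b x : Fin (m + 1) → Bool) 0 = b := pad_val (Fin.cons b x : Fin (m + 1) → Bool) 0

theorem pad_cons_succ {m : ℕ} (b : Bool) (x : Fin m → Bool) (i : ℕ) :
    pad (Fin.cons b x : Fin (m + 1) → Bool) (i + 1) = pad x i := by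
  by_cases h : i < m
  · rw [pad_of_lt _ (show i + 1 < m + 1 by omega), pad_of_lt _ h]
    exact Fin.cons_succ (α := fun _ => Bool) b x ⟨i, h⟩
  · rw [pad, pad, Function.extend_apply' _ _ _ (fun ⟨j, hj⟩ => by omega),
      Function.extend_apply' _ _ _ (fun ⟨j, hj⟩ => by omega)]

/-- Condition on the first bit: with probability `1/2` the decision is made at once, otherwise it is
left to the rest of the list, negated for kind `2`. Bits beyond the list are irrelevant. -/
theorem sum_rsgn_decideFirst (ks : List ℕ) {K : ℕ} (h : ks.length ≤ K) :
    (∑ z : Fin K → Bool, rsgn (decideFirst ks (pad z))) / 2 ^ K = kindsValue ks := by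
  induction ks generalizing K with
  | nil => simp [decideFirst, rsgn, kindsValue]
  | cons κ ks ih =>
    obtain ⟨K, rfl⟩ : ∃ K', K = K' + 1 := ⟨K - 1, by simp at h; omega⟩
    have := ih (K := K) (by simpa using h)
    rw [sum_cons]
    simp only [decideFirst, pad_cons_zero, pad_cons_succ, Bool.false_eq_true, if_false, if_true]
    have h2 : (2 : ℝ) ^ K ≠ 0 := by positivity
    rw [div_eq_iff h2] at this
    match κ with
    | 0 =>
      simp [this, rsgn_false, kindsValue]
      field_simp
      ring
    | 1 =>
      simp [this, rsgn_true, kindsValue]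
      field_simp
      ring
    | κ + 2 =>
      have hn : ∀ b, rsgn (!b) = - rsgn b := by intro b; cases b <;> simp [rsgn]
      simp [this, hn, kindsValue]
      simp [rsgn]
      field_simp
      ring

/-- The kinds for a signed binary expansion. -/
def BinaryFraction.kinds (r : BinaryFraction) : List ℕ :=
  (r.neg.toNat + 1) :: r.digits.map Bool.toNat

/-- For `v = 1 - d`, a digit `0` gives `(1 + v)/2 = 1 - d/2` and a digit `1` gives `(-1 + v)/2 = 1 -
(1 + d/2)`. -/
theorem kindsValue_digits (l : List Bool) : kindsValue (l.map Bool.toNat) = 1 - digitsValue l := by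
  induction l with
  | nil => simp [kindsValue, digitsValue]
  | cons b l ih =>
    cases b
    · simp only [List.map_cons, Bool.toNat_false, kindsValue, ih, digitsValue, Bool.false_eq_true,
        if_false]
      ring
    · simp only [List.map_cons, Bool.toNat_true, kindsValue, ih, digitsValue, if_true]
      ring

/-- The first kind removes the offset `1` and carries the sign: kind `1` gives `(-1 + (1 - d))/2 =
-d/2`, kind `2` gives `(1 - (1 - d))/2 = d/2`. -/
theorem kindsValue_kinds (r : BinaryFraction) : kindsValue r.kinds = -r.value / 2 := by
  rw [BinaryFraction.kinds, BinaryFraction.value]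
  cases r.neg
  · simp only [Bool.toNat_false, zero_add, kindsValue, kindsValue_digits, Bool.false_eq_true,
      if_false]
    ring
  · simp only [Bool.toNat_true, Nat.reduceAdd, kindsValue, kindsValue_digits, if_true]
    ring

theorem sum_append {a n : ℕ} (f : (Fin (a + n) → Bool) → ℝ) :
    (∑ v : Fin (a + n) → Bool, if ∀ i : Fin a, v (Fin.castAdd n i) = false then f v else 0) =
      ∑ w : Fin n → Bool, f (Fin.append (fun _ => false) w) := by
  rw [← (Fin.appendEquiv a n).sum_comp, Fintype.sum_prod_type]
  rw [Finset.sum_eq_single (fun _ => false)]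
  · refine Finset.sum_congr rfl fun w _ => ?_
    rw [if_pos fun i => by simp [Fin.appendEquiv]]
    rfl
  · intro u _ hu
    refine Finset.sum_eq_zero fun w _ => if_neg fun h => hu (funext fun i => ?_)
    simpa [Fin.appendEquiv] using h i
  · simp

/-! ## The acceptance probability -/

/-- The four values of bits `7` and `11` contribute the trace, nothing, `-lo/2` and `-hi/2`, each
with weight `1/4`. Demanding zero ancillas costs `2^(-a)`, and the Hadamard test costs another
factor `1/2`. -/
theorem exists_traceCircuit {a n m K : ℕ} (U : Circuit (a + n)) (lo hi : BinaryFraction)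
    (hlo : lo.kinds.length ≤ K) (hhi : hi.kinds.length ≤ K) (hK : 16 + 4 * K ≤ m)
    (hN : 5 + 4 * (a + n) ≤ m) :
    ∃ Q : Circuit (m + 1), Q.raw = .h 0 :: (core (0 :: 0 :: lo.kinds) (0 :: 0 :: hi.kinds) a U.raw ++
        (zGate 0 ++ [.h 0])) ∧
      acceptProb Q = 1 / 2 + ((topLeftBlock a U.toMatrix).trace.re / 2 ^ n -
        (lo.value + hi.value) / 2) / (8 * 2 ^ a) := by
  have hvalid : ∀ g ∈ core (0 :: 0 :: lo.kinds) (0 :: 0 :: hi.kinds) a U.raw, g.Valid (m + 1) :=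
    valid_core (N := a + n) (by simp; omega) (by simp; omega) (by omega) (by omega) (by omega)
      U.raw_valid
  obtain ⟨C, hC⟩ := exists_circuit hvalid
  refine ⟨hadamardTest C, by
    rw [← hC]; simp [hadamardTest, Circuit.raw, Gate.raw, zGate], ?_⟩
  rw [acceptProb_hadamardTest_run C (by rw [hC]; exact keeps_core _ _ _ _), hC]
  -- The relevant random bits are qubits `7 + 4 * j` and `5 + 4 * i`; among the mixed qubits the
  -- numbering is lower by one, because qubit `0` is the clean one.
  let f : Fin (K + 2) ⊕ Fin (a + n) → Fin m :=
    Sum.elim (fun j => ⟨6 + 4 * j, by omega⟩) (fun i => ⟨4 + 4 * i, by omega⟩)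
  have hf : Function.Injective f := by
    rintro (i | i) (j | j) h <;> simp [f, Fin.ext_iff] at h ⊢ <;> omega
  let u : (Fin (a + n) → Bool) → ℝ := fun v => (U.toMatrix v v).re
  let P : (Fin (a + n) → Bool) → Prop := fun v => ∀ i : Fin a, v (Fin.castAdd n i) = false
  let G : (Fin (K + 2) → Bool) → (Fin (a + n) → Bool) → ℝ := fun z v =>
    if P v then
      (if z 0 = true then (if z 1 = true then 0 else u v)
        else (if z 1 = true then rsgn (decideFirst hi.kinds fun i => pad z (i + 2))
          else rsgn (decideFirst lo.kinds fun i => pad z (i + 2))))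
    else 0
  have hx : ∀ x : Fin m → Bool, (run (inv (core (0 :: 0 :: lo.kinds) (0 :: 0 :: hi.kinds) a U.raw))
      (fun y => run (core (0 :: 0 :: lo.kinds) (0 :: 0 :: hi.kinds) a U.raw)
        (ket (pad (Fin.cons false x : Fin (m + 1) → Bool))) (Function.update y 0 (!y 0)))
      (pad (Fin.cons true x : Fin (m + 1) → Bool))).re =
      G (fun j => x (f (Sum.inl j))) fun i => x (f (Sum.inr i)) := by
    intro x
    set X := pad (Fin.cons false x : Fin (m + 1) → Bool) with hX
    have hX1 : pad (Fin.cons true x : Fin (m + 1) → Bool) = Function.update X 0 true := by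
      funext k
      cases k with
      | zero => rw [pad_cons_zero, Function.update_self]
      | succ k => rw [pad_cons_succ, Function.update_of_ne (by omega), hX, pad_cons_succ]
    have hX0 : X 0 = false := pad_cons_zero _ _
    have hXz : ∀ j : Fin (K + 2), X (7 + 4 * j) = x (f (Sum.inl j)) := fun j => by
      rw [hX, show 7 + 4 * (j : ℕ) = 6 + 4 * j + 1 by omega, pad_cons_succ, pad_of_lt]
      rfl
    have hXv : ∀ i : Fin (a + n), X (5 + 4 * i) = x (f (Sum.inr i)) := fun j => by
      rw [hX, show 5 + 4 * (j : ℕ) = 4 + 4 * j + 1 by omega, pad_cons_succ, pad_of_lt]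
      rfl
    have h7 : X 7 = x (f (Sum.inl 0)) := hXz 0
    have h11 : X 11 = x (f (Sum.inl 1)) := hXz 1
    rw [hX1, run_core_overlap_re hvalid U.raw_valid X hX0]
    simp only [G]
    have hcond : testsMap a (Function.update X 0 true) = Function.update X 0 true ↔
        (x (f (Sum.inl 0)) && x (f (Sum.inl 1))) = false ∧ P fun i => x (f (Sum.inr i)) := by
      rw [testsMap_eq_iff a (by simp), Function.update_of_ne (by omega),
        Function.update_of_ne (by omega), h7, h11]
      refine and_congr_right fun _ => ⟨fun h i => ?_, fun h i hi => ?_⟩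
      · have := h i i.2
        rw [Function.update_of_ne (by omega)] at this
        exact (hXv (Fin.castAdd n i)).symm.trans this
      · rw [Function.update_of_ne (by omega)]
        exact (hXv (Fin.castAdd n ⟨i, hi⟩)).trans (h ⟨i, hi⟩)
    have hu : (run U.raw (ket fun i => X (slot i)) fun i => X (slot i)).re =
        u fun i => x (f (Sum.inr i)) := by
      have : (fun i => X (slot i)) =
          Function.extend Fin.val (fun i => x (f (Sum.inr i))) fun i => X (slot i) := by
        funext k
        by_cases hk : ∃ i : Fin (a + n), (i : ℕ) = k
        · obtain ⟨i, rfl⟩ := hk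
          rw [Fin.val_injective.extend_apply, ← hXv]
          rfl
        · rw [Function.extend_apply' _ _ _ hk]
      rw [this, run_extend]
    have hdec : ∀ ks : List ℕ, ks.length ≤ K → ∀ b,
        ladderBit 2 ks (Function.update (Function.update X 0 true) 11 b) =
        decideFirst ks fun i => pad (fun j => x (f (Sum.inl j))) (i + 2) := by
      intro ks hks b
      rw [ladderBit_eq _ _ (by simp)]
      refine decideFirst_congr fun i hi => ?_
      rw [Function.update_of_ne (by omega), Function.update_of_ne (by omega),
        pad_of_lt _ (show i + 2 < K + 2 by omega), ← hXz, Nat.add_comm 2 i]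
    have hph : X 7 = false → (testsPhase (0 :: 0 :: lo.kinds) (0 :: 0 :: hi.kinds)
        (Function.update X 0 true)).re = if X 11 = true then
          rsgn (decideFirst hi.kinds fun i => pad (fun j => x (f (Sum.inl j))) (i + 2))
          else rsgn (decideFirst lo.kinds fun i => pad (fun j => x (f (Sum.inl j))) (i + 2)) := by
      intro h
      have hl0 : ladderBit 2 lo.kinds (Function.update X 0 true) =
          decideFirst lo.kinds fun i => pad (fun j => x (f (Sum.inl j))) (i + 2) := by
        rw [← hdec lo.kinds hlo (Function.update X 0 true 11), Function.update_eq_self]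
      rw [testsPhase, sgn_eq, sgn_eq, ← Complex.ofReal_mul, Complex.ofReal_re]
      simp only [ladderBit, mul_zero, add_zero, mul_one, zero_add, Nat.reduceAdd, hdec hi.kinds hhi,
        hl0]
      cases h11' : X 11 <;> simp [h, h11', rsgn]
    by_cases hP : P fun i => x (f (Sum.inr i))
    · rw [if_pos hP]
      simp only [← h7, ← h11]
      cases h7' : X 7
      · rw [if_pos (hcond.2 ⟨by rw [← h7, h7']; rfl, hP⟩), hph h7']
        simp
      · cases h11' : X 11
        · rw [if_pos (hcond.2 ⟨by rw [← h7, ← h11, h7', h11']; rfl, hP⟩), hu]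
          simp
        · rw [if_neg fun h => by
            have := (hcond.1 h).1
            rw [← h7, ← h11, h7', h11'] at this
            simp at this]
          simp
    · rw [if_neg hP, if_neg fun h => hP (hcond.1 h).2]
  simp only [hx]
  have havg := sum_comp_injective hf fun y => G (fun j => y (Sum.inl j)) fun i => y (Sum.inr i)
  rw [Fintype.card_fin, Fintype.card_sum, Fintype.card_fin, Fintype.card_fin] at havg
  rw [havg, ← (Equiv.sumArrowEquivProdArrow _ _ Bool).symm.sum_comp, Fintype.sum_prod_type]
  simp only [Equiv.sumArrowEquivProdArrow_symm_apply_inl,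
    Equiv.sumArrowEquivProdArrow_symm_apply_inr]
  have hPsum : ∀ g : (Fin (a + n) → Bool) → ℝ, (∑ v, if P v then g v else 0) =
      ∑ w : Fin n → Bool, g (Fin.append (fun _ => false) w) := sum_append
  simp only [G, hPsum]
  have hp2 : ∀ (b b' : Bool) (z : Fin K → Bool) (i : ℕ),
      pad (Fin.cons b (Fin.cons b' z : Fin (K + 1) → Bool) : Fin (K + 2) → Bool) (i + 2) =
        pad z i := fun b b' z i => by
    rw [show i + 2 = (i + 1) + 1 from rfl, pad_cons_succ, pad_cons_succ]
  have h1 : ∀ (b b' : Bool) (z : Fin K → Bool),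
      (Fin.cons b (Fin.cons b' z : Fin (K + 1) → Bool) : Fin (K + 2) → Bool) 1 = b' :=
    fun b b' z => rfl
  simp only [sum_cons, hp2, h1, Fin.cons_zero, Bool.false_eq_true, if_false, if_true,
    Finset.sum_const, Finset.card_univ, Fintype.card_fun, Fintype.card_bool, Fintype.card_fin,
    nsmul_eq_mul, ← Finset.mul_sum, mul_zero, add_zero]
  have e1 := sum_rsgn_decideFirst lo.kinds hlo
  have e2 := sum_rsgn_decideFirst hi.kinds hhi
  have h2 : (2 : ℝ) ^ K ≠ 0 := by positivity
  rw [kindsValue_kinds, div_eq_iff h2] at e1 e2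
  rw [e1, e2]
  have ht : ∑ w : Fin n → Bool, u (Fin.append (fun _ => false) w) =
      (topLeftBlock a U.toMatrix).trace.re := by
    simp [u, Matrix.trace, topLeftBlock]
  rw [ht]
  push_cast
  rw [pow_add, pow_add, pow_add]
  field_simp
  ring

/-! ## Writing down the circuit for trace estimation -/

theorem PolyTime.congr_right {X Y Z : Type} {ex : X → List Bool} {ey : Y → List Bool}
    {ez : Z → List Bool} {f : X → Y} {g : X → Z} (hf : PolyTime ex ey f)
    (h : ∀ x, ez (g x) = ey (f x)) : PolyTime ex ez g := by
  obtain ⟨c⟩ := hf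
  exact ⟨⟨c.toTM2ComputableAux, c.time, fun x => (h x).symm ▸ c.outputsFun x⟩⟩

/-- The code of a sequence of gates. -/
def codes (l : List RGate) : List ℕ := l.flatMap RGate.code

theorem codes_append (l l' : List RGate) : codes (l ++ l') = codes l ++ codes l' :=
  List.flatMap_append

theorem codes_cons (g : RGate) (l : List RGate) : codes (g :: l) = g.code ++ codes l := rfl

theorem codes_nil : codes [] = [] := rfl

/-- The rule for `ladderPre`. -/
def preRule : Rule := ⟨0, [(0, 0, 3), (0, 4, 12), (0, 4, 8), (0, 0, 4), (0, 4, 7), (0, 4, 12),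
  (0, 4, 8)]⟩

/-- The rules for the reverse of `ladderPost`. -/
def postRule : ℕ → Rule
  | 0 => ⟨0, [(0, 4, 8), (0, 4, 12), (0, 4, 7), (0, 0, 4), (0, 4, 8), (0, 4, 12), (0, 0, 3)]⟩
  | 1 => ⟨0, [(0, 4, 8), (0, 4, 7), (0, 0, 0), (0, 0, 4), (0, 4, 8), (0, 4, 12), (0, 4, 7),
      (0, 0, 4), (0, 4, 8), (0, 4, 12), (0, 0, 3)]⟩
  | _ => ⟨0, [(0, 4, 8), (0, 0, 0), (0, 0, 3), (0, 4, 8), (0, 4, 7), (0, 0, 0), (0, 0, 4),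
      (0, 4, 8), (0, 4, 12), (0, 4, 7), (0, 0, 4), (0, 4, 8), (0, 4, 12), (0, 0, 3)]⟩

theorem preRule_eval (j : ℕ) (l : List ℕ) : preRule.eval j l = codes (ladderPre j) := by
  simp [preRule, Rule.eval, codes, ladderPre, RGate.code, add_comm]

theorem postRule_eval (κ j : ℕ) (l : List ℕ) :
    (postRule κ).eval j l = (codes (ladderPost κ j)).reverse := by
  match κ with
  | 0 => simp [postRule, Rule.eval, codes, ladderPre, ladderPost, RGate.code, add_comm]
  | 1 => simp [postRule, Rule.eval, codes, ladderPre, ladderPost, RGate.code, add_comm]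
  | κ + 2 => simp [postRule, Rule.eval, codes, ladderPre, ladderPost, RGate.code, add_comm]

theorem getD_postRule (κ : ℕ) : [postRule 0, postRule 1].getD κ (postRule 2) = postRule κ := by
  match κ with
  | 0 => rfl
  | 1 => rfl
  | κ + 2 => rfl

/-- The rungs are nested: first halves occur in increasing order, second halves in decreasing order.
Two passes suffice, the second being reversed, which is why `postRule` emits the codes backwards. -/
theorem codes_ladder (j : ℕ) (ks : List ℕ) : codes (ladder j ks) = transduce [] preRule j ks ++
    (transduce [postRule 0, postRule 1] (postRule 2) j ks).reverse := by
  induction ks generalizing j with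
  | nil => simp [ladder, transduce, codes]
  | cons κ ks ih =>
    have h0 : (postRule κ).arity = 0 := by unfold postRule; split <;> rfl
    have h1 : ([] : List Rule).getD κ preRule = preRule := by simp
    rw [ladder, codes_append, codes_append, ih, transduce, transduce, getD_postRule, h0, h1,
      preRule_eval, postRule_eval, List.drop_zero, List.reverse_append, List.reverse_reverse]
    simp [preRule]

theorem polyTime_codes_ladder : PolyTime bits bits (fun ks => codes (ladder 0 ks)) := by
  refine ((polyTime_transduce [] preRule (by simp [preRule])).bits_append
    (polyTime_transduce_reverse [postRule 0, postRule 1] (postRule 2)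
      (by simp [postRule]))).congr_right fun ks => ?_
  rw [codes_ladder]

theorem polyTime_codes_shift : PolyTime bits bits (fun ks => codes (shift ks)) := by
  refine (polyTime_codes_ladder.bits_append ((polyTime_const (codes (zGate 8))).bits_append
    (polyTime_codes_ladder.bits_append (polyTime_const (codes (zGate 8)))))).congr_right
    fun ks => ?_
  rw [shift, codes_append, codes_append, codes_append]

/-- The rule for `proj`. -/
def projRule : Rule := ⟨0, [(0, 0, 4), (0, 0, 0), (0, 4, 5), (0, 4, 6)]⟩

theorem transduce_projRule (a j : ℕ) : transduce [] projRule j (List.replicate a 0) =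
    codes ((List.range' j a).map fun i => .ccx 0 (5 + 4 * i) (6 + 4 * i)) := by
  induction a generalizing j with
  | zero => simp [transduce, codes]
  | succ a ih =>
    rw [List.replicate_succ, transduce, List.range'_succ, List.map_cons, codes_cons, ← ih]
    simp [projRule, Rule.eval, RGate.code, add_comm]

theorem polyTime_codes_proj : PolyTime bits bits (fun l => codes (proj (l.headD 0))) := by
  refine ((polyTime_transduce [] projRule (by simp [projRule])).comp
    polyTime_replicate).congr_right fun l => ?_
  rw [transduce_projRule, proj, List.range_eq_range']

/-- The rules for controlled gates. -/
def ctrlRule : ℕ → Rule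
  | 0 => ⟨1, [(0, 0, 1), (1, 4, 5), (0, 0, 1), (1, 4, 5), (0, 0, 0), (1, 4, 5), (0, 0, 1),
      (1, 4, 5), (0, 0, 3), (0, 0, 3), (1, 4, 5), (0, 0, 2), (1, 4, 5), (0, 0, 0), (1, 4, 5),
      (0, 0, 2), (1, 4, 5), (0, 0, 2), (1, 4, 5)]⟩
  | 1 => ⟨1, [(0, 0, 4), (0, 0, 3), (1, 4, 5), (0, 0, 1), (0, 0, 1), (0, 0, 1), (0, 0, 4),
      (0, 0, 3), (1, 4, 5), (0, 0, 1), (0, 0, 2), (0, 0, 1)]⟩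
  | 2 => ⟨1, [(0, 0, 4), (0, 0, 3), (1, 4, 5), (0, 0, 1), (0, 0, 2), (0, 0, 1), (0, 0, 4),
      (0, 0, 3), (1, 4, 5), (0, 0, 1), (0, 0, 1), (0, 0, 1)]⟩
  | 3 => ⟨2, [(0, 0, 4), (0, 0, 3), (1, 4, 5), (2, 4, 5)]⟩
  | _ => ⟨3, [(0, 0, 4), (0, 0, 3), (1, 4, 5), (0, 0, 2), (0, 0, 4), (0, 0, 2), (2, 4, 5),
      (3, 4, 5), (0, 0, 4), (0, 0, 3), (1, 4, 5), (0, 0, 2), (0, 0, 4), (0, 0, 2), (2, 4, 5),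
      (3, 4, 5)]⟩

/-- The type of a gate is the token and its qubits are the arguments; the affine map `q ↦ 4 * q + 5`
sends each of them to its slot. -/
theorem transduce_ctrlRule (j : ℕ) (l : List RGate) :
    transduce [ctrlRule 0, ctrlRule 1, ctrlRule 2, ctrlRule 3] (ctrlRule 4) j (codes l) =
      codes (controlled l) := by
  induction l generalizing j with
  | nil => simp [transduce, codes, controlled]
  | cons g l ih =>
    have h : controlled (g :: l) = ctrl g ++ controlled l := rfl
    rw [h, codes_append, codes_cons, ← ih (j + 1)]
    cases g <;> simp [RGate.code, transduce, Rule.eval, ctrlRule, codes, ctrl, add_comm]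

theorem polyTime_codes_controlled :
    ∃ F : List ℕ → List ℕ, PolyTime bits bits F ∧ ∀ l, F (codes l) = codes (controlled l) :=
  ⟨_, polyTime_transduce [ctrlRule 0, ctrlRule 1, ctrlRule 2, ctrlRule 3] (ctrlRule 4)
    (by simp [ctrlRule]), transduce_ctrlRule 0⟩

/-- Skip a signed binary expansion. -/
def skipFraction (l : List ℕ) : List ℕ := (l.dropWhile (· < 2)).tail

/-- Read the kinds of a signed binary expansion. -/
def readKinds (l : List ℕ) : List ℕ :=
  [0, 0] ++ ([1 * l.headD 0 + 1] ++ l.tail.takeWhile (· < 2))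

theorem skipFraction_code (r : BinaryFraction) (l : List ℕ) :
    skipFraction (r.code ++ l) = l := by
  have : ∀ ds : List Bool, (ds.map Bool.toNat ++ 2 :: l).dropWhile (· < 2) = 2 :: l := by
    intro ds
    induction ds with
    | nil => simp
    | cons b ds ih => rw [List.map_cons, List.cons_append, List.dropWhile_cons, ih]; cases b <;> rfl
  rw [skipFraction, BinaryFraction.code, List.cons_append, List.append_assoc, List.singleton_append,
    List.dropWhile_cons, this]
  cases r.neg <;> rfl

theorem readKinds_code (r : BinaryFraction) (l : List ℕ) :
    readKinds (r.code ++ l) = 0 :: 0 :: r.kinds := by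
  have : ∀ ds : List Bool, (ds.map Bool.toNat ++ 2 :: l).takeWhile (· < 2) =
      ds.map Bool.toNat := by
    intro ds
    induction ds with
    | nil => simp
    | cons b ds ih => rw [List.map_cons, List.cons_append, List.takeWhile_cons, ih]; cases b <;> rfl
  have h : r.code ++ l = r.neg.toNat :: (r.digits.map Bool.toNat ++ 2 :: l) := by
    simp [BinaryFraction.code]
  rw [readKinds, h, List.tail_cons, this, BinaryFraction.kinds, List.headD_cons, one_mul]
  rfl

theorem polyTime_readKinds : PolyTime bits bits readKinds :=
  (polyTime_const [0, 0]).bits_append ((polyTime_affine 1 1).bits_append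
    (polyTime_takeWhile.comp polyTime_tail))

theorem polyTime_skipFraction : PolyTime bits bits skipFraction := polyTime_dropWhile_tail

theorem exists_polyTime_traceCircuit : ∃ G : List ℕ → List ℕ, PolyTime bits bits G ∧
    ∀ (n a : ℕ) (lo hi : BinaryFraction) (l : List RGate),
      G (n :: a :: (lo.code ++ hi.code ++ codes l)) =
        codes (.h 0 :: (core (0 :: 0 :: lo.kinds) (0 :: 0 :: hi.kinds) a l ++
          (zGate 0 ++ [.h 0]))) := by
  obtain ⟨F, hF, hF'⟩ := polyTime_codes_controlled
  -- `t1`, `t2`, `t3` and `t4` expose the input after `n`, after `a`, after `lo` and after `hi`,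
  -- respectively.
  have t1 := polyTime_tail
  have t2 := t1.comp t1
  have t3 := polyTime_skipFraction.comp t2
  have t4 := polyTime_skipFraction.comp t3
  refine ⟨_, (polyTime_const (codes [.h 0])).bits_append
    ((polyTime_codes_shift.comp (polyTime_readKinds.comp t2)).bits_append
    ((polyTime_const (codes [.cx 0 11])).bits_append
    ((polyTime_codes_shift.comp (polyTime_readKinds.comp t3)).bits_append
    ((polyTime_const (codes ([.cx 0 11] ++ kill))).bits_append
    ((polyTime_codes_proj.comp t1).bits_append
    ((polyTime_const (codes flag)).bits_append
    ((hF.comp t4).bits_append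
    (polyTime_const (codes (flag ++ (zGate 0 ++ [.h 0]))))))))))), fun n a lo hi l => ?_⟩
  simp only [List.tail_cons, List.append_assoc, readKinds_code, skipFraction_code, hF',
    List.headD_cons, core, tests, codes_append, codes_cons, codes_nil, List.append_nil]

/-! ## Membership in DQC1 -/

theorem exists_eval_le (p : Polynomial ℕ) : ∃ c d : ℕ, ∀ k : ℕ, p.eval k ≤ c * (k + 1) ^ d := by
  induction p using Polynomial.induction_on' with
  | add p q hp hq =>
    obtain ⟨c, d, h⟩ := hp
    obtain ⟨c', d', h'⟩ := hq
    refine ⟨c + c', d + d', fun k => ?_⟩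
    rw [Polynomial.eval_add, add_mul]
    refine add_le_add ((h k).trans ?_) ((h' k).trans ?_) <;>
      exact Nat.mul_le_mul_left _ (Nat.pow_le_pow_right (by omega) (by omega))
  | monomial n a =>
    refine ⟨a, n, fun k => ?_⟩
    rw [Polynomial.eval_monomial]
    exact Nat.mul_le_mul_left _ (Nat.pow_le_pow_left (by omega) _)

/-- For large `n`, `2^(K log n)` is at most `(n + 1)^⌈|K|⌉`, since `log 2 ≤ 1`; the finitely many
other values go into the constant. This is where the logarithmic number of ancillas matters: the gap
of the test shrinks by `2^a`. -/
theorem exists_two_pow_le {anc : ℕ → ℕ}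
    (hlog : (fun n => (anc n : ℝ)) =O[atTop] (fun n : ℕ => Real.log n)) :
    ∃ C d : ℕ, ∀ n, 2 ^ anc n ≤ C * (n + 1) ^ d := by
  obtain ⟨K, hK⟩ := hlog.bound
  obtain ⟨N, hN⟩ := eventually_atTop.1 hK
  refine ⟨∑ i ∈ Finset.range N, 2 ^ anc i + 1, ⌈|K|⌉₊, fun n => ?_⟩
  rcases lt_or_ge n N with h | h
  · calc 2 ^ anc n ≤ ∑ i ∈ Finset.range N, 2 ^ anc i :=
          Finset.single_le_sum (f := fun i => 2 ^ anc i) (fun _ _ => Nat.zero_le _)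
            (Finset.mem_range.2 h)
      _ ≤ (∑ i ∈ Finset.range N, 2 ^ anc i + 1) * 1 := by omega
      _ ≤ _ := Nat.mul_le_mul_left _ (Nat.one_le_pow _ _ (by omega))
  · have h1 := hN n h
    have h2 : (2 : ℝ) ^ anc n ≤ ((n + 1 : ℕ) : ℝ) ^ ⌈|K|⌉₊ := by
      have hlog0 : 0 ≤ Real.log ((n + 1 : ℕ) : ℝ) := Real.log_natCast_nonneg _
      have h3 : Real.log n ≤ Real.log ((n + 1 : ℕ) : ℝ) := by
        rcases Nat.eq_zero_or_pos n with rfl | hn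
        · simp
        · exact Real.log_le_log (by exact_mod_cast hn) (by push_cast; linarith)
      rw [Real.norm_of_nonneg (Nat.cast_nonneg _), Real.norm_of_nonneg (Real.log_natCast_nonneg _)]
        at h1
      have h4 : (anc n : ℝ) ≤ ⌈|K|⌉₊ * Real.log ((n + 1 : ℕ) : ℝ) := by
        calc (anc n : ℝ) ≤ K * Real.log n := h1
          _ ≤ |K| * Real.log n :=
            mul_le_mul_of_nonneg_right (le_abs_self K) (Real.log_natCast_nonneg _)
          _ ≤ ⌈|K|⌉₊ * Real.log ((n + 1 : ℕ) : ℝ) :=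
            mul_le_mul (Nat.le_ceil _) h3 (Real.log_natCast_nonneg _) (Nat.cast_nonneg _)
      have h5 : Real.log 2 ≤ 1 := by linarith [Real.log_two_lt_d9]
      have h6 : Real.log ((2 : ℝ) ^ anc n) ≤ Real.log (((n + 1 : ℕ) : ℝ) ^ ⌈|K|⌉₊) := by
        rw [Real.log_pow, Real.log_pow]
        refine le_trans ?_ h4
        nlinarith [Nat.cast_nonneg (α := ℝ) (anc n)]
      exact (Real.log_le_log_iff (by positivity) (by positivity)).1 h6
    have h3 : 2 ^ anc n ≤ (n + 1) ^ ⌈|K|⌉₊ := by exact_mod_cast h2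
    exact h3.trans (Nat.le_mul_of_pos_left _ (by omega))

/-- Each diagonal entry is `⟨v, A v⟩` for a unit vector `v`, hence bounded by the operator norm, and
so is the average of these entries. -/
theorem abs_trace_le {n : ℕ} (A : QOp n) :
    |A.trace.re| / 2 ^ n ≤ ‖Matrix.toEuclideanCLM (𝕜 := ℂ) A‖ := by
  have h : ∀ x : Fin n → Bool, |(A x x).re| ≤ ‖Matrix.toEuclideanCLM (𝕜 := ℂ) A‖ := by
    intro x
    set v : EuclideanSpace ℂ (Fin n → Bool) := EuclideanSpace.single x 1
    have hv : ‖v‖ = 1 := by simp [v]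
    have h1 : inner ℂ v (Matrix.toEuclideanCLM (𝕜 := ℂ) A v) = A x x := by
      rw [EuclideanSpace.inner_single_left]
      have : (Matrix.toEuclideanCLM (𝕜 := ℂ) A v).ofLp = A.mulVec v.ofLp :=
        Matrix.ofLp_toEuclideanCLM A v
      rw [this]
      simp [v]
    calc |(A x x).re| ≤ ‖A x x‖ := Complex.abs_re_le_norm _
      _ ≤ ‖v‖ * ‖Matrix.toEuclideanCLM (𝕜 := ℂ) A v‖ := h1 ▸ norm_inner_le_norm _ _
      _ ≤ ‖v‖ * (‖Matrix.toEuclideanCLM (𝕜 := ℂ) A‖ * ‖v‖) := by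
        gcongr
        exact ContinuousLinearMap.le_opNorm _ _
      _ = _ := by rw [hv]; ring
  rw [div_le_iff₀ (by positivity), Matrix.trace, Complex.re_sum]
  refine (Finset.abs_sum_le_sum_abs _ _).trans ((Finset.sum_le_sum fun x _ => h x).trans ?_)
  simp [mul_comm]

/-! ### Thresholds for the acceptance probability -/

/-- The threshold `1 / 2`. -/
def lowThreshold (_ : ℕ) : BinaryFraction := ⟨false, [false, true]⟩

/-- The threshold `1 / 2 + 1 / 2 ^ e` for a number `e` that grows logarithmically. -/
def highThreshold (c d : ℕ) (k : ℕ) : BinaryFraction :=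
  ⟨false, [false, true] ++ (List.replicate c false ++
    (List.replicate (d * halvings k) false ++ [true]))⟩

theorem lowThreshold_value (k : ℕ) : (lowThreshold k).value = 1 / 2 := by
  simp [lowThreshold, BinaryFraction.value, digitsValue]

theorem digitsValue_replicate (c : ℕ) (l : List Bool) :
    digitsValue (List.replicate c false ++ l) = digitsValue l / 2 ^ c := by
  induction c with
  | zero => simp
  | succ c ih =>
    rw [List.replicate_succ, List.cons_append, digitsValue, ih, pow_succ]
    simp only [Bool.false_eq_true, if_false]
    field_simp
    ring

theorem highThreshold_value (c d k : ℕ) :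
    (highThreshold c d k).value = 1 / 2 + 1 / (4 * 2 ^ c * 2 ^ (d * halvings k)) := by
  simp only [highThreshold, BinaryFraction.value, List.cons_append, digitsValue,
    digitsValue_replicate, List.nil_append, Bool.false_eq_true, if_false, if_true]
  field_simp
  ring

theorem polyTime_lowThreshold : PolyTime Computability.unaryEncodeNat
    (fun r : BinaryFraction => bits r.code) lowThreshold :=
  ((polyTime_const [0, 0, 1, 2]).comp polyTime_unary_singleton).congr_right fun _ => rfl

theorem polyTime_highThreshold (c d : ℕ) : PolyTime Computability.unaryEncodeNat
    (fun r : BinaryFraction => bits r.code) (highThreshold c d) := by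
  have h : ∀ d, PolyTime bits bits
      (fun l : List ℕ => List.replicate (d * halvings (l.headD 0)) 0) := by
    intro d
    induction d with
    | zero => simpa using polyTime_const_nil
    | succ d ih =>
      refine (ih.bits_append polyTime_halvings).congr_right fun l => ?_
      rw [Nat.succ_mul, List.replicate_add]
  refine (((polyTime_const ([0, 0, 1] ++ List.replicate c 0)).bits_append
    ((h d).bits_append (polyTime_const [1, 2]))).comp polyTime_unary_singleton).congr_right
    fun k => ?_
  simp [highThreshold, BinaryFraction.code]

/-- The DQC1 threshold may depend only on the input length `k`, so it has to serve all `n ≤ k`. Both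
`2^a` and `p(n) + 1` are polynomial in `n + 1 ≤ 2^(halvings k + 1)`; constants are absorbed by `C ≤
2^C`. -/
theorem exists_threshold {anc : ℕ → ℕ} {p : Polynomial ℕ}
    (hlog : (fun n => (anc n : ℝ)) =O[atTop] (fun n : ℕ => Real.log n)) :
    ∃ c d : ℕ, ∀ n k a : ℕ, n ≤ k → a ≤ anc n →
      8 * 2 ^ a * (p.eval n + 1) ≤ 4 * 2 ^ c * 2 ^ (d * halvings k) := by
  obtain ⟨C, d, h⟩ := exists_two_pow_le hlog
  obtain ⟨C', d', h'⟩ := exists_eval_le p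
  refine ⟨2 * C * (C' + 1) + (d + d'), d + d', fun n k a hn ha => ?_⟩
  have hk : n + 1 ≤ 2 ^ (halvings k + 1) := by
    have := lt_pow_halvings k
    omega
  have h1 : 2 ^ a ≤ C * (2 ^ (halvings k + 1)) ^ d :=
    (Nat.pow_le_pow_right (by omega) ha).trans ((h n).trans
      (Nat.mul_le_mul_left _ (Nat.pow_le_pow_left hk _)))
  have h2 : p.eval n + 1 ≤ (C' + 1) * (2 ^ (halvings k + 1)) ^ d' := by
    have h3 : 1 ≤ (2 ^ (halvings k + 1)) ^ d' := Nat.one_le_pow _ _ (by positivity)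
    have h4 := (h' n).trans (Nat.mul_le_mul_left C' (Nat.pow_le_pow_left hk d'))
    rw [add_mul]
    omega
  have h5 : 2 * C * (C' + 1) ≤ 2 ^ (2 * C * (C' + 1)) := Nat.lt_two_pow_self.le
  calc 8 * 2 ^ a * (p.eval n + 1)
      ≤ 8 * (C * (2 ^ (halvings k + 1)) ^ d) * ((C' + 1) * (2 ^ (halvings k + 1)) ^ d') :=
        Nat.mul_le_mul (Nat.mul_le_mul_left _ h1) h2
    _ = 4 * (2 * C * (C' + 1)) * (2 ^ (d + d') * 2 ^ ((d + d') * halvings k)) := by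
        rw [← pow_mul, ← pow_mul, ← pow_add 2 (d + d')]
        have : (halvings k + 1) * d + (halvings k + 1) * d' =
          d + d' + (d + d') * halvings k := by ring
        rw [← this, pow_add]
        ring
    _ ≤ 4 * 2 ^ (2 * C * (C' + 1)) * (2 ^ (d + d') * 2 ^ ((d + d') * halvings k)) := by gcongr
    _ = _ := by rw [pow_add]; ring

/-- Compare the trace of the block with the midpoint of the thresholds. On yes-instances it is
larger by at least `δ - ε ≥ 1/(p(n) + 1)`; on no-instances it is not larger, so `1/2` itself can be
the lower threshold. -/
theorem traceEstimation_mem {anc : ℕ → ℕ} (size : Polynomial ℕ) {ε δ : ℕ → ℝ}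
    (hlog : (fun n => (anc n : ℝ)) =O[atTop] (fun n : ℕ => Real.log n))
    (hδ : ∃ p : Polynomial ℕ, ∀ n, ε n + 1 / (((p.eval n : ℕ) : ℝ) + 1) ≤ δ n) :
    traceEstimation anc size ε δ ∈ DQC1 := by
  obtain ⟨p, hp⟩ := hδ
  obtain ⟨c, d, hcd⟩ := exists_threshold (p := p) hlog
  obtain ⟨G, hG, hG'⟩ := exists_polyTime_traceCircuit
  -- The numbers `n`, `a` and of digits add up to at most the length of the description. With
  -- spacing `4` between positions, `4 * x.length + 40` mixed qubits have room for everything.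
  have hgen : PolyTime id bits (fun x => [4 * x.length + 40] ++ G (ofBits x)) := by
    refine PolyTime.bits_append ?_ (hG.comp polyTime_ofBits)
    simpa using (polyTime_affine 4 40).comp polyTime_length_singleton
  have key : ∀ I : TraceInstance, ∃ Q : Circuit (4 * I.describe.length + 40 + 1),
      bits ([4 * I.describe.length + 40] ++ G (ofBits I.describe)) = describe Q ∧
      acceptProb Q = 1 / 2 + ((topLeftBlock I.a I.circuit.toMatrix).trace.re / 2 ^ I.n -
        (I.lo.value + I.hi.value) / 2) / (8 * 2 ^ I.a) := by
    intro I
    have hlen : I.n + I.a + I.lo.digits.length + I.hi.digits.length ≤ I.describe.length := by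
      have h1 := length_le_length_bits (I.lo.code ++ I.hi.code ++ I.circuit.code)
      rw [TraceInstance.describe, length_bits_cons, length_bits_cons]
      simp [BinaryFraction.code] at h1
      simp [BinaryFraction.code]
      omega
    obtain ⟨Q, hQ, hQ'⟩ := exists_traceCircuit (m := 4 * I.describe.length + 40)
      (K := I.describe.length + 1) I.circuit I.lo I.hi
      (by simp [BinaryFraction.kinds]; omega) (by simp [BinaryFraction.kinds]; omega)
      (by omega) (by omega)
    refine ⟨Q, ?_, hQ'⟩
    rw [describe, Circuit.code_eq, hQ, TraceInstance.describe, ofBits_bits, Circuit.code_eq]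
    exact congrArg bits (congrArg _ (hG' I.n I.a I.lo I.hi I.circuit.raw))
  have hn : ∀ I : TraceInstance, I.n ≤ I.describe.length := by
    intro I
    rw [TraceInstance.describe, length_bits_cons]
    omega
  have hclose : ∀ (I : TraceInstance) (A : QOp I.n), I.Encodes ε A →
      |A.trace.re / 2 ^ I.n - (topLeftBlock I.a I.circuit.toMatrix).trace.re / 2 ^ I.n| ≤ ε I.n := by
    rintro I A ⟨-, -, hA⟩
    refine le_trans ?_ hA
    have := abs_trace_le (A - ((1 : ℝ) : ℂ) • topLeftBlock I.a I.circuit.toMatrix)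
    refine le_trans (le_of_eq ?_) this
    rw [← sub_div, abs_div, abs_of_pos (show (0 : ℝ) < 2 ^ I.n by positivity), Matrix.trace_sub,
      Complex.sub_re, Complex.ofReal_one, one_smul]
  refine ⟨fun x => bits ([4 * x.length + 40] ++ G (ofBits x)), lowThreshold, highThreshold c d,
    4 * 2 ^ c * (.X + 1) ^ d, hgen.congr_right fun _ => rfl, polyTime_lowThreshold,
    polyTime_highThreshold c d, fun k => ?_, ?_, ?_⟩
  · have h1 : (1 : ℝ) ≤ 2 ^ c := one_le_pow₀ (by norm_num)
    have h2 : (1 : ℝ) ≤ 2 ^ (d * halvings k) := one_le_pow₀ (by norm_num)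
    have h3 : (2 : ℝ) ≤ 4 * 2 ^ c * 2 ^ (d * halvings k) := by nlinarith
    rw [lowThreshold_value, highThreshold_value]
    refine ⟨by norm_num, ?_, ?_⟩
    · have : 1 / (4 * 2 ^ c * 2 ^ (d * halvings k)) ≤ (1 : ℝ) / 2 :=
        one_div_le_one_div_of_le (by norm_num) h3
      linarith
    · rw [add_sub_cancel_left]
      refine one_div_le_one_div_of_le (by positivity) ?_
      have : 4 * 2 ^ c * 2 ^ (d * halvings k) ≤
          Polynomial.eval k (4 * 2 ^ c * (.X + 1) ^ d : Polynomial ℕ) := by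
        simp only [Polynomial.eval_mul, Polynomial.eval_pow, Polynomial.eval_add, Polynomial.eval_X,
          Polynomial.eval_one, Polynomial.eval_ofNat]
        refine Nat.mul_le_mul_left _ ?_
        rw [mul_comm d, pow_mul]
        exact Nat.pow_le_pow_left (pow_halvings_le k) d
      have : ((4 * 2 ^ c * 2 ^ (d * halvings k) : ℕ) : ℝ) ≤
        (Polynomial.eval k (4 * 2 ^ c * (.X + 1) ^ d : Polynomial ℕ) : ℕ) := by exact_mod_cast this
      push_cast at this ⊢
      linarith
  · rintro x ⟨I, rfl, ⟨ha, -, hgap⟩, A, hA, hhi⟩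
    obtain ⟨Q, hQ, hQ'⟩ := key I
    refine ⟨_, Q, hQ, ?_⟩
    rw [hQ', highThreshold_value]
    have h1 := abs_le.1 (hclose I A hA)
    have h2 := hp I.n
    have h3 : 1 / ((p.eval I.n : ℕ) + 1 : ℝ) ≤
        (topLeftBlock I.a I.circuit.toMatrix).trace.re / 2 ^ I.n -
          (I.lo.value + I.hi.value) / 2 := by linarith
    have h4 : ((8 * 2 ^ I.a * (p.eval I.n + 1) : ℕ) : ℝ) ≤
        ((4 * 2 ^ c * 2 ^ (d * halvings I.describe.length) : ℕ) : ℝ) := by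
      exact_mod_cast hcd I.n _ I.a (hn I) ha
    push_cast at h4
    have h5 : 1 / (4 * 2 ^ c * 2 ^ (d * halvings I.describe.length)) ≤
        (1 : ℝ) / (8 * 2 ^ I.a * ((p.eval I.n : ℕ) + 1)) :=
      one_div_le_one_div_of_le (by positivity) h4
    have h6 : (1 : ℝ) / (8 * 2 ^ I.a * ((p.eval I.n : ℕ) + 1)) =
        1 / ((p.eval I.n : ℕ) + 1 : ℝ) / (8 * 2 ^ I.a) := by
      rw [div_div, mul_comm]
    rw [h6] at h5
    have h7 := div_le_div_of_nonneg_right h3 (show (0 : ℝ) ≤ 8 * 2 ^ I.a by positivity)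
    linarith
  · rintro x ⟨I, rfl, ⟨ha, -, hgap⟩, A, hA, hlo⟩
    obtain ⟨Q, hQ, hQ'⟩ := key I
    refine ⟨_, Q, hQ, ?_⟩
    rw [hQ', lowThreshold_value]
    have h1 := abs_le.1 (hclose I A hA)
    have h2 := hp I.n
    have h0 : 0 ≤ 1 / ((p.eval I.n : ℕ) + 1 : ℝ) := by positivity
    have h3 : (topLeftBlock I.a I.circuit.toMatrix).trace.re / 2 ^ I.n -
          (I.lo.value + I.hi.value) / 2 ≤ 0 := by linarith
    have h7 := div_nonpos_of_nonpos_of_nonneg h3 (show (0 : ℝ) ≤ 8 * 2 ^ I.a by positivity)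
    linarith

/-! ## A block-encoding of the acceptance operator -/

/-- A diagonal sign depending on the qubits `0` and `s`. -/
def signGate (s : ℕ) : List RGate := zGate s ++ [.h 0, .cx s 0, .h 0]

/-- `CNOT` between Hadamard gates on its target is a controlled `Z`. Together with `Z` on qubit `s`,
the sign is `-1` exactly if `s` is set and qubit `0` is not. -/
theorem run_signGate {s : ℕ} (hs : s ≠ 0) (ψ : (ℕ → Bool) → ℂ) (y : ℕ → Bool) :
    run (signGate s) ψ y = sgn (xor (y s) (y s && y 0)) * ψ y := by
  have hz : ∀ φ : (ℕ → Bool) → ℂ, run [.h 0, .cx s 0, .h 0] φ y = sgn (y s && y 0) * φ y := by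
    intro φ
    have hk : (Real.sqrt 2 : ℂ)⁻¹ * (Real.sqrt 2 : ℂ)⁻¹ * 2 = 1 := by
      rw [← mul_inv, sqrt_two_mul]; norm_num
    simp only [run_cons, run_nil, act, Function.update_self, Function.update_idem,
      Function.update_of_ne hs, div_eq_mul_inv]
    have e : Function.update y 0 (y 0) = y := Function.update_eq_self 0 y
    cases h0 : y 0 <;> cases h1 : y s <;> rw [h0] at e <;>
      simp only [Bool.false_eq_true, Bool.xor_false, Bool.xor_true, Bool.not_true, Bool.not_false,
        if_true, if_false, e, Bool.and_true, Bool.and_false, sgn]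
    all_goals generalize (Real.sqrt 2 : ℂ)⁻¹ = k at *; generalize φ y = a
    · generalize φ (Function.update y 0 true) = b
      linear_combination a * hk
    · generalize φ (Function.update y 0 true) = b
      linear_combination a * hk
    · generalize φ (Function.update y 0 false) = b
      linear_combination a * hk
    · generalize φ (Function.update y 0 false) = b
      linear_combination -a * hk
  rw [signGate, run_append, hz, run_zGate, ← mul_assoc, sgn_xor, mul_comm (sgn (y s))]

/-- The circuit `Q† S Q`. -/
def sandwich (s : ℕ) (l : List RGate) : List RGate := l ++ (signGate s ++ inv l)

theorem valid_signGate {M s : ℕ} (h0 : s ≠ 0) (hs : s < M) : ∀ g ∈ signGate s, g.Valid M := by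
  intro g hg
  simp only [signGate, zGate, List.mem_append, List.mem_cons, List.not_mem_nil, or_false] at hg
  rcases hg with (rfl | rfl | rfl | rfl) | rfl | rfl | rfl <;> simp only [Valid] <;> omega

theorem Valid.mono {M M' : ℕ} (h : M ≤ M') {g : RGate} (hg : g.Valid M) : g.Valid M' := by
  cases g <;> simp only [Valid] at hg ⊢ <;> omega

theorem valid_sandwich {M s : ℕ} {l : List RGate} (h0 : s ≠ 0) (hs : s < M)
    (hl : ∀ g ∈ l, g.Valid M) : ∀ g ∈ sandwich s l, g.Valid M := by
  intro g hg
  simp only [sandwich, List.mem_append] at hg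
  rcases hg with hg | hg | hg
  exacts [hl g hg, valid_signGate h0 hs g hg, valid_inv hl g hg]

theorem run_inv_sandwich {s : ℕ} (hs : s ≠ 0) (l : List RGate) (ψ : (ℕ → Bool) → ℂ) :
    run (inv (sandwich s l)) ψ = run (sandwich s l) ψ := by
  have h : ∀ ψ, run (signGate s) (run (signGate s) ψ) = ψ := by
    intro ψ
    funext y
    rw [run_signGate hs, run_signGate hs, ← mul_assoc, sgn_mul_self, one_mul]
  have h' : ∀ ψ, run (inv (signGate s)) ψ = run (signGate s) ψ := by
    intro ψ
    conv_lhs => rw [← h ψ]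
    exact run_inv_run (valid_signGate hs (Nat.lt_succ_self s)) _
  rw [sandwich, inv_append, inv_append, inv_inv, List.append_assoc, run_append, run_append, h',
    run_append, run_append]

/-- Qubit `m + 1` is untouched by `Q`. If it is clear, the sign gate is trivial and `Q† Q = 1`; if
it is set, the sign gate is `2Π - 1` for the accepting projector `Π`. -/
theorem run_sandwich_ket {m : ℕ} (Q : Circuit (m + 1)) (X : ℕ → Bool) (hX : X 0 = false) :
    (run (sandwich (m + 1) Q.raw) (ket X) X).re = if X (m + 1) = true then
      2 * (∑ y : Fin m → Bool, Complex.normSq (Q.toMatrix (Fin.cons true y)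
        (Fin.cons false fun i => X (i + 1)))) - 1 else 1 := by
  have hkeep : ∀ g ∈ Q.raw, g.Keeps (m + 1) := by
    intro g hg
    have := Q.raw_valid g hg
    cases g <;> simp only [Valid, Keeps] at this ⊢ <;> omega
  have hsupp : ∀ y, y (m + 1) ≠ X (m + 1) → run Q.raw (ket X) y = 0 := fun y hy =>
    run_eq_zero hkeep (fun z hz => by
      rw [ket, if_neg]
      rintro rfl
      exact hz rfl) y hy
  have hsign : run (signGate (m + 1)) (run Q.raw (ket X)) = fun y =>
      sgn (xor (X (m + 1)) (X (m + 1) && y 0)) * run Q.raw (ket X) y := by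
    funext y
    rw [run_signGate (by omega)]
    by_cases hy : y (m + 1) = X (m + 1)
    · rw [hy]
    · rw [hsupp y hy, mul_zero, mul_zero]
  rw [sandwich, run_append, run_append, hsign]
  cases hs : X (m + 1)
  · have : (fun y : ℕ → Bool => sgn (xor false (false && y 0)) * run Q.raw (ket X) y) =
        run Q.raw (ket X) := by
      funext y
      simp [sgn]
    rw [this, run_inv_run Q.raw_valid]
    simp [ket]
  · set w : Fin (m + 1) → Bool := Fin.cons false fun i : Fin m => X (i + 1) with hw
    have hXw : X = Function.extend Fin.val w X := by
      funext k
      by_cases hk : ∃ i : Fin (m + 1), (i : ℕ) = k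
      · obtain ⟨i, rfl⟩ := hk
        rw [Fin.val_injective.extend_apply]
        refine Fin.cases ?_ (fun i => ?_) i
        · simp [hw, hX]
        · simp [hw]
      · rw [Function.extend_apply' _ _ _ hk]
    have h1 := congrFun (restrict_run Q.inv X (fun y => sgn (xor true (true && y 0)) *
      run Q.raw (ket X) y)) w
    rw [restrict, ← hXw, Circuit.raw_inv] at h1
    have h2 : ∀ y, restrict (m + 1) X (fun y => sgn (xor true (true && y 0)) *
        run Q.raw (ket X) y) y = sgn (xor true (y 0)) * Q.toMatrix y w := by
      intro y
      rw [← run_extend Q w y X, ← hXw, restrict]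
      have : Function.extend Fin.val y X 0 = y 0 := Fin.val_injective.extend_apply y X 0
      rw [this, Bool.true_and]
    rw [h1, Matrix.mulVec, dotProduct, Circuit.toMatrix_inv]
    have hcol : ∑ y, Complex.normSq (Q.toMatrix y w) = 1 := by
      have := congrFun (congrFun Q.conjTranspose_mul_self w) w
      rw [Matrix.mul_apply, Matrix.one_apply_eq] at this
      simp only [Matrix.conjTranspose_apply, RCLike.star_def,
        ← Complex.normSq_eq_conj_mul_self] at this
      exact_mod_cast this
    have h3 : ∀ y, Q.toMatrix.conjTranspose w y * restrict (m + 1) X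
        (fun y => sgn (xor true (true && y 0)) * run Q.raw (ket X) y) y =
        ((rsgn (xor true (y 0)) * Complex.normSq (Q.toMatrix y w) : ℝ) : ℂ) := by
      intro y
      rw [h2, Matrix.conjTranspose_apply, RCLike.star_def, sgn_eq, Complex.ofReal_mul,
        Complex.normSq_eq_conj_mul_self]
      ring
    rw [Finset.sum_congr rfl fun y _ => h3 y, ← Complex.ofReal_sum, Complex.ofReal_re, sum_cons]
    rw [sum_cons] at hcol
    simp only [Fin.cons_zero, Bool.xor_false, Bool.xor_true, Bool.not_true, rsgn_true, rsgn_false,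
      ← Finset.mul_sum, if_true]
    linarith

/-- The clean qubit of `Q` becomes the ancilla. Averaging over the selector gives `(1 + (2p - 1))/2
= p` for each initial state, and averaging over the mixed qubits gives the acceptance probability.
The block is Hermitian because `Q† S Q` is. -/
theorem exists_blockEncoding {m n : ℕ} (Q : Circuit (m + 1)) (hn : m + 1 ≤ n) :
    ∃ U : Circuit (1 + n), U.raw = sandwich (m + 1) Q.raw ∧
      (topLeftBlock 1 U.toMatrix).IsHermitian ∧
      (topLeftBlock 1 U.toMatrix).trace.re / 2 ^ n = acceptProb Q := by
  obtain ⟨U, hU⟩ := exists_circuit (n := 1 + n) (l := sandwich (m + 1) Q.raw)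
    (valid_sandwich (by omega) (by omega) fun g hg => Valid.mono (by omega) (Q.raw_valid g hg))
  refine ⟨U, hU, ?_, ?_⟩
  · have : U.toMatrix.conjTranspose = U.toMatrix := by
      rw [← Circuit.toMatrix_inv]
      ext y x
      rw [toMatrix_eq_run, toMatrix_eq_run, Circuit.raw_inv, hU, run_inv_sandwich (by omega)]
    ext y x
    exact congrFun (congrFun this (Fin.append (fun _ => false) y)) (Fin.append (fun _ => false) x)
  · let p : (Fin m → Bool) → ℝ := fun x =>
      ∑ y : Fin m → Bool, Complex.normSq (Q.toMatrix (Fin.cons true y) (Fin.cons false x))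
    -- The selector, qubit `m + 1`, comes first and the mixed qubits of `Q` follow; indices drop by
    -- one because the ancilla is not among the `n` qubits.
    let f : Fin (m + 1) → Fin n := Fin.cons ⟨m, by omega⟩ fun i => ⟨i, by omega⟩
    have hf : Function.Injective f := by
      intro i j
      refine Fin.cases ?_ (fun i => ?_) i <;> refine Fin.cases ?_ (fun j => ?_) j <;>
        simp [f, Fin.ext_iff] <;> omega
    let F : (Fin (m + 1) → Bool) → ℝ := fun x =>
      if x 0 = true then 2 * p (Fin.tail x) - 1 else 1
    have hw : ∀ w : Fin n → Bool, (topLeftBlock 1 U.toMatrix w w).re = F fun i => w (f i) := by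
      intro w
      set X := pad (Fin.append (fun _ : Fin 1 => false) w) with hX
      have hX0 : X 0 = false := by
        rw [hX, pad_of_lt _ (by omega)]
        exact Fin.append_left (fun _ : Fin 1 => false) w 0
      have hXi : ∀ i : Fin n, X (i + 1) = w i := by
        intro i
        rw [hX, pad_of_lt _ (by omega)]
        have := Fin.append_right (fun _ : Fin 1 => false) w i
        rw [← this]
        congr 1
        ext
        simp [add_comm]
      have h1 : topLeftBlock 1 U.toMatrix w w = run (sandwich (m + 1) Q.raw) (ket X) X := by
        rw [← hU]
        exact toMatrix_eq_run U _ _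
      rw [h1, run_sandwich_ket Q X hX0]
      have h2 : X (m + 1) = w (f 0) := hXi ⟨m, by omega⟩
      have h3 : (fun i : Fin m => X (i + 1)) = Fin.tail fun i => w (f i) := by
        funext i
        exact hXi ⟨i, by omega⟩
      rw [h2, h3]
    have havg := sum_comp_injective hf F
    rw [Fintype.card_fin, Fintype.card_fin] at havg
    rw [Matrix.trace, Complex.re_sum]
    simp only [Matrix.diag_apply, hw]
    rw [havg, acceptProb_eq, sum_cons]
    simp only [F, Fin.cons_zero, Fin.tail_cons, Bool.false_eq_true, if_false, if_true,
      Finset.sum_sub_distrib, ← Finset.mul_sum, pow_succ, p]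
    rw [mul_comm ((2 : ℝ) ^ m), ← div_div]
    congr 1
    ring

/-! ## Writing down the instance -/

/-- The rules for the reversed code of the inverse gate. -/
def invRule : ℕ → Rule
  | 0 => ⟨1, [(1, 1, 0), (0, 0, 0)]⟩
  | 1 => ⟨1, [(1, 1, 0), (0, 0, 2)]⟩
  | 2 => ⟨1, [(1, 1, 0), (0, 0, 1)]⟩
  | 3 => ⟨2, [(2, 1, 0), (1, 1, 0), (0, 0, 3)]⟩
  | _ => ⟨3, [(3, 1, 0), (2, 1, 0), (1, 1, 0), (0, 0, 4)]⟩

/-- Inversion reverses the order of the gates but not the entries within a code. The rules emit each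
code backwards, and the final reversal repairs it. -/
theorem transduce_invRule (j : ℕ) (l : List RGate) :
    (transduce [invRule 0, invRule 1, invRule 2, invRule 3] (invRule 4) j (codes l)).reverse =
      codes (inv l) := by
  induction l generalizing j with
  | nil => simp [transduce, codes, inv]
  | cons g l ih =>
    have h : inv (g :: l) = inv l ++ [g.conj] := by simp [inv]
    rw [h, codes_append, codes_cons, ← ih (j + 1)]
    cases g <;> simp [RGate.code, transduce, Rule.eval, invRule, codes, RGate.conj]

theorem exists_polyTime_sandwich : ∃ G : List ℕ → List ℕ, PolyTime bits bits G ∧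
    ∀ (m : ℕ) (l : List RGate), G (m :: codes l) = codes (sandwich (m + 1) l) := by
  have s := polyTime_affine 1 1
  have c1 := polyTime_const [1]
  refine ⟨_, polyTime_tail.bits_append ((c1.bits_append (s.bits_append (c1.bits_append
    (s.bits_append (c1.bits_append (s.bits_append (c1.bits_append (s.bits_append
    ((polyTime_const [0, 0, 3]).bits_append (s.bits_append
    (polyTime_const [0, 0, 0]))))))))))).bits_append
    ((polyTime_transduce_reverse [invRule 0, invRule 1, invRule 2, invRule 3] (invRule 4)
    (by simp [invRule])).comp polyTime_tail)), fun m l => ?_⟩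
  simp only [List.tail_cons, List.headD_cons, transduce_invRule, sandwich, codes_append]
  simp [signGate, zGate, codes, RGate.code]

/-- The base is the length of a concatenated string, and repeated squaring raises it to the exponent
`2 ^ r`. -/
theorem polyTime_size {gen : List Bool → List Bool} (hgen : PolyTime id id gen) (N r : ℕ) :
    PolyTime id bits (fun x => [(x.length + (gen x).length + N) ^ 2 ^ r]) := by
  induction r with
  | zero =>
    have h1 := polyTime_replicate.comp polyTime_length_singleton
    have h2 : PolyTime id id (fun x => bits (List.replicate x.length 0 ++
        (List.replicate (gen x).length 0 ++ List.replicate N 0))) :=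
      (h1.bits_append ((h1.comp hgen).bits_append
        ((polyTime_const (List.replicate N 0)).comp polyTime_length_singleton))).congr_right
        fun x => by simp
    refine (polyTime_length_singleton.comp h2).congr_right fun x => ?_
    have h3 : ∀ j, bits (List.replicate j 0) = List.replicate j false := by
      intro j
      induction j with
      | zero => rfl
      | succ j ih => rw [List.replicate_succ, bits_zero_cons, ih, List.replicate_succ]
    simp [h3, add_assoc]
  | succ r ih =>
    refine (polyTime_square.comp ih).congr_right fun x => ?_
    rw [List.headD_cons, pow_succ, pow_mul, sq]

theorem length_le_of_describe {m : ℕ} (Q : Circuit (m + 1)) :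
    m + Q.length ≤ (describe Q).length := by
  have h1 := length_le_length_bits Q.code
  have h2 : ∀ C : Circuit (m + 1), C.length ≤ C.code.length := by
    intro C
    induction C with
    | nil => simp
    | cons g C ih =>
      have : 1 ≤ g.code.length := by cases g <;> simp [Gate.code]
      rw [Circuit.code, List.flatMap_cons, ← Circuit.code, List.length_append, List.length_cons]
      omega
  have := h2 Q
  rw [describe, length_bits_cons]
  omega

/-- Choose `r` with `γ * 2 ^ r ≥ d + 1`, where `p(k) + 1 ≤ (c + 1) s^d`. Then `δ(s^(2^r))` is at
most `|K| / s^(d+1)`, and the spare factor `s` absorbs the constant `2 |K| (c + 1)`. -/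
theorem exists_accuracy {δ : ℕ → ℝ} (p : Polynomial ℕ)
    (hδ : ∃ γ : ℝ, 0 < γ ∧ δ =O[atTop] (fun n : ℕ => (n : ℝ) ^ (-γ))) :
    ∃ N r : ℕ, ∀ s k : ℕ, N ≤ s → k < s →
      2 * δ (s ^ 2 ^ r) ≤ 1 / (((p.eval k : ℕ) : ℝ) + 1) := by
  obtain ⟨γ, hγ, hO⟩ := hδ
  obtain ⟨K, hK⟩ := hO.bound
  obtain ⟨N, hN⟩ := eventually_atTop.1 hK
  obtain ⟨c, d, hp⟩ := exists_eval_le p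
  obtain ⟨r, hr⟩ : ∃ r : ℕ, ((d + 1 : ℕ) : ℝ) ≤ γ * 2 ^ r := by
    obtain ⟨r, hr⟩ := pow_unbounded_of_one_lt (((d + 1 : ℕ) : ℝ) / γ) (one_lt_two (α := ℝ))
    exact ⟨r, by rw [mul_comm]; exact ((div_lt_iff₀ hγ).1 hr).le⟩
  refine ⟨N + ⌈2 * |K| * (c + 1)⌉₊ + 1, r, fun s k hs hk => ?_⟩
  have hs1 : 1 ≤ s := by omega
  have hsR : (1 : ℝ) ≤ s := by exact_mod_cast hs1
  have hsN : N ≤ s ^ 2 ^ r := by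
    have : s ≤ s ^ 2 ^ r := Nat.le_self_pow (by positivity) s
    omega
  have h1 := hN _ hsN
  have h2 : ((s ^ 2 ^ r : ℕ) : ℝ) ^ (-γ) ≤ 1 / (s : ℝ) ^ (d + 1) := by
    rw [Nat.cast_pow, ← Real.rpow_natCast (s : ℝ) (2 ^ r), ← Real.rpow_mul (by positivity), one_div,
      ← Real.rpow_natCast (s : ℝ) (d + 1), ← Real.rpow_neg (by positivity)]
    refine Real.rpow_le_rpow_of_exponent_le hsR ?_
    push_cast at hr ⊢
    nlinarith
  have h3 : δ (s ^ 2 ^ r) ≤ |K| * (1 / (s : ℝ) ^ (d + 1)) := by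
    refine (le_abs_self _).trans (h1.trans ?_)
    rw [Real.norm_of_nonneg (Real.rpow_nonneg (Nat.cast_nonneg _) _)]
    exact mul_le_mul (le_abs_self K) h2 (Real.rpow_nonneg (Nat.cast_nonneg _) _) (abs_nonneg K)
  have h4 : ((p.eval k : ℕ) : ℝ) + 1 ≤ (c + 1) * (s : ℝ) ^ d := by
    have h5 : p.eval k ≤ c * s ^ d :=
      (hp k).trans (Nat.mul_le_mul_left _ (Nat.pow_le_pow_left hk d))
    have h6 : ((p.eval k : ℕ) : ℝ) ≤ c * (s : ℝ) ^ d := by exact_mod_cast h5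
    have h7 : (1 : ℝ) ≤ (s : ℝ) ^ d := one_le_pow₀ hsR
    linarith
  have h5 : 2 * |K| * (c + 1) ≤ s := by
    have h6 : ⌈2 * |K| * (c + 1)⌉₊ ≤ s := by omega
    exact (Nat.le_ceil _).trans (by exact_mod_cast h6)
  rw [le_div_iff₀ (by positivity)]
  have hsp : (0 : ℝ) < (s : ℝ) ^ d := by positivity
  calc 2 * δ (s ^ 2 ^ r) * (((p.eval k : ℕ) : ℝ) + 1)
      ≤ 2 * (|K| * (1 / (s : ℝ) ^ (d + 1))) * (((p.eval k : ℕ) : ℝ) + 1) := by gcongr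
    _ ≤ 2 * (|K| * (1 / (s : ℝ) ^ (d + 1))) * ((c + 1) * (s : ℝ) ^ d) := by gcongr
    _ = 2 * |K| * (c + 1) / s := by
      rw [pow_succ]
      field_simp
    _ ≤ 1 := by rw [div_le_one (by linarith)]; exact h5

theorem reduces_traceEstimation {anc : ℕ → ℕ} {size : Polynomial ℕ} {ε δ : ℕ → ℝ}
    (hanc : ∀ n, 1 ≤ anc n) (hsize : ∀ n, n ≤ size.eval n) (hε : ∀ n, 0 ≤ ε n)
    (hδ : ∃ γ : ℝ, 0 < γ ∧ δ =O[atTop] (fun n : ℕ => (n : ℝ) ^ (-γ)))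
    {L : PromiseProblem} (hL : L ∈ DQC1) : Reduces L (traceEstimation anc size ε δ) := by
  obtain ⟨gen, a, b, p, hgen, ha, hb, hab, hyes, hno⟩ := hL
  obtain ⟨N, r, hN⟩ := exists_accuracy p hδ
  obtain ⟨G, hG, hG'⟩ := exists_polyTime_sandwich
  let s : List Bool → ℕ := fun x => x.length + (gen x).length + (N + 10)
  -- The accuracy bound is applied to `s x ^ 2`. The additional squaring ensures `n ≥ 2 * |gen x| +
  -- 20` even for `r = 0`, which covers the `2 * |Q| + 7` gates and the `m + 1` qubits.
  let n : List Bool → ℕ := fun x => s x ^ 2 ^ (r + 1)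
  have hN' : ∀ x, 2 * δ (n x) ≤ (b x.length).value - (a x.length).value := by
    intro x
    refine le_trans ?_ (hab x.length).2.2
    have h1 : s x ≤ s x ^ 2 := Nat.le_self_pow (by norm_num) _
    have h2 := hN (s x ^ 2) x.length (by simp only [s] at h1 ⊢; omega)
      (by simp only [s] at h1 ⊢; omega)
    rwa [← pow_mul, ← pow_succ'] at h2
  have hn : ∀ x, 2 * (gen x).length + 20 ≤ n x := by
    intro x
    have h1 : 2 * s x ≤ s x * s x := Nat.mul_le_mul_right _ (by simp only [s]; omega)
    have h2 : s x * s x ≤ n x := by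
      rw [← sq]
      exact Nat.pow_le_pow_right (by simp only [s]; omega)
        (by rw [pow_succ']; have := Nat.one_le_two_pow (n := r); omega)
    simp only [s] at h1 h2
    omega
  let f : List Bool → List Bool := fun x => bits ([n x] ++ ([1] ++ ((a x.length).code ++
    ((b x.length).code ++ G (ofBits (gen x))))))
  have hf : PolyTime id id f := by
    have ha' : PolyTime id bits (fun x : List Bool => (a x.length).code) :=
      (ha.comp polyTime_length).congr_right fun _ => rfl
    have hb' : PolyTime id bits (fun x : List Bool => (b x.length).code) :=
      (hb.comp polyTime_length).congr_right fun _ => rfl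
    exact ((polyTime_size hgen (N + 10) (r + 1)).bits_append
      (((polyTime_const [1]).comp polyTime_length_singleton).bits_append (ha'.bits_append
        (hb'.bits_append ((hG.comp polyTime_ofBits).comp hgen))))).congr_right fun x => rfl
  have key : ∀ (x : List Bool) (m : ℕ) (Q : Circuit (m + 1)), gen x = describe Q →
      ∃ I : TraceInstance, f x = I.describe ∧ I.Admissible anc size δ ∧
        (∃ A, I.Encodes ε A ∧ A.trace.re / 2 ^ I.n = acceptProb Q) ∧
        I.lo = a x.length ∧ I.hi = b x.length := by
    intro x m Q hQ
    have hlen := length_le_of_describe Q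
    rw [← hQ] at hlen
    have hnx := hn x
    obtain ⟨U, hU, hH, hT⟩ := exists_blockEncoding (n := n x) Q (by omega)
    refine ⟨⟨n x, 1, U, a x.length, b x.length⟩, ?_, ⟨hanc _, ?_, hN' x⟩,
      ⟨topLeftBlock 1 U.toMatrix, ⟨hH, U.mem_unitaryGroup, ?_⟩, hT⟩, rfl, rfl⟩
    · simp only [f, TraceInstance.describe, hQ, describe, ofBits_bits, Circuit.code_eq, hU]
      refine congrArg bits ?_
      have := hG' m Q.raw
      simp only [codes] at this
      rw [this]
      simp
    · refine le_trans ?_ (hsize _)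
      have : U.length = U.raw.length := by simp [Circuit.raw]
      change U.length ≤ n x
      rw [this, hU]
      simp [sandwich, signGate, zGate, inv, Circuit.raw]
      omega
    -- The encoded matrix is the block itself, so the encoding is exact and any `ε ≥ 0` is
    -- admissible.
    · rw [Complex.ofReal_one, one_smul, sub_self, map_zero, norm_zero]
      exact hε _
  refine ⟨f, hf, fun x hx => ?_, fun x hx => ?_⟩
  · obtain ⟨m, Q, hQ, hacc⟩ := hyes x hx
    obtain ⟨I, hI, hadm, ⟨A, hA, hAt⟩, -, hhi⟩ := key x m Q hQ
    exact ⟨I, hI, hadm, A, hA, by rw [hAt, hhi]; exact hacc⟩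
  · obtain ⟨m, Q, hQ, hacc⟩ := hno x hx
    obtain ⟨I, hI, hadm, ⟨A, hA, hAt⟩, hlo, -⟩ := key x m Q hQ
    exact ⟨I, hI, hadm, A, hA, by rw [hAt, hlo]; exact hacc⟩

end DQC

end

/-! ### Completeness -/

theorem theorem4p6 (anc : ℕ → ℕ) (size : Polynomial ℕ) (ε δ : ℕ → ℝ)
    (hanc : ∀ n, 1 ≤ anc n)
    (hlog : (fun n => (anc n : ℝ)) =O[atTop] (fun n : ℕ => Real.log n))
    (hsize : ∀ n, n ≤ size.eval n)
    (hε : ∀ n, 0 ≤ ε n)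
    (hδ : ∃ p : Polynomial ℕ, ∀ n, ε n + 1 / (((p.eval n : ℕ) : ℝ) + 1) ≤ δ n)
    (hδ' : ∃ γ : ℝ, 0 < γ ∧ δ =O[atTop] (fun n : ℕ => (n : ℝ) ^ (-γ))) :
    DQC.DQC1Complete (DQC.traceEstimation anc size ε δ) := by
  exact ⟨DQC.traceEstimation_mem size hlog hδ, fun _ hL =>
    DQC.reduces_traceEstimation hanc hsize hε hδ' hL⟩
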